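/- **Setting.** Let $d\ge 1$, $\nu\ge 1$ be integers, $\lambda,\mu\in\mathbf R$, $\eta_1,\dots,\eta_d\in\{-1,1\}$, and $\Delta_\eta=\sum_{m=1}^d\eta_m\partial_{x_m}^2$. Let $K\in\mathcal S'(\mathbf R^d)$ be such that $\widehat K$ is a function homogeneous of degree $0$ and continuous on $\mathbf R^d\setminus\{0\}$, and let $E(f)=K*f$, i.e. $\widehat{E(f)}=\widehat K\,\widehat f$. Let $W\cap L^2=\{f\in L^2(\mathbf R^d):\widehat f\in L^1\}$, with $\|f\|_{W\cap L^2}=\|\widehat f\|_{L^1}+\|f\|_{L^2}$ and $\|f\|_{L^\infty\cap L^2}=\|f\|_{L^\infty}+\|f\|_{L^2}$, where the Fourier transform is $\widehat f(\xi)=\int f(x)e^{-2\pi i x\cdot\xi}\,dx$. **Initial data.** Let $J_0\subseteq\mathbf N$ and, for $j\in J_0$, let $\kappa_j\in\mathbf Z^d$ and $\alpha_j\in\mathcal S(\mathbf R^d,\mathbf C)$ satisfy $$\sum_{j\in J_0}(1+|\kappa_j|^2)\|\widehat\alpha_j\|_{L^1\cap L^2}+\sum_{j\in J_0}\|\widehat{\Delta\alpha_j}\|_{L^1\cap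 L^2}<\infty .$$ For $\varepsilon>0$ consider the Cauchy problem $$i\varepsilon\partial_tu^\varepsilon+\tfrac{\varepsilon^2}{2}\Delta_\eta u^\varepsilon=\varepsilon\lambda E(|u^\varepsilon|^{2\nu})u^\varepsilon+\varepsilon\mu|u^\varepsilon|^{2\nu}u^\varepsilon,\qquad u^\varepsilon(0,x)=\sum_{j\in J_0}\alpha_j(x)e^{i\kappa_j\cdot x/\varepsilon}. \tag{1}$$ **Phases, resonances, amplitudes.** For $k\in\mathbf Z^d$ let $\phi_k(t,x)=k\cdot x-\frac t2\sum_{m}\eta_mk_m^2$. Let $\Phi\subseteq\mathbf Z^d$ be the smallest set that contains all $\kappa_j$ and that contains $k\in\mathbf Z^d$ whenever $\phi_k=\phi_{\ell_1}-\phi_{\ell_2}+\dots+\phi_{\ell_{2\nu+1}}$ for some $\ell_1,\dots,\ell_{2\nu+1}\in\Phi$. For $k\in\Phi$ let $I_k$ be the set of all $(\ell_1,\dots,\ell_{2\nu+1})\in\Phi^{2\nu+1}$ with $\phi_k=\phi_{\ell_1}-\phi_{\ell_2}+\dots+\phi_{\ell_{2\nu+1}}$. Let $X$ be the space of families $a=(a_k)_{k\in\Phi}$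 with $\|a\|_X=\sum_{k\in\Phi}\|a_k\|_{W\cap L^2}<\infty$. The resonant transport system is, for $k\in\Phi$, $$\begin{aligned}\partial_ta_k+\sum_{m=1}^d\eta_mk_m\partial_{x_m}a_k=&-i\lambda\sum_{(\ell_1,\dots,\ell_{2\nu},k)\in I_k}E(a_{\ell_1}\overline a_{\ell_2}\cdots\overline a_{\ell_{2\nu}})\,a_k\\&-i\lambda\sum_{(\ell_1,\dots,\ell_{2\nu+1})\in I_k,\ \ell_{2\nu+1}\ne k}\widehat K(k-\ell_{2\nu+1})\,a_{\ell_1}\overline a_{\ell_2}\cdots a_{\ell_{2\nu+1}}\\&-i\mu\sum_{(\ell_1,\dots,\ell_{2\nu+1})\in I_k}a_{\ell_1}\overline a_{\ell_2}\cdots a_{\ell_{2\nu+1}},\qquad a_k(0,\cdot)=\sum_{j\in J_0:\ \kappa_j=k}\alpha_j .\end{aligned}\tag{2}$$ Solutions of (1) and (2) are understood in the sense of Duhamel's formula in $L^2$. **Theorem.** There is $T>0$ such that (2) has a solution $a\in C([0,T];X)$. Moreover, let $T>0$ be any time for which (2) has a solution $a\in C([0,T];X)$. Then this solution is unique, for every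 $\varepsilon>0$ the function $$u^\varepsilon_{\rm app}(t,x)=\sum_{k\in\Phi}a_k(t,x)e^{i\phi_k(t,x)/\varepsilon}$$ belongs to $C([0,T];W\cap L^2)$ and to $C([0,T];L^\infty\cap L^2)$, and there are $\varepsilon_0,C>0$ such that for every $\varepsilon\in(0,\varepsilon_0]$ the problem (1) has a unique solution $u^\varepsilon\in C([0,T];L^\infty\cap L^2)$; this solution belongs to $C([0,T];W\cap L^2)$, and $$\sup_{t\in[0,T]}\|u^\varepsilon(t)-u^\varepsilon_{\rm app}(t)\|_{L^\infty\cap L^2}\le\sup_{t\in[0,T]}\|u^\varepsilon(t)-u^\varepsilon_{\rm app}(t)\|_{W\cap L^2}=:\delta(\varepsilon),$$ where $\delta(\varepsilon)\to0$ as $\varepsilon\to0$ if $\lambda\neq0$, and $\delta(\varepsilon)\le C\varepsilon$ for all $\varepsilon\in(0,\varepsilon_0]$ if $\lambda=0$. -/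

import Mathlib

open MeasureTheory Filter Topology Set FourierTransform SchwartzMap Laplacian
open scoped ENNReal ComplexConjugate

noncomputable section

namespace MultiphaseNLS

/-- The physical space `ℝ^d` with its Euclidean norm. -/
abbrev Space (d : ℕ) : Type := EuclideanSpace ℝ (Fin d)

/-- The Hilbert space `L²(ℝ^d, ℂ)`. Mathlib's Fourier transform `𝓕` on it is the isometry that
extends `f ↦ (ξ ↦ ∫ f(x) e^{-2πi x·ξ} dx)`. -/
abbrev L2 (d : ℕ) : Type := Lp ℂ 2 (volume : Measure (Space d))

open Classical in
/-- The class in `L²` of a square integrable function (and `0` for any other function). -/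
def toL2 {d : ℕ} (f : Space d → ℂ) : L2 d :=
  if h : MemLp f 2 volume then h.toLp f else 0

/-! ### Fourier multipliers -/

/-- The Fourier multiplier `f ↦ 𝓕⁻¹(m · 𝓕 f)` on `L²`, for a bounded measurable symbol `m`. -/
def multiplier {d : ℕ} (m : Space d → ℂ) (f : L2 d) : L2 d :=
  𝓕⁻ (toL2 (fun ξ => m ξ * (𝓕 f : L2 d) ξ))

/-- `K` is a tempered distribution whose Fourier transform is (the distribution given by) the
function `Khat`, which is homogeneous of degree zero and continuous away from the origin.
The operator `E f = K ∗ f` is then `multiplier Khat`. -/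
structure IsDegreeZeroKernel {d : ℕ} (K : 𝓢'(Space d, ℂ)) (Khat : Space d → ℂ) : Prop where
  fourier_eq : ∀ φ : 𝓢(Space d, ℂ), (𝓕 K : 𝓢'(Space d, ℂ)) φ = ∫ ξ, φ ξ * Khat ξ
  homogeneous : ∀ r : ℝ, 0 < r → ∀ ξ : Space d, ξ ≠ 0 → Khat (r • ξ) = Khat ξ
  continuousOn : ContinuousOn Khat {0}ᶜ

/-- The free group `U^ε(t) = exp(i ε (t/2) Δ_η)` with `Δ_η = ∑ η_m ∂_m²`;
the symbol of `∂_m` is `2πi ξ_m`. -/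
def schrodingerGroup {d : ℕ} (η : Fin d → ℤ) (ε t : ℝ) : L2 d → L2 d :=
  multiplier (fun ξ => Complex.exp
    (-(Complex.I * ((ε * t / 2 * ∑ m, (η m : ℝ) * (2 * Real.pi * ξ m) ^ 2 : ℝ) : ℂ))))

/-- The transport group `exp(-t ∑ η_m k_m ∂_m)`, i.e. `f ↦ f(· - t (η_m k_m)_m)`. -/
def transportGroup {d : ℕ} (η : Fin d → ℤ) (k : Fin d → ℤ) (t : ℝ) : L2 d → L2 d :=
  multiplier (fun ξ => Complex.exp
    (-(Complex.I * ((t * ∑ m, (η m : ℝ) * (k m : ℝ) * (2 * Real.pi * ξ m) : ℝ) : ℂ))))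

/-! ### Function spaces -/

/-- The norm of `L^∞ ∩ L²`. -/
def linftyL2Norm {d : ℕ} (f : L2 d) : ℝ≥0∞ :=
  eLpNorm f ∞ volume + eLpNorm f 2 volume

/-- The norm of `W ∩ L²`, where `‖f‖_W` is the `L¹` norm of the Fourier transform of `f`. -/
def wienerL2Norm {d : ℕ} (f : L2 d) : ℝ≥0∞ :=
  eLpNorm (𝓕 f : L2 d) 1 volume + eLpNorm f 2 volume

/-- The norm of `X`, i.e. of families in `ℓ¹(Φ; W ∩ L²)`. -/
def profileNorm {d : ℕ} {Φ : Set (Fin d → ℤ)} (a : Φ → L2 d) : ℝ≥0∞ :=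
  ∑' k : Φ, wienerL2Norm (a k)

/-- `u ∈ C([0,T]; Z)`, where `Z` is the space of elements with finite (extended) norm `N`. -/
def ContinuousInNorm {V : Type*} [Sub V] (N : V → ℝ≥0∞) (T : ℝ) (u : ℝ → V) : Prop :=
  ∀ t ∈ Icc 0 T, N (u t) < ∞ ∧ Tendsto (fun s => N (u s - u t)) (𝓝[Icc 0 T] t) (𝓝 0)

/-! ### The nonlinear Schrödinger equation -/

/-- `λ E(|u|^{2ν}) u + μ |u|^{2ν} u`. -/
def nlsNonlinearity {d : ℕ} (ν : ℕ) (lam mu : ℝ) (Khat : Space d → ℂ) (u : L2 d) : L2 d :=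
  toL2 (fun x =>
    (lam : ℂ) * multiplier Khat (toL2 (fun y => ((‖u y‖ ^ (2 * ν) : ℝ) : ℂ))) x * u x
      + (mu : ℂ) * ((‖u x‖ ^ (2 * ν) : ℝ) : ℂ) * u x)

/-- `u` solves `iε ∂_t u + (ε²/2) Δ_η u = ε λ E(|u|^{2ν}) u + ε μ |u|^{2ν} u`, `u(0) = u₀`, on
`[0,T]`, in the sense of Duhamel's formula in `L²`. -/
structure IsNLSSolution {d : ℕ} (ν : ℕ) (lam mu : ℝ) (η : Fin d → ℤ) (Khat : Space d → ℂ)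
    (ε T : ℝ) (u₀ : L2 d) (u : ℝ → L2 d) : Prop where
  init : u 0 = u₀
  duhamel : ∀ t ∈ Icc 0 T, u t = schrodingerGroup η ε t u₀
    - Complex.I • ∫ τ in (0 : ℝ)..t,
        schrodingerGroup η ε (t - τ) (nlsNonlinearity ν lam mu Khat (u τ))

/-- The initial datum `∑_j α_j(x) e^{i κ_j·x/ε}`, as a sum in `L²`. -/
def initialDatum {d : ℕ} {J₀ : Set ℕ} (κ : J₀ → Fin d → ℤ) (α : J₀ → 𝓢(Space d, ℂ)) (ε : ℝ) :
    L2 d :=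
  ∑' j : J₀, toL2 (fun x =>
    α j x * Complex.exp (Complex.I * (((∑ m, (κ j m : ℝ) * x m) / ε : ℝ) : ℂ)))

/-- `∑_j ⟨κ_j⟩² ‖(α_j)^‖_{L¹∩L²} + ∑_j ‖(Δ α_j)^‖_{L¹∩L²} < ∞`. -/
def SummableAmplitudes {d : ℕ} {J₀ : Set ℕ} (κ : J₀ → Fin d → ℤ) (α : J₀ → 𝓢(Space d, ℂ)) :
    Prop :=
  (∑' j : J₀, ENNReal.ofReal (1 + ∑ m, (κ j m : ℝ) ^ 2) *
      (eLpNorm (𝓕 (α j) : 𝓢(Space d, ℂ)) 1 volume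
        + eLpNorm (𝓕 (α j) : 𝓢(Space d, ℂ)) 2 volume))
    + (∑' j : J₀, (eLpNorm (𝓕 (Δ (α j)) : 𝓢(Space d, ℂ)) 1 volume
        + eLpNorm (𝓕 (Δ (α j)) : 𝓢(Space d, ℂ)) 2 volume)) < ∞

/-! ### Phases and resonances -/

/-- The quadratic form `∑ η_m k_m²`. -/
def quadForm {d : ℕ} (η : Fin d → ℤ) (k : Fin d → ℤ) : ℤ := ∑ m, η m * k m ^ 2

/-- The characteristic phase `k·x - (t/2) ∑ η_m k_m²`. -/
def phase {d : ℕ} (η : Fin d → ℤ) (k : Fin d → ℤ) (t : ℝ) (x : Space d) : ℝ :=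
  ∑ m, (k m : ℝ) * x m - t / 2 * ∑ m, (η m : ℝ) * (k m : ℝ) ^ 2

/-- The phases of the wave vectors `ℓ_1, …, ℓ_n` satisfy
`φ_{ℓ_1} - φ_{ℓ_2} + φ_{ℓ_3} - ⋯ = φ_k`. -/
def Resonant {d n : ℕ} (η : Fin d → ℤ) (ℓ : Fin n → Fin d → ℤ) (k : Fin d → ℤ) : Prop :=
  ∑ i : Fin n, (-1) ^ (i : ℕ) • ℓ i = k ∧
    ∑ i : Fin n, (-1) ^ (i : ℕ) * quadForm η (ℓ i) = quadForm η k

/-- Wave vectors generated from `Φ₀` by finitely many resonant interactions of `2ν+1` phases. -/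
inductive IsRelevant {d : ℕ} (ν : ℕ) (η : Fin d → ℤ) (Φ₀ : Set (Fin d → ℤ)) :
    (Fin d → ℤ) → Prop
  | init (k : Fin d → ℤ) (hk : k ∈ Φ₀) : IsRelevant ν η Φ₀ k
  | resonance (ℓ : Fin (2 * ν + 1) → Fin d → ℤ) (k : Fin d → ℤ)
      (hℓ : ∀ i, IsRelevant ν η Φ₀ (ℓ i)) (hk : Resonant η ℓ k) : IsRelevant ν η Φ₀ k

/-- The set `Φ` of relevant wave vectors: the smallest set that contains `Φ₀` and is stable under
the resonance condition. It serves as index set for phases and amplitudes. -/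
def relevantSet {d : ℕ} (ν : ℕ) (η : Fin d → ℤ) (Φ₀ : Set (Fin d → ℤ)) : Set (Fin d → ℤ) :=
  {k | IsRelevant ν η Φ₀ k}

/-- The set `I_k` of `(2ν+1)`-tuples in `Φ` that are in resonance with `k`. -/
def resonantTuples {d : ℕ} (ν : ℕ) (η : Fin d → ℤ) (Φ : Set (Fin d → ℤ)) (k : Fin d → ℤ) :
    Set (Fin (2 * ν + 1) → Φ) :=
  {ℓ | Resonant η (fun i => (ℓ i : Fin d → ℤ)) k}

/-! ### The transport system -/

/-- The function `a_1 conj(a_2) a_3 conj(a_4) ⋯` (`n` factors). -/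
def alternatingProduct {d n : ℕ} (a : Fin n → L2 d) (x : Space d) : ℂ :=
  ∏ i : Fin n, if Even (i : ℕ) then a i x else conj (a i x)

/-- The right-hand side of the transport equation for the amplitude with index `k`. The three sums
run over `I_k`, restricted to `ℓ_{2ν+1} = k` in the first and to `ℓ_{2ν+1} ≠ k` in the second. -/
def transportNonlinearity {d : ℕ} (ν : ℕ) (lam mu : ℝ) (η : Fin d → ℤ) (Khat : Space d → ℂ)
    {Φ : Set (Fin d → ℤ)} (a : Φ → L2 d) (k : Φ) : L2 d :=
  -(Complex.I * (lam : ℂ)) •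
      (∑' ℓ : {ℓ : resonantTuples ν η Φ k // ℓ.1 (Fin.last (2 * ν)) = k},
        toL2 (fun x =>
          multiplier Khat
            (toL2 (alternatingProduct (fun i : Fin (2 * ν) => a (ℓ.1.1 i.castSucc)))) x * a k x))
    - (Complex.I * (lam : ℂ)) •
      (∑' ℓ : {ℓ : resonantTuples ν η Φ k // ℓ.1 (Fin.last (2 * ν)) ≠ k},
        Khat (WithLp.toLp 2 (fun m =>
          (((k : Fin d → ℤ) m - (ℓ.1.1 (Fin.last (2 * ν)) : Fin d → ℤ) m : ℤ) : ℝ))) •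
          toL2 (alternatingProduct (fun i => a (ℓ.1.1 i))))
    - (Complex.I * (mu : ℂ)) •
      (∑' ℓ : resonantTuples ν η Φ k, toL2 (alternatingProduct (fun i => a (ℓ.1 i))))

/-- The initial amplitude carried by the wave vector `k`: the sum of the `α_j` with `κ_j = k`
(thus `α_j` itself if the `κ_j` are distinct, and `0` if `k` is not one of them). -/
def initialAmplitude {d : ℕ} {J₀ : Set ℕ} (κ : J₀ → Fin d → ℤ) (α : J₀ → 𝓢(Space d, ℂ))
    (k : Fin d → ℤ) : L2 d :=
  ∑' j : {j : J₀ // κ j = k}, (α j).toLp 2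

/-- `a = (a_k)_{k ∈ Φ} ∈ C([0,T]; X)` solves the transport system
`∂_t a_k + ∑ η_m k_m ∂_m a_k = transportNonlinearity`, `a_k(0) = α_k`, on `[0,T]`, in the sense of
Duhamel's formula in `L²`. -/
structure IsProfile {d : ℕ} (ν : ℕ) (lam mu : ℝ) (η : Fin d → ℤ) (Khat : Space d → ℂ)
    {Φ : Set (Fin d → ℤ)} (α : (Fin d → ℤ) → L2 d) (T : ℝ) (a : ℝ → Φ → L2 d) : Prop where
  continuous : ContinuousInNorm profileNorm T a
  init : ∀ k : Φ, a 0 k = α k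
  duhamel : ∀ t ∈ Icc 0 T, ∀ k : Φ, a t k = transportGroup η k t (α k)
    + ∫ τ in (0 : ℝ)..t,
        transportGroup η k (t - τ) (transportNonlinearity ν lam mu η Khat (a τ) k)

/-- The approximate solution `∑_{k ∈ Φ} a_k(t,x) e^{i φ_k(t,x)/ε}`, as a sum in `L²`. -/
def approxSolution {d : ℕ} (η : Fin d → ℤ) {Φ : Set (Fin d → ℤ)} (a : ℝ → Φ → L2 d)
    (ε t : ℝ) : L2 d :=
  ∑' k : Φ, toL2 (fun x =>
    a t k x * Complex.exp (Complex.I * ((phase η k t x / ε : ℝ) : ℂ)))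

end MultiphaseNLS

end

open MultiphaseNLS

/-!
The space `W ∩ L²` is, on the Fourier side, `L¹ ∩ L²` with convolution, so it is a Banach algebra
(`WienerAlg`). Every bounded Fourier multiplier acts on it; in particular `E` does, whose symbol is
bounded because it is homogeneous of degree zero and continuous on the sphere, and so does the
Schrödinger group, by isometries. Hence all power nonlinearities are locally Lipschitz.

A multiphase function `∑ b_γ e^{i(κ·x - ωt/2)/ε}`, with `γ = (κ, ω)`, is an absolutely summable
family of amplitudes in this algebra (`PhaseAlg`). Wave vectors and frequencies add under
multiplication, so these families form a Banach algebra as well, and the evaluation `ev ε t`, which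
sums the series, is a homomorphism of norm at most one. It intertwines `E` with the translated
symbols `ξ ↦ K̂(ξ + κ/(2πε))` on the amplitudes (`PhaseAlg.symb_ev`), so the nonlinearity of the
Schrödinger equation lifts to multiphase functions exactly, for each `ε`. Three errors remain.

* Dispersion. Since `|κ/ε + 2πξ|²` expands into a square, a mixed term and a remainder, the
  Schrödinger flow on a multiphase function is an oscillating factor `e^{it(q(κ) - ω)/(2ε)}` times
  the transport with velocity `(η_m κ_m)` times a dispersion with the symbol `e^{O(ε|ξ|²)}`
  (`schro_neg_ev`, `norm_schroPhase_sub_le`). The dispersion costs `O(ε)` if two derivatives of the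
  amplitudes are under control. This is where the assumption on the initial data enters; it
  propagates because the nonlinearity obeys tame estimates (`IsPhaseProfile.weightBound`). As the
  weighted norms may be infinite a priori, the weights are truncated, with bounds that do not depend
  on the truncation.
* Nonresonant phases. As `q(κ) - ω` is an integer, the oscillating factor is `4πε`-periodic in time,
  with mean zero unless `ω = q(κ)`. There are no small divisors, and the nonresonant part of the
  nonlinearity, which is Lipschitz in time, integrates to `O(ε)` (`norm_integral_averaging_le`,
  `norm_integral_osc_le`).
* The nonlocal term. By homogeneity `K̂(ξ + κ/(2πε)) = K̂(2πεξ + κ)`, which tends to `K̂(κ)` for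
  `κ ≠ 0` and equals `K̂(ξ)` for `κ = 0`; the two nonlocal sums of the transport system come from
  these two cases. The convergence has no rate, since `K̂` is merely continuous, and contributes
  `o(1)` by dominated convergence (`tendsto_integral_freezeError`), and nothing if `λ = 0`.

The part of the limiting nonlinearity with `ω = q(κ)` is the right-hand side of the transport system
(`phaseNonlin_eikonal`, `transportNonlinearity_toLTwo`); since `Φ` is stable under resonances, it
creates no phase outside of `Φ` (`phaseNonlin_apply_eq_zero`). So the profile solves the lifted
equation up to the three errors, and Gronwall's inequality bounds the distance to the exact solution
of an equation with truncated nonlinearity (`IsPhaseProfile.norm_sub_ev_le`). For small `ε` this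
distance is less than one, so the exact solution stays where the truncation is inactive, and it
exists up to the time `T` (`IsPhaseProfile.exists_exact_solution`).

Uniqueness in `L^∞ ∩ L²` is not immediate, because `E` is not bounded on `L^∞`. It suffices to
compare with the solution `u` in `W ∩ L²`, for which `E(|u|^{2ν})` is bounded; the difference is
then estimated in `L²` alone (`norm_nlsNonlinearity_sub_le`, `IsNLSSolution.eq_toLTwo`).
-/

noncomputable section

namespace MultiphaseNLS

variable {d : ℕ}

/-! ### The space `W ∩ L²`, seen from the Fourier side -/

/-- `L¹ ∩ L²`, as the space of pairs in `L¹ × L²` whose two components agree. -/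
def wienerSubmodule (d : ℕ) :
    Submodule ℂ (WithLp 1 (Lp ℂ 1 (volume : Measure (Space d)) × L2 d)) where
  carrier := {p | (p.fst : Space d → ℂ) =ᵐ[volume] p.snd}
  add_mem' := by
    intro p q hp hq
    simp only [Set.mem_ofPred_eq, WithLp.add_fst, WithLp.add_snd] at *
    filter_upwards [hp, hq, Lp.coeFn_add p.fst q.fst, Lp.coeFn_add p.snd q.snd] with x h1 h2 h3 h4
    rw [h3, h4, Pi.add_apply, Pi.add_apply, h1, h2]
  zero_mem' := by
    simp only [Set.mem_ofPred_eq, WithLp.zero_fst, WithLp.zero_snd]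
    filter_upwards [Lp.coeFn_zero ℂ 1 (volume : Measure (Space d)),
      Lp.coeFn_zero ℂ 2 (volume : Measure (Space d))] with x h1 h2
    rw [h1, h2]
  smul_mem' := by
    intro c p hp
    simp only [Set.mem_ofPred_eq, WithLp.smul_fst, WithLp.smul_snd] at *
    filter_upwards [hp, Lp.coeFn_smul c p.fst, Lp.coeFn_smul c p.snd] with x h1 h3 h4
    rw [h3, h4, Pi.smul_apply, Pi.smul_apply, h1]

lemma mem_wienerSubmodule {p : WithLp 1 (Lp ℂ 1 (volume : Measure (Space d)) × L2 d)} :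
    p ∈ wienerSubmodule d ↔ (p.fst : Space d → ℂ) =ᵐ[volume] p.snd := Iff.rfl

lemma isClosed_wienerSubmodule (d : ℕ) : IsClosed (SetLike.coe (wienerSubmodule d)) := by
  refine IsSeqClosed.isClosed fun x p hx hp => ?_
  have h1 : Tendsto (fun n => (x n).fst) atTop (𝓝 p.fst) :=
    ((WithLp.fstL 1 ℂ (Lp ℂ 1 (volume : Measure (Space d))) (L2 d)).continuous.tendsto p).comp hp
  have h2 : Tendsto (fun n => (x n).snd) atTop (𝓝 p.snd) :=
    ((WithLp.sndL 1 ℂ (Lp ℂ 1 (volume : Measure (Space d))) (L2 d)).continuous.tendsto p).comp hp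
  have h1' := tendstoInMeasure_of_tendsto_Lp h1
  have h2' := tendstoInMeasure_of_tendsto_Lp h2
  exact tendstoInMeasure_ae_unique (h1'.congr_left fun n => hx n) h2'

/-- The space `W ∩ L²`. An element is given by its Fourier transform, which belongs to
`L¹ ∩ L²`. -/
def WienerAlg (d : ℕ) : Type := wienerSubmodule d

namespace WienerAlg

instance : NormedAddCommGroup (WienerAlg d) :=
  inferInstanceAs (NormedAddCommGroup (wienerSubmodule d))

instance : NormedSpace ℂ (WienerAlg d) :=
  inferInstanceAs (NormedSpace ℂ (wienerSubmodule d))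

instance : CompleteSpace (WienerAlg d) :=
  (isClosed_wienerSubmodule d).completeSpace_coe

/-- The Fourier transform of an element of `W ∩ L²`, as an element of `L²`. -/
def ftL2 : WienerAlg d →L[ℂ] L2 d :=
  (WithLp.sndL 1 ℂ _ _).comp (wienerSubmodule d).subtypeL

/-- The Fourier transform of an element of `W ∩ L²`, as a function. -/
def ft (x : WienerAlg d) : Space d → ℂ := ftL2 x

lemma memLp_two_ft (x : WienerAlg d) : MemLp (ft x) 2 volume := Lp.memLp _

lemma memLp_one_ft (x : WienerAlg d) : MemLp (ft x) 1 volume :=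
  (Lp.memLp x.1.fst).ae_eq (mem_wienerSubmodule.1 x.2)

lemma integrable_ft (x : WienerAlg d) : Integrable (ft x) :=
  memLp_one_iff_integrable.1 x.memLp_one_ft

/-- The element of `W ∩ L²` with a given Fourier transform in `L¹ ∩ L²`. -/
def mk (F : Space d → ℂ) (h1 : MemLp F 1 volume) (h2 : MemLp F 2 volume) : WienerAlg d :=
  ⟨WithLp.toLp 1 (h1.toLp F, h2.toLp F), h1.coeFn_toLp.trans h2.coeFn_toLp.symm⟩

lemma ft_mk {F : Space d → ℂ} (h1 : MemLp F 1 volume) (h2 : MemLp F 2 volume) :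
    ft (mk F h1 h2) =ᵐ[volume] F := h2.coeFn_toLp

lemma ftL2_mk {F : Space d → ℂ} (h1 : MemLp F 1 volume) (h2 : MemLp F 2 volume) :
    ftL2 (mk F h1 h2) = h2.toLp F := rfl

lemma ft_add (x y : WienerAlg d) : ft (x + y) =ᵐ[volume] ft x + ft y := by
  unfold ft; rw [map_add]; exact Lp.coeFn_add _ _

lemma ft_sub (x y : WienerAlg d) : ft (x - y) =ᵐ[volume] ft x - ft y := by
  unfold ft; rw [map_sub]; exact Lp.coeFn_sub _ _

lemma ft_smul (c : ℂ) (x : WienerAlg d) : ft (c • x) =ᵐ[volume] c • ft x := by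
  unfold ft; rw [map_smul]; exact Lp.coeFn_smul _ _

lemma ext_ft {x y : WienerAlg d} (h : ft x =ᵐ[volume] ft y) : x = y := by
  refine Subtype.ext ?_
  apply WithLp.ofLp_injective
  refine Prod.ext ?_ (Lp.ext h)
  exact Lp.ext ((mem_wienerSubmodule.1 x.2).trans (h.trans (mem_wienerSubmodule.1 y.2).symm))

lemma ftL2_injective : Function.Injective (ftL2 : WienerAlg d → L2 d) := fun x y h =>
  ext_ft (by unfold ft; rw [h])

lemma enorm_eq (x : WienerAlg d) :
    ‖x‖ₑ = eLpNorm (ft x) 1 volume + eLpNorm (ft x) 2 volume := by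
  have h : ‖x‖ₑ = ‖x.1.fst‖ₑ + ‖x.1.snd‖ₑ := by
    have := WithLp.prod_nnnorm_eq_of_L1 x.1
    rw [← ENNReal.coe_inj, ENNReal.coe_add] at this
    exact this
  rw [h, Lp.enorm_def, Lp.enorm_def, eLpNorm_congr_ae (mem_wienerSubmodule.1 x.2)]
  rfl

lemma enorm_mk {F : Space d → ℂ} (h1 : MemLp F 1 volume) (h2 : MemLp F 2 volume) :
    ‖mk F h1 h2‖ₑ = eLpNorm F 1 volume + eLpNorm F 2 volume := by
  rw [enorm_eq, eLpNorm_congr_ae (ft_mk h1 h2), eLpNorm_congr_ae (ft_mk h1 h2)]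

/-- The function in `L²` that an element of `W ∩ L²` stands for. -/
def toLTwo : WienerAlg d →L[ℂ] L2 d :=
  ((Lp.fourierTransformₗᵢ (Space d) ℂ).symm.toContinuousLinearEquiv :
    L2 d →L[ℂ] L2 d).comp ftL2

lemma toLTwo_def (x : WienerAlg d) : toLTwo x = 𝓕⁻ (ftL2 x) := rfl

lemma fourier_toLTwo (x : WienerAlg d) : 𝓕 (toLTwo x) = ftL2 x := by
  rw [toLTwo_def, FourierInvPair.fourier_fourierInv_eq]

lemma toLTwo_injective : Function.Injective (toLTwo : WienerAlg d → L2 d) := fun x y h =>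
  ftL2_injective (by rw [← fourier_toLTwo, h, fourier_toLTwo])

lemma eLpNorm_two_toLTwo (x : WienerAlg d) :
    eLpNorm (toLTwo x) 2 volume = eLpNorm (ft x) 2 volume := by
  have : ‖toLTwo x‖ = ‖ftL2 x‖ := by rw [← fourier_toLTwo, Lp.norm_fourier_eq]
  rw [Lp.norm_def, Lp.norm_def] at this
  exact (ENNReal.toReal_eq_toReal_iff' (Lp.eLpNorm_ne_top _) (Lp.eLpNorm_ne_top _)).1 this

lemma wienerL2Norm_toLTwo (x : WienerAlg d) : wienerL2Norm (toLTwo x) = ‖x‖ₑ := by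
  rw [wienerL2Norm, eLpNorm_two_toLTwo, fourier_toLTwo, enorm_eq]; rfl

lemma exists_toLTwo_eq {f : L2 d} (hf : wienerL2Norm f < ∞) : ∃ x, toLTwo x = f := by
  have h1 : MemLp (𝓕 f : L2 d) 1 volume :=
    ⟨Lp.aestronglyMeasurable _, lt_of_le_of_lt le_self_add hf⟩
  refine ⟨mk _ h1 (Lp.memLp _), ?_⟩
  rw [toLTwo_def, ftL2_mk, Lp.toLp_coeFn, FourierPair.fourierInv_fourier_eq]

/-- On `L¹ ∩ L²` the inverse Fourier transform of `L²` is given by the Fourier integral. -/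
lemma fourierInv_toLp_ae_eq {F : Space d → ℂ} (h1 : MemLp F 1 volume) (h2 : MemLp F 2 volume) :
    ((𝓕⁻ (h2.toLp F) : L2 d) : Space d → ℂ) =ᵐ[volume] (𝓕⁻ F : Space d → ℂ) := by
  have hF : Integrable F := memLp_one_iff_integrable.1 h1
  have hcont : Continuous (𝓕⁻ F : Space d → ℂ) := by
    have : (𝓕⁻ F : Space d → ℂ) = fun x => 𝓕 F (-x) := by
      ext x; exact Real.fourierInv_eq_fourier_neg F x
    rw [this]
    exact (VectorFourier.fourierIntegral_continuous Real.continuous_fourierChar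
      (by exact continuous_inner) hF).comp continuous_neg
  refine ae_eq_of_integral_contDiff_smul_eq ((Lp.memLp _).locallyIntegrable (by norm_num))
    hcont.locallyIntegrable fun g hg hgs => ?_
  have hgc : ContDiff ℝ ((⊤ : ℕ∞) : WithTop ℕ∞) (fun x => (g x : ℂ)) :=
    Complex.ofRealCLM.contDiff.comp hg
  have hgsc : HasCompactSupport (fun x => (g x : ℂ)) :=
    hgs.comp_left (g := fun r : ℝ => (r : ℂ)) (by simp)
  set φ : 𝓢(Space d, ℂ) := hgsc.toSchwartzMap hgc with hφ
  have hφx : ∀ x, φ x = g x := fun x => rfl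
  have e1 : ∫ x, g x • (𝓕⁻ (h2.toLp F) : L2 d) x = ∫ x, (𝓕⁻ φ) x * F x := by
    have : ((𝓕⁻ (h2.toLp F) : L2 d) : 𝓢'(Space d, ℂ)) φ
        = (h2.toLp F : 𝓢'(Space d, ℂ)) (𝓕⁻ φ) := by
      rw [← Lp.fourierInv_toTemperedDistribution_eq]; rfl
    rw [Lp.toTemperedDistribution_apply, Lp.toTemperedDistribution_apply] at this
    simp only [hφx, smul_eq_mul] at this
    simp only [Complex.real_smul]
    rw [this]
    refine integral_congr_ae ?_
    filter_upwards [h2.coeFn_toLp] with x hx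
    rw [hx]
  have e2 : ∫ x, g x • (𝓕⁻ F : Space d → ℂ) x = ∫ x, (𝓕⁻ φ) x * F x := by
    have key := VectorFourier.integral_fourierIntegral_smul_eq_flip
      (μ := (volume : Measure (Space d))) (ν := (volume : Measure (Space d)))
      (L := -(innerₗ (Space d))) (f := fun x => φ x) (g := F) (𝕜 := ℝ) (F := ℂ)
      Real.continuous_fourierChar
      (by exact continuous_inner.neg) φ.integrable hF
    have hflip : (-(innerₗ (Space d))).flip = -(innerₗ (Space d)) := by
      ext x y; simp [real_inner_comm]
    rw [hflip] at key
    have h3 : ∀ (G : Space d → ℂ) (x : Space d),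
        VectorFourier.fourierIntegral Real.fourierChar volume (-(innerₗ (Space d))) G x
          = (𝓕⁻ G : Space d → ℂ) x := fun G x => rfl
    simp only [h3, hφx, smul_eq_mul] at key
    simp only [Complex.real_smul]
    rw [← key, SchwartzMap.fourierInv_coe]
    rfl
  rw [e1, e2]

lemma toLTwo_ae_eq (x : WienerAlg d) :
    (toLTwo x : Space d → ℂ) =ᵐ[volume] (𝓕⁻ (ft x) : Space d → ℂ) := by
  have := fourierInv_toLp_ae_eq x.memLp_one_ft x.memLp_two_ft
  rwa [show (x.memLp_two_ft.toLp (ft x) : L2 d) = ftL2 x from Lp.toLp_coeFn _ _] at this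

lemma toLTwo_mk_ae_eq {F : Space d → ℂ} (h1 : MemLp F 1 volume) (h2 : MemLp F 2 volume) :
    (toLTwo (mk F h1 h2) : Space d → ℂ) =ᵐ[volume] (𝓕⁻ F : Space d → ℂ) :=
  fourierInv_toLp_ae_eq h1 h2

lemma enorm_toLTwo_apply_le (x : WienerAlg d) :
    ∀ᵐ y, ‖toLTwo x y‖ₑ ≤ eLpNorm (ft x) 1 volume := by
  filter_upwards [x.toLTwo_ae_eq] with y hy
  rw [hy, Real.fourierInv_eq, eLpNorm_one_eq_lintegral_enorm]
  refine (enorm_integral_le_lintegral_enorm _).trans (lintegral_mono fun v => ?_)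
  exact enorm_le_iff_norm_le.2 (by rw [Circle.norm_smul])

lemma norm_toLTwo_apply_le (x : WienerAlg d) : ∀ᵐ y, ‖toLTwo x y‖ ≤ ‖x‖ := by
  filter_upwards [x.enorm_toLTwo_apply_le] with y hy
  exact enorm_le_iff_norm_le.1 (hy.trans (by rw [enorm_eq]; exact le_self_add))

end WienerAlg

/-! ### Young's inequality -/

/-- The convolution of two functions with values in `[0,∞]`. -/
def lconv (f g : Space d → ℝ≥0∞) (x : Space d) : ℝ≥0∞ := ∫⁻ t, f t * g (x - t)

lemma aemeasurable_comp_sub {g : Space d → ℝ≥0∞} (hg : AEMeasurable g volume) :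
    AEMeasurable (fun p : Space d × Space d => g (p.1 - p.2)) (volume.prod volume) :=
  hg.comp_quasiMeasurePreserving (quasiMeasurePreserving_sub_of_right_invariant volume volume)

lemma aemeasurable_lconv_integrand {f g : Space d → ℝ≥0∞} (hf : AEMeasurable f volume)
    (hg : AEMeasurable g volume) :
    AEMeasurable (fun p : Space d × Space d => f p.2 * g (p.1 - p.2)) (volume.prod volume) :=
  hf.comp_snd.mul (aemeasurable_comp_sub hg)

lemma aemeasurable_lconv {f g : Space d → ℝ≥0∞} (hf : AEMeasurable f volume)
    (hg : AEMeasurable g volume) : AEMeasurable (lconv f g) volume :=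
  (aemeasurable_lconv_integrand hf hg).lintegral_prod_right'

lemma lintegral_lconv {f g : Space d → ℝ≥0∞} (hf : AEMeasurable f volume)
    (hg : AEMeasurable g volume) : ∫⁻ x, lconv f g x = (∫⁻ x, f x) * ∫⁻ x, g x := by
  unfold lconv
  rw [lintegral_lintegral_swap (aemeasurable_lconv_integrand hf hg)]
  have : ∀ t : Space d, ∫⁻ x, f t * g (x - t) = f t * ∫⁻ x, g x := fun t => by
    have h : AEMeasurable (fun x => g (x - t)) volume := hg.comp_quasiMeasurePreserving
      (measurePreserving_sub_right volume t).quasiMeasurePreserving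
    rw [lintegral_const_mul'' _ h, lintegral_sub_right_eq_self]
  simp_rw [this]
  rw [lintegral_mul_const'' _ hf]

lemma aemeasurable_comp_const_sub {g : Space d → ℝ≥0∞} (hg : AEMeasurable g volume)
    (x : Space d) : AEMeasurable (fun t => g (x - t)) volume :=
  hg.comp_quasiMeasurePreserving
    (Measure.measurePreserving_sub_left volume x).quasiMeasurePreserving

lemma lconv_sq_le {f g : Space d → ℝ≥0∞} (hf : AEMeasurable f volume)
    (hg : AEMeasurable g volume) (x : Space d) :
    lconv f g x ^ (2 : ℝ) ≤ (∫⁻ t, f t) * lconv f (fun t => g t ^ (2 : ℝ)) x := by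
  have h := ENNReal.lintegral_mul_le_Lp_mul_Lq (volume : Measure (Space d))
    (Real.HolderConjugate.two_two) (f := fun t => f t ^ (1 / 2 : ℝ))
    (g := fun t => f t ^ (1 / 2 : ℝ) * g (x - t)) (hf.pow_const _)
    ((hf.pow_const _).mul (aemeasurable_comp_const_sub hg x))
  have e1 : ∀ t, (f t ^ (1 / 2 : ℝ)) ^ (2 : ℝ) = f t := fun t => by
    rw [← ENNReal.rpow_mul]; norm_num
  have e2 : ∀ t, f t ^ (1 / 2 : ℝ) * f t ^ (1 / 2 : ℝ) = f t := fun t => by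
    rw [← ENNReal.rpow_add_of_nonneg _ _ (by norm_num) (by norm_num)]; norm_num
  simp only [Pi.mul_apply, ← mul_assoc, e2, e1, ENNReal.mul_rpow_of_nonneg _ _ zero_le_two] at h
  calc lconv f g x ^ (2 : ℝ)
      ≤ ((∫⁻ t, f t) ^ (1 / 2 : ℝ) * (∫⁻ t, f t * g (x - t) ^ (2 : ℝ)) ^ (1 / 2 : ℝ)) ^ (2 : ℝ) :=
        ENNReal.rpow_le_rpow h zero_le_two
    _ = _ := by
        rw [ENNReal.mul_rpow_of_nonneg _ _ zero_le_two, ← ENNReal.rpow_mul, ← ENNReal.rpow_mul]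
        norm_num
        rfl

/-- Young's inequality `L¹ * Lᵖ ⊆ Lᵖ`, for `p = 1` and `p = 2`. -/
lemma eLpNorm_lconv_le {f g : Space d → ℝ≥0∞} (hf : AEMeasurable f volume)
    (hg : AEMeasurable g volume) {p : ℝ≥0∞} (hp : p = 1 ∨ p = 2) :
    eLpNorm (lconv f g) p volume ≤ eLpNorm f 1 volume * eLpNorm g p volume := by
  rcases hp with rfl | rfl
  · simp only [eLpNorm_one_eq_lintegral_enorm, enorm_eq_self]
    exact (lintegral_lconv hf hg).le
  · have h2 : ∀ h : Space d → ℝ≥0∞,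
        eLpNorm h 2 volume = (∫⁻ x, h x ^ (2 : ℝ)) ^ (1 / 2 : ℝ) := fun h => by
      rw [eLpNorm_eq_lintegral_rpow_enorm_toReal (by norm_num) (by norm_num)]; simp
    rw [h2, h2, eLpNorm_one_eq_lintegral_enorm]
    simp only [enorm_eq_self]
    calc (∫⁻ x, lconv f g x ^ (2 : ℝ)) ^ (1 / 2 : ℝ)
        ≤ (∫⁻ x, (∫⁻ t, f t) * lconv f (fun t => g t ^ (2 : ℝ)) x) ^ (1 / 2 : ℝ) :=
          ENNReal.rpow_le_rpow (lintegral_mono fun x => lconv_sq_le hf hg x) (by norm_num)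
      _ = ((∫⁻ t, f t) ^ (2 : ℝ) * ∫⁻ x, g x ^ (2 : ℝ)) ^ (1 / 2 : ℝ) := by
          rw [lintegral_const_mul'' _ (aemeasurable_lconv hf (hg.pow_const _)),
            lintegral_lconv hf (hg.pow_const _), ← mul_assoc]
          congr 2
          rw [show (2 : ℝ) = ((2 : ℕ) : ℝ) by norm_num, ENNReal.rpow_natCast, sq]
      _ = _ := by
          rw [ENNReal.mul_rpow_of_nonneg _ _ (by norm_num), ← ENNReal.rpow_mul]
          norm_num

/-! ### Banach spaces with a product and a conjugation -/

/-- A Banach space with a bounded bilinear product of norm at most one and an isometric conjugation.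
No algebraic law is imposed: the nonlinear estimates do not need any. -/
class ConjAlg (B : Type*) [NormedAddCommGroup B] [NormedSpace ℂ B] where
  /-- the product -/
  mulL : B →L[ℂ] B →L[ℂ] B
  norm_mulL_le : ∀ x y, ‖mulL x y‖ ≤ ‖x‖ * ‖y‖
  /-- the conjugation -/
  conjL : B →L⋆[ℂ] B
  norm_conjL : ∀ x, ‖conjL x‖ = ‖x‖

open MultiphaseNLS.ConjAlg (mulL conjL norm_mulL_le norm_conjL)

lemma enorm_convolution_le (F G : Space d → ℂ) (x : Space d) :
    ‖convolution F G (ContinuousLinearMap.mul ℂ ℂ) volume x‖ₑ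
      ≤ lconv (fun t => ‖F t‖ₑ) (fun t => ‖G t‖ₑ) x := by
  refine (enorm_integral_le_lintegral_enorm _).trans (le_of_eq ?_)
  simp [lconv, enorm_mul]

/-- Young's inequality with weights, where the weight `w` on the convolution is dominated by a sum
of weights on the factors. -/
lemma eLpNorm_mul_convolution_le {F G w w₁ w₂ : Space d → ℂ} (hF : AEStronglyMeasurable F volume)
    (hG : AEStronglyMeasurable G volume) (hw₁ : Measurable w₁) (hw₂ : Measurable w₂)
    (h : ∀ s t, ‖w (s + t)‖ ≤ ‖w₁ s‖ + ‖w₂ t‖) {p : ℝ≥0∞} (hp : p = 1 ∨ p = 2) :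
    eLpNorm (fun ξ => w ξ * convolution F G (ContinuousLinearMap.mul ℂ ℂ) volume ξ) p volume
      ≤ eLpNorm (fun ξ => w₁ ξ * F ξ) 1 volume * eLpNorm G p volume
        + eLpNorm F 1 volume * eLpNorm (fun ξ => w₂ ξ * G ξ) p volume := by
  have hF' : AEMeasurable (fun t => ‖F t‖ₑ) volume := hF.enorm
  have hG' : AEMeasurable (fun t => ‖G t‖ₑ) volume := hG.enorm
  have hwF : AEMeasurable (fun t => ‖w₁ t * F t‖ₑ) volume :=
    (hw₁.aestronglyMeasurable.mul hF).enorm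
  have hwG : AEMeasurable (fun t => ‖w₂ t * G t‖ₑ) volume :=
    (hw₂.aestronglyMeasurable.mul hG).enorm
  have e : ∀ (H : Space d → ℂ) (q : ℝ≥0∞),
      eLpNorm (fun t => ‖H t‖ₑ) q volume = eLpNorm H q volume := fun H q => eLpNorm_enorm H
  have hp1 : 1 ≤ p := by rcases hp with rfl | rfl <;> norm_num
  calc _ ≤ eLpNorm (lconv (fun t => ‖w₁ t * F t‖ₑ) (fun t => ‖G t‖ₑ)
        + lconv (fun t => ‖F t‖ₑ) (fun t => ‖w₂ t * G t‖ₑ)) p volume := by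
        refine eLpNorm_mono_enorm fun ξ => ?_
        rw [enorm_mul, enorm_eq_self, Pi.add_apply]
        refine (mul_le_mul_right (enorm_convolution_le F G ξ) _).trans ?_
        unfold lconv
        rw [← lintegral_add_left', ← lintegral_const_mul'']
        · refine lintegral_mono fun t => ?_
          have h1 : ‖w ξ‖ₑ ≤ ‖w₁ t‖ₑ + ‖w₂ (ξ - t)‖ₑ := by
            have := h t (ξ - t)
            rw [add_sub_cancel] at this
            simp only [← ofReal_norm]
            rw [← ENNReal.ofReal_add (norm_nonneg _) (norm_nonneg _)]
            exact ENNReal.ofReal_le_ofReal this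
          calc ‖w ξ‖ₑ * (‖F t‖ₑ * ‖G (ξ - t)‖ₑ)
              ≤ (‖w₁ t‖ₑ + ‖w₂ (ξ - t)‖ₑ) * (‖F t‖ₑ * ‖G (ξ - t)‖ₑ) := by gcongr
            _ = _ := by simp only [enorm_mul]; ring
        · exact hF'.mul (aemeasurable_comp_const_sub hG' ξ)
        · exact hwF.mul (aemeasurable_comp_const_sub hG' ξ)
    _ ≤ _ := (eLpNorm_add_le (aemeasurable_lconv hwF hG').aestronglyMeasurable
        (aemeasurable_lconv hF' hwG).aestronglyMeasurable hp1)
    _ ≤ _ := by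
        refine add_le_add ((eLpNorm_lconv_le hwF hG' hp).trans ?_)
          ((eLpNorm_lconv_le hF' hwG hp).trans ?_) <;> simp only [e, le_refl]

lemma eLpNorm_convolution_le {F G : Space d → ℂ} (hF : AEStronglyMeasurable F volume)
    (hG : AEStronglyMeasurable G volume) {p : ℝ≥0∞} (hp : p = 1 ∨ p = 2) :
    eLpNorm (convolution F G (ContinuousLinearMap.mul ℂ ℂ) volume) p volume
      ≤ eLpNorm F 1 volume * eLpNorm G p volume := by
  have e : ∀ (H : Space d → ℂ) (q : ℝ≥0∞),
      eLpNorm (fun t => ‖H t‖ₑ) q volume = eLpNorm H q volume := fun H q => eLpNorm_enorm H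
  have h1 : eLpNorm (convolution F G (ContinuousLinearMap.mul ℂ ℂ) volume) p volume
      ≤ eLpNorm (lconv (fun t => ‖F t‖ₑ) (fun t => ‖G t‖ₑ)) p volume :=
    eLpNorm_mono_enorm fun ξ => by rw [enorm_eq_self]; exact enorm_convolution_le F G ξ
  refine (h1.trans (eLpNorm_lconv_le hF.enorm hG.enorm hp)).trans ?_
  rw [e, e]

namespace WienerAlg

lemma norm_eq_toReal_enorm (x : WienerAlg d) : ‖x‖ = ‖x‖ₑ.toReal := (toReal_enorm x).symm

lemma memLp_convolution (x y : WienerAlg d) {p : ℝ≥0∞} (hp : p = 1 ∨ p = 2) :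
    MemLp (convolution (ft x) (ft y) (ContinuousLinearMap.mul ℂ ℂ) volume) p volume := by
  refine ⟨(x.integrable_ft.integrable_convolution _ y.integrable_ft).aestronglyMeasurable, ?_⟩
  refine (eLpNorm_convolution_le x.memLp_one_ft.1 y.memLp_one_ft.1 hp).trans_lt ?_
  refine ENNReal.mul_lt_top x.memLp_one_ft.2 ?_
  rcases hp with rfl | rfl
  exacts [y.memLp_one_ft.2, y.memLp_two_ft.2]

/-- The product of two elements of `W ∩ L²`, defined by convolution of the Fourier transforms. -/
def mulFun (x y : WienerAlg d) : WienerAlg d :=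
  mk (convolution (ft x) (ft y) (ContinuousLinearMap.mul ℂ ℂ) volume)
    (memLp_convolution x y (.inl rfl)) (memLp_convolution x y (.inr rfl))

lemma enorm_mulFun_le (x y : WienerAlg d) : ‖mulFun x y‖ₑ ≤ ‖x‖ₑ * ‖y‖ₑ := by
  rw [mulFun, enorm_mk, enorm_eq y, mul_add]
  have hx : eLpNorm (ft x) 1 volume ≤ ‖x‖ₑ := by rw [enorm_eq]; exact le_self_add
  refine add_le_add
    ((eLpNorm_convolution_le x.memLp_one_ft.1 y.memLp_one_ft.1 (.inl rfl)).trans ?_)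
    ((eLpNorm_convolution_le x.memLp_one_ft.1 y.memLp_one_ft.1 (.inr rfl)).trans ?_) <;> gcongr

lemma norm_mulFun_le (x y : WienerAlg d) : ‖mulFun x y‖ ≤ ‖x‖ * ‖y‖ := by
  simp only [norm_eq_toReal_enorm]
  rw [← ENNReal.toReal_mul]
  exact ENNReal.toReal_mono (ENNReal.mul_ne_top enorm_ne_top enorm_ne_top) (enorm_mulFun_le x y)

lemma fourierInv_convolution {F G : Space d → ℂ} (hF : Integrable F) (hG : Integrable G)
    (x : Space d) :
    (𝓕⁻ (convolution F G (ContinuousLinearMap.mul ℂ ℂ) volume) : Space d → ℂ) x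
      = (𝓕⁻ F : Space d → ℂ) x * (𝓕⁻ G : Space d → ℂ) x := by
  simp only [Real.fourierInv_eq_fourier_neg]
  exact Real.fourier_mul_convolution_eq hF hG (-x)

/-- The product on `W ∩ L²` is the pointwise product of functions. -/
lemma toLTwo_mulFun (x y : WienerAlg d) :
    (toLTwo (mulFun x y) : Space d → ℂ) =ᵐ[volume] fun z => toLTwo x z * toLTwo y z := by
  filter_upwards [toLTwo_mk_ae_eq (memLp_convolution x y (.inl rfl))
    (memLp_convolution x y (.inr rfl)), x.toLTwo_ae_eq, y.toLTwo_ae_eq] with z h1 h2 h3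
  rw [mulFun, h1, h2, h3, fourierInv_convolution x.integrable_ft y.integrable_ft]

lemma ext_toLTwo {x y : WienerAlg d} (h : (toLTwo x : Space d → ℂ) =ᵐ[volume] toLTwo y) : x = y :=
  toLTwo_injective (Lp.ext h)

lemma toLTwo_add_ae (x y : WienerAlg d) :
    (toLTwo (x + y) : Space d → ℂ) =ᵐ[volume] fun z => toLTwo x z + toLTwo y z := by
  rw [map_add]; exact Lp.coeFn_add _ _

lemma toLTwo_smul_ae (c : ℂ) (x : WienerAlg d) :
    (toLTwo (c • x) : Space d → ℂ) =ᵐ[volume] fun z => c * toLTwo x z := by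
  rw [map_smul]; exact Lp.coeFn_smul _ _

lemma eLpNorm_conj_comp_neg {F : Space d → ℂ} (hF : AEStronglyMeasurable F volume) (p : ℝ≥0∞) :
    eLpNorm (fun ξ => conj (F (-ξ))) p volume = eLpNorm F p volume := by
  have h : eLpNorm (fun ξ => conj (F (-ξ))) p volume = eLpNorm (fun ξ => F (-ξ)) p volume :=
    eLpNorm_congr_norm_ae (Eventually.of_forall fun ξ => by simp)
  rw [h]
  exact eLpNorm_comp_measurePreserving hF (Measure.measurePreserving_neg volume)

lemma memLp_conj_comp_neg {F : Space d → ℂ} {p : ℝ≥0∞} (hF : MemLp F p volume) :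
    MemLp (fun ξ => conj (F (-ξ))) p volume :=
  ⟨Complex.continuous_conj.comp_aestronglyMeasurable
    (hF.1.comp_measurePreserving (Measure.measurePreserving_neg volume)),
    (eLpNorm_conj_comp_neg hF.1 p).trans_lt hF.2⟩

/-- Complex conjugation on `W ∩ L²`, on the Fourier side. -/
def conjFun (x : WienerAlg d) : WienerAlg d :=
  mk (fun ξ => conj (ft x (-ξ))) (memLp_conj_comp_neg x.memLp_one_ft)
    (memLp_conj_comp_neg x.memLp_two_ft)

lemma ft_conjFun (x : WienerAlg d) : ft (conjFun x) =ᵐ[volume] fun ξ => conj (ft x (-ξ)) :=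
  ft_mk _ _

lemma enorm_conjFun (x : WienerAlg d) : ‖conjFun x‖ₑ = ‖x‖ₑ := by
  rw [conjFun, enorm_mk, enorm_eq, eLpNorm_conj_comp_neg x.memLp_one_ft.1,
    eLpNorm_conj_comp_neg x.memLp_one_ft.1]

lemma norm_conjFun (x : WienerAlg d) : ‖conjFun x‖ = ‖x‖ := by
  rw [norm_eq_toReal_enorm, enorm_conjFun, ← norm_eq_toReal_enorm]

lemma toLTwo_conjFun (x : WienerAlg d) :
    (toLTwo (conjFun x) : Space d → ℂ) =ᵐ[volume] fun z => conj (toLTwo x z) := by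
  filter_upwards [(conjFun x).toLTwo_ae_eq, x.toLTwo_ae_eq] with z h1 h2
  rw [h1, h2, Real.fourierInv_congr_ae (ft_conjFun x), Real.fourierInv_eq, Real.fourierInv_eq,
    ← integral_conj, ← integral_neg_eq_self]
  congr 1
  ext v
  simp [Circle.smul_def, ← Circle.coe_inv_eq_conj, inner_neg_left, AddChar.map_neg_eq_inv]

/-- Multiplication by the character `e^{2πi v·x}` on `W ∩ L²`: a translation on the Fourier
side. -/
def shiftFun (v : Space d) (x : WienerAlg d) : WienerAlg d :=
  mk (fun ξ => ft x (ξ - v))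
    (x.memLp_one_ft.comp_measurePreserving (measurePreserving_sub_right volume v))
    (x.memLp_two_ft.comp_measurePreserving (measurePreserving_sub_right volume v))

lemma ft_shiftFun (v : Space d) (x : WienerAlg d) :
    ft (shiftFun v x) =ᵐ[volume] fun ξ => ft x (ξ - v) := ft_mk _ _

lemma enorm_shiftFun (v : Space d) (x : WienerAlg d) : ‖shiftFun v x‖ₑ = ‖x‖ₑ := by
  rw [shiftFun, enorm_mk, enorm_eq]
  congr 1
  · exact eLpNorm_comp_measurePreserving x.memLp_one_ft.1 (measurePreserving_sub_right volume v)
  · exact eLpNorm_comp_measurePreserving x.memLp_two_ft.1 (measurePreserving_sub_right volume v)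

lemma norm_shiftFun (v : Space d) (x : WienerAlg d) : ‖shiftFun v x‖ = ‖x‖ := by
  rw [norm_eq_toReal_enorm, enorm_shiftFun, ← norm_eq_toReal_enorm]

lemma toLTwo_shiftFun (v : Space d) (x : WienerAlg d) :
    (toLTwo (shiftFun v x) : Space d → ℂ) =ᵐ[volume]
      fun z => (Real.fourierChar (inner ℝ v z) : ℂ) * toLTwo x z := by
  filter_upwards [(shiftFun v x).toLTwo_ae_eq, x.toLTwo_ae_eq] with z h1 h2
  rw [h1, h2, Real.fourierInv_congr_ae (ft_shiftFun v x), Real.fourierInv_eq, Real.fourierInv_eq,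
    ← integral_const_mul, ← integral_add_right_eq_self _ v]
  congr 1
  ext w
  simp only [add_sub_cancel_right, Circle.smul_def, inner_add_left, AddChar.map_add_eq_mul,
    Circle.coe_mul, smul_eq_mul]
  ring

instance : ConjAlg (WienerAlg d) where
  mulL := LinearMap.mkContinuous₂
    (LinearMap.mk₂ ℂ mulFun
      (fun x y z => ext_toLTwo <| by
        filter_upwards [toLTwo_mulFun (x + y) z, toLTwo_mulFun x z, toLTwo_mulFun y z,
          toLTwo_add_ae x y, toLTwo_add_ae (mulFun x z) (mulFun y z)] with w h1 h2 h3 h4 h5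
        rw [h1, h5, h4, h2, h3, add_mul])
      (fun c x z => ext_toLTwo <| by
        filter_upwards [toLTwo_mulFun (c • x) z, toLTwo_mulFun x z,
          toLTwo_smul_ae c x, toLTwo_smul_ae c (mulFun x z)] with w h1 h2 h3 h4
        rw [h1, h4, h3, h2, mul_assoc])
      (fun z x y => ext_toLTwo <| by
        filter_upwards [toLTwo_mulFun z (x + y), toLTwo_mulFun z x, toLTwo_mulFun z y,
          toLTwo_add_ae x y, toLTwo_add_ae (mulFun z x) (mulFun z y)] with w h1 h2 h3 h4 h5
        rw [h1, h5, h4, h2, h3, mul_add])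
      (fun c x z => ext_toLTwo <| by
        filter_upwards [toLTwo_mulFun x (c • z), toLTwo_mulFun x z,
          toLTwo_smul_ae c z, toLTwo_smul_ae c (mulFun x z)] with w h1 h2 h3 h4
        rw [h1, h4, h3, h2]; ring)) 1
    (fun x y => by simpa using norm_mulFun_le x y)
  norm_mulL_le := norm_mulFun_le
  conjL := LinearMap.mkContinuous
    { toFun := conjFun
      map_add' := fun x y => ext_toLTwo <| by
        filter_upwards [toLTwo_conjFun (x + y), toLTwo_conjFun x, toLTwo_conjFun y,
          toLTwo_add_ae x y, toLTwo_add_ae (conjFun x) (conjFun y)] with w h1 h2 h3 h4 h5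
        rw [h1, h5, h4, h2, h3, map_add]
      map_smul' := fun c x => ext_toLTwo <| by
        filter_upwards [toLTwo_conjFun (c • x), toLTwo_conjFun x,
          toLTwo_smul_ae c x, toLTwo_smul_ae (conj c) (conjFun x)] with w h1 h2 h3 h4
        rw [h1, h4, h3, h2, map_mul] } 1
    (fun x => by simpa using (norm_conjFun x).le)
  norm_conjL := norm_conjFun

lemma toLTwo_mulL (x y : WienerAlg d) :
    (toLTwo (mulL x y) : Space d → ℂ) =ᵐ[volume] fun z => toLTwo x z * toLTwo y z :=
  toLTwo_mulFun x y

lemma toLTwo_conjL (x : WienerAlg d) :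
    (toLTwo (conjL x) : Space d → ℂ) =ᵐ[volume] fun z => conj (toLTwo x z) :=
  toLTwo_conjFun x

/-- Multiplication by the character `e^{2πi v·x}` as a linear operator. -/
def shift (v : Space d) : WienerAlg d →L[ℂ] WienerAlg d :=
  LinearMap.mkContinuous
    { toFun := shiftFun v
      map_add' := fun x y => ext_toLTwo <| by
        filter_upwards [toLTwo_shiftFun v (x + y), toLTwo_shiftFun v x, toLTwo_shiftFun v y,
          toLTwo_add_ae x y, toLTwo_add_ae (shiftFun v x) (shiftFun v y)] with w h1 h2 h3 h4 h5
        rw [h1, h5, h4, h2, h3, mul_add]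
      map_smul' := fun c x => ext_toLTwo <| by
        filter_upwards [toLTwo_shiftFun v (c • x), toLTwo_shiftFun v x,
          toLTwo_smul_ae c x, toLTwo_smul_ae c (shiftFun v x)] with w h1 h2 h3 h4
        rw [h1, RingHom.id_apply, h4, h3, h2]; ring } 1
    (fun x => by simpa using (norm_shiftFun v x).le)

lemma norm_shift (v : Space d) (x : WienerAlg d) : ‖shift v x‖ = ‖x‖ := norm_shiftFun v x

lemma toLTwo_shift (v : Space d) (x : WienerAlg d) :
    (toLTwo (shift v x) : Space d → ℂ) =ᵐ[volume]
      fun z => (Real.fourierChar (inner ℝ v z) : ℂ) * toLTwo x z := toLTwo_shiftFun v x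

lemma ft_shift (v : Space d) (x : WienerAlg d) :
    ft (shift v x) =ᵐ[volume] fun ξ => ft x (ξ - v) := ft_mk _ _

lemma mulL_shift (v w : Space d) (x y : WienerAlg d) :
    mulL (shift v x) (shift w y) = shift (v + w) (mulL x y) := ext_toLTwo <| by
  filter_upwards [toLTwo_mulL (shift v x) (shift w y), toLTwo_shift v x, toLTwo_shift w y,
    toLTwo_shift (v + w) (mulL x y), toLTwo_mulL x y] with z h1 h2 h3 h4 h5
  rw [h1, h2, h3, h4, h5, inner_add_left, AddChar.map_add_eq_mul, Circle.coe_mul]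
  ring

lemma conjL_shift (v : Space d) (x : WienerAlg d) :
    conjL (shift v x) = shift (-v) (conjL x) := ext_toLTwo <| by
  filter_upwards [toLTwo_conjL (shift v x), toLTwo_shift v x, toLTwo_shift (-v) (conjL x),
    toLTwo_conjL x] with z h1 h2 h3 h4
  rw [h1, h2, h3, h4, inner_neg_left, AddChar.map_neg_eq_inv, map_mul, Circle.coe_inv_eq_conj]

end WienerAlg

/-! ### Fourier multipliers on `W ∩ L²` -/

/-- Bounded measurable symbols of Fourier multipliers. -/
def BddSymbol (m : Space d → ℂ) : Prop := Measurable m ∧ ∃ C : ℝ, ∀ ξ, ‖m ξ‖ ≤ C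

namespace BddSymbol

lemma memLp_mul {m : Space d → ℂ} (hm : BddSymbol m) {F : Space d → ℂ} {p : ℝ≥0∞}
    (hF : MemLp F p volume) : MemLp (fun ξ => m ξ * F ξ) p volume := by
  obtain ⟨hm, C, hC⟩ := hm
  refine MemLp.of_le_mul (c := C) hF (hm.aestronglyMeasurable.mul hF.1)
    (Eventually.of_forall fun ξ => ?_)
  rw [norm_mul]
  gcongr
  exact hC ξ

lemma mul {m m' : Space d → ℂ} (hm : BddSymbol m) (hm' : BddSymbol m') :
    BddSymbol (fun ξ => m ξ * m' ξ) := by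
  obtain ⟨C, hC⟩ := hm.2
  obtain ⟨C', hC'⟩ := hm'.2
  refine ⟨hm.1.mul hm'.1, C * C', fun ξ => ?_⟩
  rw [norm_mul]
  exact mul_le_mul (hC ξ) (hC' ξ) (norm_nonneg _) ((norm_nonneg _).trans (hC ξ))

lemma sub {m m' : Space d → ℂ} (hm : BddSymbol m) (hm' : BddSymbol m') :
    BddSymbol (fun ξ => m ξ - m' ξ) := by
  obtain ⟨C, hC⟩ := hm.2
  obtain ⟨C', hC'⟩ := hm'.2
  exact ⟨hm.1.sub hm'.1, C + C', fun ξ => (norm_sub_le _ _).trans (add_le_add (hC ξ) (hC' ξ))⟩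

lemma const (c : ℂ) : BddSymbol (fun _ : Space d => c) :=
  ⟨measurable_const, ‖c‖, fun _ => le_rfl⟩

lemma comp_add {m : Space d → ℂ} (hm : BddSymbol m) (v : Space d) :
    BddSymbol (fun ξ => m (ξ + v)) :=
  ⟨hm.1.comp (measurable_add_const v), hm.2.imp fun _ hC _ => hC _⟩

end BddSymbol

lemma toL2_eq {f : Space d → ℂ} (hf : MemLp f 2 volume) : toL2 f = hf.toLp f := dif_pos hf

lemma coeFn_toL2 {f : Space d → ℂ} (hf : MemLp f 2 volume) : toL2 f =ᵐ[volume] f := by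
  rw [toL2_eq hf]; exact hf.coeFn_toLp

lemma toL2_congr {f g : Space d → ℂ} (h : f =ᵐ[volume] g) : toL2 f = toL2 g := by
  by_cases hf : MemLp f 2 volume
  · rw [toL2_eq hf, toL2_eq (hf.ae_eq h)]
    exact MemLp.toLp_congr _ _ h
  · rw [toL2, toL2, dif_neg hf, dif_neg fun hg => hf (hg.ae_eq h.symm)]

lemma toL2_eq_of_ae_eq {f : Space d → ℂ} {g : L2 d} (h : f =ᵐ[volume] g) : toL2 f = g := by
  rw [toL2_congr h, toL2_eq (Lp.memLp g), Lp.toLp_coeFn]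

namespace WienerAlg

/-- The norm is monotone in the modulus of the Fourier transform. -/
lemma norm_le_mul_of_ft {x y : WienerAlg d} {c : ℝ} (hc : 0 ≤ c)
    (h : ∀ᵐ ξ, ‖ft x ξ‖ ≤ c * ‖ft y ξ‖) : ‖x‖ ≤ c * ‖y‖ := by
  have h' : ‖x‖ₑ ≤ ENNReal.ofReal c * ‖y‖ₑ := by
    rw [enorm_eq, enorm_eq, mul_add]
    exact add_le_add (eLpNorm_le_mul_eLpNorm_of_ae_le_mul h 1)
      (eLpNorm_le_mul_eLpNorm_of_ae_le_mul h 2)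
  rw [norm_eq_toReal_enorm, norm_eq_toReal_enorm]
  refine (ENNReal.toReal_mono (ENNReal.mul_ne_top ENNReal.ofReal_ne_top enorm_ne_top) h').trans ?_
  rw [ENNReal.toReal_mul, ENNReal.toReal_ofReal hc]

/-- The action of a Fourier multiplier on `W ∩ L²`. -/
def symbFun {m : Space d → ℂ} (hm : BddSymbol m) (x : WienerAlg d) : WienerAlg d :=
  mk (fun ξ => m ξ * ft x ξ) (hm.memLp_mul x.memLp_one_ft) (hm.memLp_mul x.memLp_two_ft)

lemma ft_symbFun {m : Space d → ℂ} (hm : BddSymbol m) (x : WienerAlg d) :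
    ft (symbFun hm x) =ᵐ[volume] fun ξ => m ξ * ft x ξ := ft_mk _ _

lemma norm_symbFun_le {m : Space d → ℂ} (hm : BddSymbol m) {C : ℝ} (hC0 : 0 ≤ C)
    (hC : ∀ ξ, ‖m ξ‖ ≤ C) (x : WienerAlg d) : ‖symbFun hm x‖ ≤ C * ‖x‖ := by
  refine norm_le_mul_of_ft hC0 ?_
  filter_upwards [ft_symbFun hm x] with ξ h
  rw [h, norm_mul]
  gcongr
  exact hC ξ

open Classical in
/-- The Fourier multiplier with symbol `m`, as a bounded operator on `W ∩ L²`
(zero if the symbol is not a bounded measurable function). -/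
def symb (m : Space d → ℂ) : WienerAlg d →L[ℂ] WienerAlg d :=
  if hm : BddSymbol m then
    LinearMap.mkContinuousOfExistsBound
      { toFun := symbFun hm
        map_add' := fun x y => ext_ft <| by
          filter_upwards [ft_symbFun hm (x + y), ft_symbFun hm x, ft_symbFun hm y, ft_add x y,
            ft_add (symbFun hm x) (symbFun hm y)] with ξ h1 h2 h3 h4 h5
          rw [h1, h5, h4, Pi.add_apply, Pi.add_apply, h2, h3, mul_add]
        map_smul' := fun c x => ext_ft <| by
          filter_upwards [ft_symbFun hm (c • x), ft_symbFun hm x, ft_smul c x,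
            ft_smul c (symbFun hm x)] with ξ h1 h2 h3 h4
          rw [RingHom.id_apply, h1, h4, h3, Pi.smul_apply, Pi.smul_apply, h2, smul_eq_mul,
            smul_eq_mul]
          ring }
      (by
        obtain ⟨C, hC⟩ := hm.2
        exact ⟨C, norm_symbFun_le hm ((norm_nonneg _).trans (hC 0)) hC⟩)
  else 0

lemma symb_apply {m : Space d → ℂ} (hm : BddSymbol m) (x : WienerAlg d) :
    symb m x = symbFun hm x := by
  rw [symb, dif_pos hm]; rfl

lemma ft_symb {m : Space d → ℂ} (hm : BddSymbol m) (x : WienerAlg d) :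
    ft (symb m x) =ᵐ[volume] fun ξ => m ξ * ft x ξ := by
  rw [symb_apply hm]; exact ft_symbFun hm x

lemma norm_symb_le_mul {m m' : Space d → ℂ} (hm : BddSymbol m) (hm' : BddSymbol m') {c : ℝ}
    (hc : 0 ≤ c) (h : ∀ ξ, ‖m ξ‖ ≤ c * ‖m' ξ‖) (x : WienerAlg d) :
    ‖symb m x‖ ≤ c * ‖symb m' x‖ := by
  refine norm_le_mul_of_ft hc ?_
  filter_upwards [ft_symb hm x, ft_symb hm' x] with ξ h1 h2
  rw [h1, h2, norm_mul, norm_mul, ← mul_assoc]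
  gcongr
  exact h ξ

lemma symb_const (c : ℂ) (x : WienerAlg d) : symb (fun _ => c) x = c • x := ext_ft <| by
  filter_upwards [ft_symb (BddSymbol.const c) x, ft_smul c x] with ξ h1 h2
  rw [h1, h2]; rfl

lemma symb_one (x : WienerAlg d) : symb (fun _ => 1) x = x := by rw [symb_const, one_smul]

lemma norm_symb_le {m : Space d → ℂ} (hm : BddSymbol m) {C : ℝ} (hC : ∀ ξ, ‖m ξ‖ ≤ C)
    (x : WienerAlg d) : ‖symb m x‖ ≤ C * ‖x‖ := by
  rw [symb_apply hm]; exact norm_symbFun_le hm ((norm_nonneg _).trans (hC 0)) hC x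

lemma symb_symb {m m' : Space d → ℂ} (hm : BddSymbol m) (hm' : BddSymbol m') (x : WienerAlg d) :
    symb m (symb m' x) = symb (fun ξ => m ξ * m' ξ) x := ext_ft <| by
  filter_upwards [ft_symb hm (symb m' x), ft_symb hm' x, ft_symb (hm.mul hm') x] with ξ h1 h2 h3
  rw [h1, h2, h3, mul_assoc]

lemma symb_sub {m m' : Space d → ℂ} (hm : BddSymbol m) (hm' : BddSymbol m') (x : WienerAlg d) :
    symb m x - symb m' x = symb (fun ξ => m ξ - m' ξ) x := ext_ft <| by
  filter_upwards [ft_sub (symb m x) (symb m' x), ft_symb hm x, ft_symb hm' x,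
    ft_symb (hm.sub hm') x] with ξ h1 h2 h3 h4
  rw [h1, h4, Pi.sub_apply, h2, h3, sub_mul]

lemma toLTwo_symb {m : Space d → ℂ} (hm : BddSymbol m) (x : WienerAlg d) :
    toLTwo (symb m x) = multiplier m (toLTwo x) := by
  rw [multiplier, toLTwo_def, fourier_toLTwo]
  congr 1
  exact (toL2_eq_of_ae_eq (ft_symb hm x).symm).symm

lemma symb_shift {m : Space d → ℂ} (hm : BddSymbol m) (v : Space d) (x : WienerAlg d) :
    symb m (shift v x) = shift v (symb (fun ξ => m (ξ + v)) x) := ext_ft <| by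
  have h5 := (measurePreserving_sub_right (volume : Measure (Space d)) v).quasiMeasurePreserving.ae
    (ft_symb (hm.comp_add v) x)
  filter_upwards [ft_symb hm (shift v x), ft_shift v x,
    ft_shift v (symb (fun ξ => m (ξ + v)) x), h5] with ξ h1 h2 h3 h4
  rw [h1, h2, h3, h4, sub_add_cancel]

/-- A Leibniz-type estimate: a multiplier whose symbol is subadditive up to changing the symbol
distributes over products. -/
lemma norm_symb_mulL_le {w w₁ w₂ : Space d → ℂ} (hw : BddSymbol w) (hw₁ : BddSymbol w₁)
    (hw₂ : BddSymbol w₂) (h : ∀ s t, ‖w (s + t)‖ ≤ ‖w₁ s‖ + ‖w₂ t‖) (x y : WienerAlg d) :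
    ‖symb w (mulL x y)‖ ≤ ‖symb w₁ x‖ * ‖y‖ + ‖x‖ * ‖symb w₂ y‖ := by
  have e : ft (symb w (mulL x y)) =ᵐ[volume]
      fun ξ => w ξ * convolution (ft x) (ft y) (ContinuousLinearMap.mul ℂ ℂ) volume ξ := by
    have h2 : ft (mulL x y) =ᵐ[volume] _ := ft_mk (memLp_convolution x y (.inl rfl))
      (memLp_convolution x y (.inr rfl))
    filter_upwards [ft_symb hw (mulL x y), h2] with ξ h3 h4
    rw [h3, h4]
  have hx1 : eLpNorm (ft x) 1 volume ≤ ‖x‖ₑ := by rw [enorm_eq]; exact le_self_add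
  have hx2 : eLpNorm (fun ξ => w₁ ξ * ft x ξ) 1 volume ≤ ‖symb w₁ x‖ₑ := by
    rw [enorm_eq, eLpNorm_congr_ae (ft_symb hw₁ x)]; exact le_self_add
  have key : ‖symb w (mulL x y)‖ₑ ≤ ‖symb w₁ x‖ₑ * ‖y‖ₑ + ‖x‖ₑ * ‖symb w₂ y‖ₑ := by
    rw [enorm_eq (symb w (mulL x y)), enorm_eq y, enorm_eq (symb w₂ y), eLpNorm_congr_ae e,
      eLpNorm_congr_ae e, eLpNorm_congr_ae (ft_symb hw₂ y), eLpNorm_congr_ae (ft_symb hw₂ y),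
      mul_add, mul_add, add_add_add_comm]
    refine add_le_add
      ((eLpNorm_mul_convolution_le x.memLp_one_ft.1 y.memLp_one_ft.1 hw₁.1 hw₂.1 h
        (.inl rfl)).trans ?_)
      ((eLpNorm_mul_convolution_le x.memLp_one_ft.1 y.memLp_one_ft.1 hw₁.1 hw₂.1 h
        (.inr rfl)).trans ?_) <;> gcongr
  simp only [norm_eq_toReal_enorm]
  rw [← ENNReal.toReal_mul, ← ENNReal.toReal_mul, ← ENNReal.toReal_add
    (ENNReal.mul_ne_top enorm_ne_top enorm_ne_top) (ENNReal.mul_ne_top enorm_ne_top enorm_ne_top)]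
  exact ENNReal.toReal_mono (ENNReal.add_ne_top.2 ⟨ENNReal.mul_ne_top enorm_ne_top enorm_ne_top,
    ENNReal.mul_ne_top enorm_ne_top enorm_ne_top⟩) key

lemma norm_symb_conjL_le {w w' : Space d → ℂ} (hw : BddSymbol w) (hw' : BddSymbol w')
    (h : ∀ ξ, ‖w (-ξ)‖ ≤ ‖w' ξ‖) (x : WienerAlg d) :
    ‖symb w (conjL x)‖ ≤ ‖symb w' x‖ := by
  rw [← norm_conjL (symb w' x), ← one_mul ‖conjL _‖]
  refine norm_le_mul_of_ft zero_le_one ?_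
  have h5 := (Measure.measurePreserving_neg
    (volume : Measure (Space d))).quasiMeasurePreserving.ae (ft_symb hw' x)
  filter_upwards [ft_symb hw (conjL x), ft_conjFun x, ft_conjFun (symb w' x), h5]
    with ξ h1 h2 h3 h4
  have h2' : ft (conjL x) ξ = _ := h2
  have h3' : ft (conjL (symb w' x)) ξ = _ := h3
  rw [h1, h2', h3', h4, one_mul, norm_mul, map_mul, norm_mul, RCLike.norm_conj, RCLike.norm_conj]
  gcongr
  simpa using h (-ξ)

end WienerAlg

lemma tendsto_eLpNorm_mul_zero {ι : Type*} {l : Filter ι} [l.IsCountablyGenerated]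
    {m : ι → Space d → ℂ} {C : ℝ} {F : Space d → ℂ} {p : ℝ≥0∞} (hp : p ≠ 0) (hp' : p ≠ ∞)
    (hm : ∀ᶠ i in l, Measurable (m i)) (hC : ∀ᶠ i in l, ∀ ξ, ‖m i ξ‖ ≤ C)
    (hF : MemLp F p volume) (h : ∀ᵐ ξ, Tendsto (fun i => m i ξ) l (𝓝 0)) :
    Tendsto (fun i => eLpNorm (fun ξ => m i ξ * F ξ) p volume) l (𝓝 0) := by
  have hpr : 0 < p.toReal := ENNReal.toReal_pos hp hp'
  simp_rw [eLpNorm_eq_lintegral_rpow_enorm_toReal hp hp']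
  have key : Tendsto (fun i => ∫⁻ ξ, ‖m i ξ * F ξ‖ₑ ^ p.toReal) l (𝓝 (∫⁻ _ : Space d, 0)) := by
    refine tendsto_lintegral_filter_of_dominated_convergence'
      (fun ξ => (ENNReal.ofReal C * ‖F ξ‖ₑ) ^ p.toReal) ?_ ?_ ?_ ?_
    · filter_upwards [hm] with i hi
      exact (hi.aestronglyMeasurable.mul hF.1).enorm.pow_const _
    · filter_upwards [hC] with i hi
      refine Eventually.of_forall fun ξ => ?_
      rw [enorm_mul]
      refine ENNReal.rpow_le_rpow (mul_le_mul_left ?_ _) hpr.le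
      rw [← ofReal_norm]
      exact ENNReal.ofReal_le_ofReal (hi ξ)
    · simp_rw [ENNReal.mul_rpow_of_nonneg _ _ hpr.le]
      rw [lintegral_const_mul'' _ (hF.1.enorm.pow_const _)]
      refine ENNReal.mul_ne_top (ENNReal.rpow_ne_top_of_nonneg hpr.le ENNReal.ofReal_ne_top) ?_
      exact (lintegral_rpow_enorm_lt_top_of_eLpNorm_lt_top hp hp' hF.2).ne
    · filter_upwards [h] with ξ hξ
      have h1 : Tendsto (fun i => ‖m i ξ * F ξ‖ₑ) l (𝓝 0) := by
        have := (hξ.mul_const (F ξ)).enorm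
        simpa using this
      have := h1.ennrpow_const p.toReal
      rwa [ENNReal.zero_rpow_of_pos hpr] at this
  rw [lintegral_zero] at key
  have := key.ennrpow_const (1 / p.toReal)
  rwa [ENNReal.zero_rpow_of_pos (by positivity)] at this

namespace WienerAlg

lemma tendsto_symb {ι : Type*} {l : Filter ι} [l.IsCountablyGenerated]
    {m : ι → Space d → ℂ} {m₀ : Space d → ℂ} {C : ℝ}
    (hm : ∀ᶠ i in l, Measurable (m i)) (hC : ∀ᶠ i in l, ∀ ξ, ‖m i ξ‖ ≤ C)
    (hm₀ : BddSymbol m₀) (h : ∀ᵐ ξ, Tendsto (fun i => m i ξ) l (𝓝 (m₀ ξ))) (x : WienerAlg d) :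
    Tendsto (fun i => symb (m i) x) l (𝓝 (symb m₀ x)) := by
  obtain ⟨C₀, hC₀⟩ := hm₀.2
  rw [tendsto_iff_norm_sub_tendsto_zero]
  have key : Tendsto (fun i => ‖symb (m i) x - symb m₀ x‖ₑ) l (𝓝 0) := by
    have e : ∀ᶠ i in l, ‖symb (m i) x - symb m₀ x‖ₑ
        = eLpNorm (fun ξ => (m i ξ - m₀ ξ) * ft x ξ) 1 volume
          + eLpNorm (fun ξ => (m i ξ - m₀ ξ) * ft x ξ) 2 volume := by
      filter_upwards [hm, hC] with i h1 h2
      have hi : BddSymbol (m i) := ⟨h1, C, h2⟩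
      rw [symb_sub hi hm₀, enorm_eq, eLpNorm_congr_ae (ft_symb (hi.sub hm₀) x),
        eLpNorm_congr_ae (ft_symb (hi.sub hm₀) x)]
    rw [tendsto_congr' e, ← add_zero (0 : ℝ≥0∞)]
    have hb : ∀ᶠ i in l, ∀ ξ, ‖m i ξ - m₀ ξ‖ ≤ C + C₀ := by
      filter_upwards [hC] with i hi ξ
      exact (norm_sub_le _ _).trans (add_le_add (hi ξ) (hC₀ ξ))
    have hmm : ∀ᶠ i in l, Measurable (fun ξ => m i ξ - m₀ ξ) := by
      filter_upwards [hm] with i hi using hi.sub hm₀.1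
    have ht : ∀ᵐ ξ, Tendsto (fun i => m i ξ - m₀ ξ) l (𝓝 0) := by
      filter_upwards [h] with ξ hξ
      simpa using hξ.sub_const (m₀ ξ)
    exact (tendsto_eLpNorm_mul_zero (by norm_num) (by norm_num) hmm hb x.memLp_one_ft ht).add
      (tendsto_eLpNorm_mul_zero (by norm_num) (by norm_num) hmm hb x.memLp_two_ft ht)
  have := (ENNReal.tendsto_toReal ENNReal.zero_ne_top).comp key
  simpa [Function.comp_def, ← norm_eq_toReal_enorm] using this

end WienerAlg

/-! ### Gauge-invariant power nonlinearities -/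

lemma norm_real_smul {B : Type*} [NormedAddCommGroup B] [NormedSpace ℂ B] (r : ℝ) (x : B) :
    ‖(r : ℂ) • x‖ = |r| * ‖x‖ := by
  rw [norm_smul, Complex.norm_real, Real.norm_eq_abs]

section Nonlinearity

variable {B : Type*} [NormedAddCommGroup B] [NormedSpace ℂ B] [ConjAlg B]

/-- The factor number `n` of an alternating product: conjugated if `n` is odd. -/
def altFactor (n : ℕ) (x : B) : B := if Even n then x else conjL x

lemma norm_altFactor (n : ℕ) (x : B) : ‖altFactor n x‖ = ‖x‖ := by
  unfold altFactor; split_ifs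
  exacts [rfl, norm_conjL x]

lemma altFactor_sub (n : ℕ) (x y : B) : altFactor n x - altFactor n y = altFactor n (x - y) := by
  unfold altFactor; split_ifs
  exacts [rfl, (map_sub _ _ _).symm]

lemma continuous_altFactor (n : ℕ) : Continuous (altFactor n : B → B) := by
  unfold altFactor; split_ifs
  exacts [continuous_id, conjL.continuous]

/-- The product `a₀ (conj a₁) a₂ (conj a₃) ⋯` of `n` factors. The empty product is not available
in an algebra without unit, and is given the value `0`. -/
def altProd : (n : ℕ) → (Fin n → B) → B
  | 0, _ => 0
  | 1, a => a 0
  | n + 2, a => mulL (altProd (n + 1) fun i => a i.castSucc)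
      (altFactor (n + 1) (a (Fin.last (n + 1))))

lemma altProd_one (a : Fin 1 → B) : altProd 1 a = a 0 := rfl

lemma altProd_succ (n : ℕ) (a : Fin (n + 2) → B) : altProd (n + 2) a
    = mulL (altProd (n + 1) fun i => a i.castSucc) (altFactor (n + 1) (a (Fin.last (n + 1)))) := rfl

/-- The product `x (conj x) x (conj x) ⋯` of `n` factors. -/
def altPow (n : ℕ) (x : B) : B := altProd n fun _ => x

lemma altPow_one (x : B) : altPow 1 x = x := rfl

lemma altPow_succ (n : ℕ) (x : B) :
    altPow (n + 2) x = mulL (altPow (n + 1) x) (altFactor (n + 1) x) := rfl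

lemma norm_altProd_le (n : ℕ) (a : Fin (n + 1) → B) : ‖altProd (n + 1) a‖ ≤ ∏ i, ‖a i‖ := by
  induction n with
  | zero => simp [altProd_one]
  | succ n ih =>
    rw [altProd_succ, Fin.prod_univ_castSucc]
    refine (norm_mulL_le _ _).trans ?_
    rw [norm_altFactor]
    gcongr
    exact ih _

lemma norm_altPow_le (n : ℕ) (x : B) : ‖altPow (n + 1) x‖ ≤ ‖x‖ ^ (n + 1) := by
  simpa [altPow] using norm_altProd_le n fun _ => x

lemma continuous_altPow (n : ℕ) : Continuous (altPow n : B → B) := by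
  induction n with
  | zero => exact continuous_const
  | succ n ih =>
    cases n with
    | zero => exact continuous_id
    | succ n => exact ((mulL (B := B)).continuous.comp ih).clm_apply (continuous_altFactor _)

lemma norm_mulL_sub_le (a b x y : B) :
    ‖mulL a x - mulL b y‖ ≤ ‖a - b‖ * ‖x‖ + ‖b‖ * ‖x - y‖ := by
  have : mulL a x - mulL b y = mulL (a - b) x + mulL b (x - y) := by
    simp only [map_sub, sub_apply]; abel
  rw [this]
  exact (norm_add_le _ _).trans (add_le_add (norm_mulL_le _ _) (norm_mulL_le _ _))

lemma norm_altPow_sub_le (n : ℕ) {R : ℝ} {x y : B} (hx : ‖x‖ ≤ R) (hy : ‖y‖ ≤ R) :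
    ‖altPow (n + 1) x - altPow (n + 1) y‖ ≤ (n + 1) * R ^ n * ‖x - y‖ := by
  have hR : 0 ≤ R := (norm_nonneg _).trans hx
  induction n with
  | zero => simp [altPow_one]
  | succ n ih =>
    rw [altPow_succ, altPow_succ]
    refine (norm_mulL_sub_le _ _ _ _).trans ?_
    rw [altFactor_sub, norm_altFactor, norm_altFactor]
    have h1 : ‖altPow (n + 1) y‖ ≤ R ^ (n + 1) :=
      (norm_altPow_le n y).trans (by gcongr)
    calc _ ≤ (n + 1) * R ^ n * ‖x - y‖ * R + R ^ (n + 1) * ‖x - y‖ := by gcongr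
      _ = _ := by push_cast; ring

/-- The nonlinearity `λ E(|x|^{2ν}) x + μ |x|^{2ν} x`, where `|x|^{2ν}` is an alternating product of
`n = 2ν` factors and `E` is a bounded operator. -/
def powerNonlin (lam mu : ℝ) (n : ℕ) (E : B →L[ℂ] B) (x : B) : B :=
  (lam : ℂ) • mulL (E (altPow n x)) x + (mu : ℂ) • mulL (altPow n x) x

lemma continuous_powerNonlin (lam mu : ℝ) (n : ℕ) (E : B →L[ℂ] B) :
    Continuous (powerNonlin lam mu n E) := by
  have h := continuous_altPow (B := B) n
  have h1 : Continuous fun x : B => mulL (E (altPow n x)) x :=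
    ((mulL (B := B)).continuous.comp (E.continuous.comp h)).clm_apply continuous_id
  have h2 : Continuous fun x : B => mulL (altPow n x) x :=
    ((mulL (B := B)).continuous.comp h).clm_apply continuous_id
  exact (h1.const_smul (lam : ℂ)).add (h2.const_smul (mu : ℂ))

lemma norm_powerNonlin_sub_le {lam mu : ℝ} (n : ℕ) {E : B →L[ℂ] B} {Λ : ℝ}
    (hE : ∀ x, ‖E x‖ ≤ Λ * ‖x‖) (hΛ : 0 ≤ Λ) {R : ℝ} {x y : B} (hx : ‖x‖ ≤ R) (hy : ‖y‖ ≤ R) :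
    ‖powerNonlin lam mu (n + 1) E x - powerNonlin lam mu (n + 1) E y‖
      ≤ (|lam| * Λ + |mu|) * ((n + 2) * R ^ (n + 1)) * ‖x - y‖ := by
  have hR : 0 ≤ R := (norm_nonneg _).trans hx
  have hp := norm_altPow_sub_le n hx hy
  have hy' : ‖altPow (n + 1) y‖ ≤ R ^ (n + 1) := (norm_altPow_le n y).trans (by gcongr)
  have h1 : ‖mulL (E (altPow (n + 1) x)) x - mulL (E (altPow (n + 1) y)) y‖
      ≤ Λ * (((n + 2) * R ^ (n + 1)) * ‖x - y‖) := by
    refine (norm_mulL_sub_le _ _ _ _).trans ?_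
    rw [← map_sub]
    calc _ ≤ Λ * ((n + 1) * R ^ n * ‖x - y‖) * R + Λ * R ^ (n + 1) * ‖x - y‖ := by
          gcongr
          · exact (hE _).trans (by gcongr)
          · exact (hE _).trans (by gcongr)
      _ = _ := by ring
  have h2 : ‖mulL (altPow (n + 1) x) x - mulL (altPow (n + 1) y) y‖
      ≤ ((n + 2) * R ^ (n + 1)) * ‖x - y‖ := by
    refine (norm_mulL_sub_le _ _ _ _).trans ?_
    calc _ ≤ ((n + 1) * R ^ n * ‖x - y‖) * R + R ^ (n + 1) * ‖x - y‖ := by gcongr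
      _ = _ := by ring
  have e : powerNonlin lam mu (n + 1) E x - powerNonlin lam mu (n + 1) E y
      = (lam : ℂ) • (mulL (E (altPow (n + 1) x)) x - mulL (E (altPow (n + 1) y)) y)
        + (mu : ℂ) • (mulL (altPow (n + 1) x) x - mulL (altPow (n + 1) y) y) := by
    simp only [powerNonlin, smul_sub]; abel
  rw [e]
  refine (norm_add_le _ _).trans ?_
  rw [norm_real_smul, norm_real_smul]
  calc _ ≤ |lam| * (Λ * (((n + 2) * R ^ (n + 1)) * ‖x - y‖))
        + |mu| * (((n + 2) * R ^ (n + 1)) * ‖x - y‖) := by gcongr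
    _ = _ := by ring

lemma powerNonlin_zero (lam mu : ℝ) (n : ℕ) (E : B →L[ℂ] B) : powerNonlin lam mu n E 0 = 0 := by
  simp [powerNonlin]

lemma norm_powerNonlin_sub_powerNonlin_le (lam mu : ℝ) (n : ℕ) (E E' : B →L[ℂ] B) (x : B) :
    ‖powerNonlin lam mu n E x - powerNonlin lam mu n E' x‖
      ≤ |lam| * (‖E (altPow n x) - E' (altPow n x)‖ * ‖x‖) := by
  have e : powerNonlin lam mu n E x - powerNonlin lam mu n E' x
      = (lam : ℂ) • mulL (E (altPow n x) - E' (altPow n x)) x := by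
    simp only [powerNonlin, map_sub, sub_apply, smul_sub]; abel
  rw [e, norm_real_smul]
  gcongr
  exact norm_mulL_le _ _

/-- An operator that satisfies a Leibniz-type estimate. -/
structure IsTame (D : B →L[ℂ] B) : Prop where
  mulL_le : ∀ x y, ‖D (mulL x y)‖ ≤ 2 * (‖D x‖ * ‖y‖ + ‖x‖ * ‖D y‖)
  conjL_le : ∀ x, ‖D (conjL x)‖ ≤ ‖D x‖

lemma IsTame.altFactor_le {D : B →L[ℂ] B} (hD : IsTame D) (n : ℕ) (x : B) :
    ‖D (altFactor n x)‖ ≤ ‖D x‖ := by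
  unfold altFactor; split_ifs
  exacts [le_rfl, hD.conjL_le x]

lemma IsTame.altPow_le {D : B →L[ℂ] B} (hD : IsTame D) (n : ℕ) {R : ℝ} {x : B} (hx : ‖x‖ ≤ R) :
    ‖D (altPow (n + 1) x)‖ ≤ 4 ^ n * R ^ n * ‖D x‖ := by
  have hR : 0 ≤ R := (norm_nonneg _).trans hx
  induction n with
  | zero => simp [altPow_one]
  | succ n ih =>
    rw [altPow_succ]
    refine (hD.mulL_le _ _).trans ?_
    rw [norm_altFactor]
    have h1 : ‖altPow (n + 1) x‖ ≤ R ^ (n + 1) := (norm_altPow_le n x).trans (by gcongr)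
    have h4 : (1 : ℝ) ≤ 4 ^ n := one_le_pow₀ (by norm_num)
    calc _ ≤ 2 * (4 ^ n * R ^ n * ‖D x‖ * R + R ^ (n + 1) * ‖D x‖) := by
          gcongr
          exact hD.altFactor_le _ _
      _ = (2 * 4 ^ n + 2 * 1) * (R ^ (n + 1) * ‖D x‖) := by ring
      _ ≤ (2 * 4 ^ n + 2 * 4 ^ n) * (R ^ (n + 1) * ‖D x‖) := by gcongr
      _ = _ := by ring

/-- The nonlinearity does not lose regularity: a tame estimate, linear in the top norm. -/
lemma IsTame.powerNonlin_le {D : B →L[ℂ] B} (hD : IsTame D) {lam mu : ℝ} (n : ℕ) {E : B →L[ℂ] B}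
    {Λ : ℝ} (hE : ∀ x, ‖E x‖ ≤ Λ * ‖x‖) (hDE : ∀ x, ‖D (E x)‖ ≤ Λ * ‖D x‖) (hΛ : 0 ≤ Λ) {R : ℝ}
    {x : B} (hx : ‖x‖ ≤ R) :
    ‖D (powerNonlin lam mu (n + 1) E x)‖
      ≤ (|lam| * Λ + |mu|) * (4 ^ (n + 1) * R ^ (n + 1)) * ‖D x‖ := by
  have hR : 0 ≤ R := (norm_nonneg _).trans hx
  have hp := hD.altPow_le n hx
  have hx' : ‖altPow (n + 1) x‖ ≤ R ^ (n + 1) := (norm_altPow_le n x).trans (by gcongr)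
  have h4 : (1 : ℝ) ≤ 4 ^ n := one_le_pow₀ (by norm_num)
  have key : 2 * (4 ^ n * R ^ n * ‖D x‖ * R + R ^ (n + 1) * ‖D x‖)
      ≤ 4 ^ (n + 1) * R ^ (n + 1) * ‖D x‖ := by
    calc _ = (2 * 4 ^ n + 2 * 1) * (R ^ (n + 1) * ‖D x‖) := by ring
      _ ≤ (2 * 4 ^ n + 2 * 4 ^ n) * (R ^ (n + 1) * ‖D x‖) := by gcongr
      _ = _ := by ring
  have h1 : ‖D (mulL (E (altPow (n + 1) x)) x)‖
      ≤ Λ * (4 ^ (n + 1) * R ^ (n + 1) * ‖D x‖) := by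
    refine (hD.mulL_le _ _).trans ?_
    calc _ ≤ 2 * (Λ * (4 ^ n * R ^ n * ‖D x‖) * R + Λ * R ^ (n + 1) * ‖D x‖) := by
          gcongr
          · exact (hDE _).trans (by gcongr)
          · exact (hE _).trans (by gcongr)
      _ = Λ * (2 * (4 ^ n * R ^ n * ‖D x‖ * R + R ^ (n + 1) * ‖D x‖)) := by ring
      _ ≤ _ := by gcongr
  have h2 : ‖D (mulL (altPow (n + 1) x) x)‖ ≤ 4 ^ (n + 1) * R ^ (n + 1) * ‖D x‖ := by
    refine (hD.mulL_le _ _).trans (le_trans ?_ key)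
    gcongr
  rw [powerNonlin, map_add, map_smul, map_smul]
  refine (norm_add_le _ _).trans ?_
  rw [norm_real_smul, norm_real_smul]
  calc _ ≤ |lam| * (Λ * (4 ^ (n + 1) * R ^ (n + 1) * ‖D x‖))
        + |mu| * (4 ^ (n + 1) * R ^ (n + 1) * ‖D x‖) := by gcongr
    _ = _ := by ring

variable {C : Type*} [NormedAddCommGroup C] [NormedSpace ℂ C] [ConjAlg C]

lemma map_altFactor {f : B →L[ℂ] C} (hc : ∀ x, f (conjL x) = conjL (f x)) (n : ℕ) (x : B) :
    f (altFactor n x) = altFactor n (f x) := by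
  unfold altFactor; split_ifs
  exacts [rfl, hc x]

lemma map_altPow {f : B →L[ℂ] C} (hm : ∀ x y, f (mulL x y) = mulL (f x) (f y))
    (hc : ∀ x, f (conjL x) = conjL (f x)) (n : ℕ) (x : B) :
    f (altPow n x) = altPow n (f x) := by
  induction n with
  | zero => exact map_zero f
  | succ n ih =>
    cases n with
    | zero => rfl
    | succ n => rw [altPow_succ, altPow_succ, hm, ih, map_altFactor hc]

lemma map_powerNonlin {f : B →L[ℂ] C} (hm : ∀ x y, f (mulL x y) = mulL (f x) (f y))
    (hc : ∀ x, f (conjL x) = conjL (f x)) {E : B →L[ℂ] B} {E' : C →L[ℂ] C}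
    (hE : ∀ x, f (E x) = E' (f x)) (lam mu : ℝ) (n : ℕ) (x : B) :
    f (powerNonlin lam mu n E x) = powerNonlin lam mu n E' (f x) := by
  simp only [powerNonlin, map_add, map_smul, hm, hE, map_altPow hm hc]

end Nonlinearity

/-! ### Truncated integral equations -/

section Retraction

variable {B : Type*} [NormedAddCommGroup B] [NormedSpace ℝ B]

/-- The radial retraction onto the ball of radius `R`. -/
def retract (R : ℝ) (x : B) : B := (R / max R ‖x‖) • x

lemma retract_of_norm_le {R : ℝ} (hR : 0 < R) {x : B} (hx : ‖x‖ ≤ R) : retract R x = x := by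
  rw [retract, max_eq_left hx, div_self hR.ne', one_smul]

lemma norm_retract_le {R : ℝ} (hR : 0 < R) (x : B) : ‖retract R x‖ ≤ R := by
  have hM : 0 < max R ‖x‖ := lt_max_of_lt_left hR
  rw [retract, norm_smul, Real.norm_eq_abs, abs_of_pos (div_pos hR hM), div_mul_eq_mul_div,
    div_le_iff₀ hM]
  gcongr
  exact le_max_right _ _

lemma norm_retract_sub_le {R : ℝ} (hR : 0 < R) (x y : B) :
    ‖retract R x - retract R y‖ ≤ 2 * ‖x - y‖ := by
  have hM : 0 < max R ‖x‖ := lt_max_of_lt_left hR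
  have hN : 0 < max R ‖y‖ := lt_max_of_lt_left hR
  have e : retract R x - retract R y
      = (R / max R ‖x‖) • (x - y) + (R / max R ‖x‖ - R / max R ‖y‖) • y := by
    simp only [retract, smul_sub, sub_smul]; abel
  rw [e]
  refine (norm_add_le _ _).trans ?_
  rw [norm_smul, norm_smul, Real.norm_eq_abs, Real.norm_eq_abs, abs_of_pos (div_pos hR hM),
    two_mul]
  have h1 : R / max R ‖x‖ ≤ 1 := (div_le_one hM).2 (le_max_left _ _)
  have h2 : |max R ‖y‖ - max R ‖x‖| ≤ ‖x - y‖ := by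
    rw [norm_sub_rev]
    refine (abs_max_sub_max_le_max R ‖y‖ R ‖x‖).trans ?_
    rw [sub_self, abs_zero]
    exact max_le (norm_nonneg _) (abs_norm_sub_norm_le y x)
  have h3 : |R / max R ‖x‖ - R / max R ‖y‖| * ‖y‖ ≤ ‖x - y‖ := by
    rw [div_sub_div _ _ hM.ne' hN.ne', mul_comm (max R ‖x‖) R, ← mul_sub, abs_div, abs_mul,
      abs_of_pos hR,
      abs_of_pos (mul_pos hM hN), div_mul_eq_mul_div, div_le_iff₀ (mul_pos hM hN)]
    calc R * |max R ‖y‖ - max R ‖x‖| * ‖y‖ ≤ max R ‖x‖ * ‖x - y‖ * max R ‖y‖ := by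
          gcongr
          · exact le_max_left _ _
          · exact le_max_right _ _
      _ = _ := by ring
  refine add_le_add ?_ h3
  calc _ ≤ 1 * ‖x - y‖ := by gcongr
    _ = _ := one_mul _

end Retraction

section Integral

variable {B : Type*} [NormedAddCommGroup B] [NormedSpace ℝ B]

/-- Global solvability of integral equations with a bounded, globally Lipschitz right-hand side. -/
lemma exists_integral_solution [CompleteSpace B] {T : ℝ} (hT : 0 ≤ T) (G : ℝ → B → B)
    (hc : ∀ x, Continuous fun t => G t x) {L M : ℝ} (hL0 : 0 ≤ L) (hM0 : 0 ≤ M)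
    (hL : ∀ t x y, ‖G t x - G t y‖ ≤ L * ‖x - y‖) (hM : ∀ t x, ‖G t x‖ ≤ M) (y₀ : B) :
    ∃ y : ℝ → B, Continuous y ∧ ∀ t ∈ Icc 0 T, y t = y₀ + ∫ τ in (0 : ℝ)..t, G τ (y τ) := by
  have h0 : (0 : ℝ) ∈ Icc 0 T := ⟨le_rfl, hT⟩
  lift L to NNReal using hL0
  lift M to NNReal using hM0
  have hPL : IsPicardLindelof G (⟨0, h0⟩ : Icc (0 : ℝ) T) y₀ (M * T.toNNReal) 0 M L :=
    { lipschitzOnWith := fun t _ => (LipschitzWith.of_dist_le_mul fun x y => by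
        rw [dist_eq_norm, dist_eq_norm]; exact hL t x y).lipschitzOnWith
      continuousOn := fun x _ => (hc x).continuousOn
      norm_le := fun t _ x _ => hM t x
      mul_max_le := by
        simp [max_eq_left hT, Real.coe_toNNReal T hT] }
  obtain ⟨α, hα⟩ := ODE.FunSpace.exists_isFixedPt_next hPL
    (Metric.mem_closedBall_self le_rfl : y₀ ∈ Metric.closedBall y₀ ((0 : NNReal) : ℝ))
  refine ⟨α.compProj, α.continuous_compProj, fun t ht => ?_⟩
  have := (ODE.FunSpace.isFixedPt_next_iff hPL _).1 hα ⟨t, ht⟩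
  rw [ODE.FunSpace.compProj_of_mem ht, this]
  rfl

/-- Grönwall's inequality in integral form. -/
lemma gronwall_integral {f : ℝ → ℝ} (hf : Continuous f) (hf0 : ∀ t, 0 ≤ f t) {A K T : ℝ}
    (hA : 0 ≤ A) (hK : 0 ≤ K) (h : ∀ t ∈ Icc 0 T, f t ≤ A + K * ∫ τ in (0 : ℝ)..t, f τ) :
    ∀ t ∈ Icc 0 T, f t ≤ A * Real.exp (K * T) := by
  intro t ht
  set g : ℝ → ℝ := fun t => A + K * ∫ τ in (0 : ℝ)..t, f τ with hg
  have hd : ∀ s, HasDerivAt g (K * f s) s := fun s =>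
    ((intervalIntegral.integral_hasDerivAt_right (hf.intervalIntegrable _ _)
      (hf.stronglyMeasurableAtFilter _ _) hf.continuousAt).const_mul K).const_add A
  have hg0 : ∀ s ∈ Icc 0 T, 0 ≤ g s := fun s hs => (hf0 s).trans (h s hs)
  have := norm_le_gronwallBound_of_norm_deriv_right_le (f := g) (f' := fun s => K * f s)
    (δ := A) (K := K) (ε := 0) (a := 0) (b := T)
    (fun s _ => (hd s).continuousAt.continuousWithinAt) (fun s _ => (hd s).hasDerivWithinAt)
    (by simp [hg, abs_of_nonneg hA])
    (fun s hs => by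
      have hs' : s ∈ Icc 0 T := ⟨hs.1, hs.2.le⟩
      rw [add_zero, Real.norm_eq_abs, Real.norm_eq_abs, abs_of_nonneg (mul_nonneg hK (hf0 s)),
        abs_of_nonneg (hg0 s hs')]
      exact mul_le_mul_of_nonneg_left (h s hs') hK) t ht
  rw [gronwallBound_ε0, sub_zero, Real.norm_eq_abs, abs_of_nonneg (hg0 t ht)] at this
  refine (h t ht).trans (this.trans ?_)
  gcongr
  exact ht.2

/-- Averaging: if the operators `O τ` are contractions, and the mean of `O` over each interval of
length `p` annihilates all values of the Lipschitz function `h`, then the integral of `O h` is of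
size `p`. -/
lemma norm_integral_averaging_le {O : ℝ → B → B} {h : ℝ → B} {p T Lh Mh : ℝ} (hp : 0 < p)
    (hLh : 0 ≤ Lh)
    (hOsub : ∀ τ x y, O τ x - O τ y = O τ (x - y)) (hO1 : ∀ τ x, ‖O τ x‖ ≤ ‖x‖)
    (hOc : ∀ x, Continuous fun τ => O τ x) (hOh : Continuous fun τ => O τ (h τ))
    (hper : ∀ s r, ∫ τ in s..s + p, O τ (h r) = 0)
    (hlip : ∀ s ∈ Icc 0 T, ∀ t ∈ Icc 0 T, ‖h t - h s‖ ≤ Lh * |t - s|)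
    (hbd : ∀ t ∈ Icc 0 T, ‖h t‖ ≤ Mh) :
    ∀ t ∈ Icc 0 T, ‖∫ τ in (0 : ℝ)..t, O τ (h τ)‖ ≤ p * (T * Lh + Mh) := by
  intro t ht
  set n := ⌊t / p⌋₊ with hn
  have hnt : (n : ℝ) * p ≤ t := by
    rw [← le_div_iff₀ hp]; exact Nat.floor_le (div_nonneg ht.1 hp.le)
  have htn : t ≤ n * p + p := by
    have := (Nat.lt_floor_add_one (t / p)).le
    rw [div_le_iff₀ hp, add_mul, one_mul] at this
    exact this
  have hn0 : (0 : ℝ) ≤ n * p := by positivity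
  have hint : ∀ a b : ℝ, IntervalIntegrable (fun τ => O τ (h τ)) volume a b :=
    fun a b => hOh.intervalIntegrable _ _
  have hsum : ∑ i ∈ Finset.range n, ∫ τ in (i * p : ℝ)..((i + 1 : ℕ) * p : ℝ), O τ (h τ)
      = ∫ τ in (0 : ℝ)..(n * p : ℝ), O τ (h τ) := by
    have := intervalIntegral.sum_integral_adjacent_intervals (μ := volume)
      (f := fun τ => O τ (h τ)) (a := fun i : ℕ => (i * p : ℝ)) (n := n) fun k _ => hint _ _
    simpa using this
  rw [← intervalIntegral.integral_add_adjacent_intervals (hint 0 (n * p)) (hint (n * p) t), ← hsum]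
  have h1 : ∀ i ∈ Finset.range n,
      ‖∫ τ in (i * p : ℝ)..((i + 1 : ℕ) * p : ℝ), O τ (h τ)‖ ≤ Lh * p * p := by
    intro i hi
    have hi' : ((i + 1 : ℕ) : ℝ) * p ≤ n * p := by
      gcongr
      exact_mod_cast Finset.mem_range.1 hi
    have e1 : ((i + 1 : ℕ) : ℝ) * p = i * p + p := by push_cast; ring
    have hip : (0 : ℝ) ≤ i * p := by positivity
    rw [e1] at hi' ⊢
    have e2 : ∫ τ in (i * p : ℝ)..(i * p + p : ℝ), O τ (h τ)
        = ∫ τ in (i * p : ℝ)..(i * p + p : ℝ), O τ (h τ - h (i * p)) := by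
      rw [← sub_zero (∫ τ in (i * p : ℝ)..(i * p + p : ℝ), O τ (h τ)), ← hper (i * p) (i * p),
        ← intervalIntegral.integral_sub (hint _ _) ((hOc _).intervalIntegrable _ _)]
      simp only [hOsub]
    rw [e2]
    refine (intervalIntegral.norm_integral_le_of_norm_le_const (C := Lh * p) fun τ hτ => ?_).trans
      (by rw [add_sub_cancel_left, abs_of_pos hp])
    rw [uIoc_of_le (by linarith)] at hτ
    refine (hO1 _ _).trans ((hlip _ ⟨hip, ?_⟩ _ ⟨?_, ?_⟩).trans ?_)
    · linarith [ht.2]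
    · linarith [hτ.1]
    · linarith [hτ.2, ht.2]
    · gcongr
      rw [abs_of_nonneg (by linarith [hτ.1])]
      linarith [hτ.2]
  have h2 : ‖∫ τ in (n * p : ℝ)..t, O τ (h τ)‖ ≤ Mh * p := by
    have hMh : 0 ≤ Mh := (norm_nonneg _).trans (hbd t ht)
    refine (intervalIntegral.norm_integral_le_of_norm_le_const (C := Mh) fun τ hτ => ?_).trans ?_
    · rw [uIoc_of_le hnt] at hτ
      exact (hO1 _ _).trans (hbd τ ⟨by linarith [hτ.1], by linarith [hτ.2, ht.2]⟩)
    · gcongr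
      rw [abs_of_nonneg (by linarith)]
      linarith
  refine (norm_add_le _ _).trans ((add_le_add ((norm_sum_le_of_le _ h1)) h2).trans ?_)
  rw [Finset.sum_const, Finset.card_range, nsmul_eq_mul]
  have : (n : ℝ) * (Lh * p * p) ≤ T * (Lh * p) := by
    calc (n : ℝ) * (Lh * p * p) = (n * p) * (Lh * p) := by ring
      _ ≤ T * (Lh * p) := by
        gcongr
        exact hnt.trans ht.2
  linarith

end Integral

/-- A strongly continuous family of contractions, applied to a continuous function. -/
lemma continuous_contraction_apply {B : Type*} [NormedAddCommGroup B] {ι : Type*}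
    [TopologicalSpace ι] {S : ι → B → B}
    (hsub : ∀ t x y, S t x - S t y = S t (x - y)) (h1 : ∀ t x, ‖S t x‖ ≤ ‖x‖)
    (hc : ∀ x, Continuous fun t => S t x) {g : ι → B} (hg : Continuous g) :
    Continuous fun t => S t (g t) := by
  rw [continuous_iff_continuousAt]
  intro t
  unfold ContinuousAt
  rw [tendsto_iff_norm_sub_tendsto_zero]
  have hb : ∀ s, ‖S s (g s) - S t (g t)‖ ≤ ‖g s - g t‖ + ‖S s (g t) - S t (g t)‖ := fun s => by
    have : S s (g s) - S t (g t) = S s (g s - g t) + (S s (g t) - S t (g t)) := by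
      rw [← hsub]; abel
    rw [this]
    exact (norm_add_le _ _).trans (add_le_add (h1 _ _) le_rfl)
  have hlim : Tendsto (fun s => ‖g s - g t‖ + ‖S s (g t) - S t (g t)‖) (𝓝 t) (𝓝 0) := by
    have e1 := tendsto_iff_norm_sub_tendsto_zero.1 (hg.tendsto t)
    have e2 := tendsto_iff_norm_sub_tendsto_zero.1 ((hc (g t)).tendsto t)
    simpa using e1.add e2
  exact squeeze_zero (fun s => norm_nonneg _) hb hlim

section Bilinear

variable {B : Type*} [NormedAddCommGroup B] [NormedSpace ℂ B] [ConjAlg B]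

lemma summable_norm_mulL {I J : Type*} {x : I → B} {y : J → B} (hx : Summable fun i => ‖x i‖)
    (hy : Summable fun j => ‖y j‖) : Summable fun p : I × J => ‖mulL (x p.1) (y p.2)‖ :=
  Summable.of_nonneg_of_le (fun _ => norm_nonneg _) (fun _ => norm_mulL_le _ _)
    (hx.mul_of_nonneg hy (fun _ => norm_nonneg _) fun _ => norm_nonneg _)

lemma hasSum_mulL [CompleteSpace B] {I J : Type*} {x : I → B} {y : J → B} {X Y : B}
    (hX : HasSum x X)
    (hY : HasSum y Y) (hx : Summable fun i => ‖x i‖) (hy : Summable fun j => ‖y j‖) :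
    HasSum (fun p : I × J => mulL (x p.1) (y p.2)) (mulL X Y) := by
  have hs := (summable_norm_mulL hx hy).of_norm
  have : ∑' p : I × J, mulL (x p.1) (y p.2) = mulL X Y := by
    rw [hs.tsum_prod]
    have h1 : ∀ i, ∑' j, mulL (x i) (y j) = mulL (x i) Y := fun i =>
      ((mulL (x i)).hasSum hY).tsum_eq
    simp_rw [h1]
    exact (((mulL (B := B)).flip Y).hasSum hX).tsum_eq
  rw [← this]
  exact hs.hasSum

end Bilinear

/-! ### Multiphase functions -/

/-- A pair of a wave vector `κ` and a frequency `ω`, which stands for the phase `κ·x - ω t/2`. -/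
abbrev Phase (d : ℕ) : Type := (Fin d → ℤ) × ℤ

/-- Absolutely summable families of amplitudes in `W ∩ L²`, indexed by phases. The family `b`
stands for the function `∑ b_(κ,ω)(x) e^{i(κ·x - ω t/2)/ε}`. -/
def PhaseAlg (d : ℕ) : Type := lp (fun _ : Phase d => WienerAlg d) 1

namespace PhaseAlg

instance : NormedAddCommGroup (PhaseAlg d) :=
  inferInstanceAs (NormedAddCommGroup (lp (fun _ : Phase d => WienerAlg d) 1))

instance : NormedSpace ℂ (PhaseAlg d) :=
  inferInstanceAs (NormedSpace ℂ (lp (fun _ : Phase d => WienerAlg d) 1))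

instance : CompleteSpace (PhaseAlg d) :=
  inferInstanceAs (CompleteSpace (lp (fun _ : Phase d => WienerAlg d) 1))

/-- The amplitude with a given phase. -/
def coord (γ : Phase d) : PhaseAlg d →L[ℂ] WienerAlg d :=
  lp.evalCLM ℂ (fun _ : Phase d => WienerAlg d) 1 γ

instance : CoeFun (PhaseAlg d) fun _ => Phase d → WienerAlg d := ⟨fun b γ => coord γ b⟩

lemma add_apply (b c : PhaseAlg d) (γ : Phase d) : (b + c) γ = b γ + c γ := map_add _ _ _
lemma sub_apply (b c : PhaseAlg d) (γ : Phase d) : (b - c) γ = b γ - c γ := map_sub _ _ _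
lemma smul_apply (a : ℂ) (b : PhaseAlg d) (γ : Phase d) : (a • b) γ = a • b γ := map_smul _ _ _

lemma ext {b c : PhaseAlg d} (h : ∀ γ, b γ = c γ) : b = c := lp.ext (funext h)

lemma summable_norm (b : PhaseAlg d) : Summable fun γ => ‖b γ‖ := by
  have := (lp.hasSum_norm (p := 1) (E := fun _ : Phase d => WienerAlg d) (by simp) b).summable
  simp only [ENNReal.toReal_one, Real.rpow_one] at this
  exact this

lemma norm_eq_tsum (b : PhaseAlg d) : ‖b‖ = ∑' γ, ‖b γ‖ := by
  have := lp.norm_eq_tsum_rpow (p := 1) (E := fun _ : Phase d => WienerAlg d) (by simp) b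
  simp only [ENNReal.toReal_one, Real.rpow_one, div_one] at this
  exact this

/-- The multiphase function given by an absolutely summable family. -/
def mk (f : Phase d → WienerAlg d) (hf : Summable fun γ => ‖f γ‖) : PhaseAlg d :=
  (⟨f, memℓp_gen (by simpa using hf)⟩ : lp (fun _ : Phase d => WienerAlg d) 1)

lemma mk_apply (f : Phase d → WienerAlg d) (hf : Summable fun γ => ‖f γ‖) (γ : Phase d) :
    mk f hf γ = f γ := rfl

lemma norm_le_mul {b b' : PhaseAlg d} {c : ℝ} (h : ∀ γ, ‖b γ‖ ≤ c * ‖b' γ‖) :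
    ‖b‖ ≤ c * ‖b'‖ := by
  rw [norm_eq_tsum, norm_eq_tsum, ← tsum_mul_left]
  exact b.summable_norm.tsum_le_tsum h (b'.summable_norm.mul_left c)

/-- The multiphase function with a single amplitude. -/
def single (γ : Phase d) : WienerAlg d →L[ℂ] PhaseAlg d :=
  lp.singleContinuousLinearMap ℂ (fun _ : Phase d => WienerAlg d) 1 γ

lemma single_apply (γ γ' : Phase d) (x : WienerAlg d) :
    single γ x γ' = if γ' = γ then x else 0 := by
  have h : single γ x γ' = (lp.single (E := fun _ : Phase d => WienerAlg d) 1 γ x) γ' := rfl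
  rw [h, lp.single_apply, Pi.single_apply]

lemma norm_single (γ : Phase d) (x : WienerAlg d) : ‖single γ x‖ = ‖x‖ := by
  rw [norm_eq_tsum, tsum_eq_single γ]
  · rw [single_apply, if_pos rfl]
  · intro γ' h
    rw [single_apply, if_neg h, norm_zero]

lemma hasSum_single (b : PhaseAlg d) : HasSum (fun γ => single γ (b γ)) b :=
  lp.hasSum_single (E := fun _ : Phase d => WienerAlg d) (p := 1) (by norm_num) b

lemma summable_mulFun (b c : PhaseAlg d) : Summable fun p : Phase d × Phase d =>
    ‖single (p.1 + p.2) (mulL (b p.1) (c p.2))‖ := by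
  simp_rw [norm_single]
  exact summable_norm_mulL (x := fun γ => b γ) (y := fun γ => c γ) b.summable_norm
    c.summable_norm

/-- The product of multiphase functions. -/
def mulFun (b c : PhaseAlg d) : PhaseAlg d :=
  ∑' p : Phase d × Phase d, single (p.1 + p.2) (mulL (b p.1) (c p.2))

lemma summable_norm_mul (b c : PhaseAlg d) :
    Summable fun p : Phase d × Phase d => ‖b p.1‖ * ‖c p.2‖ :=
  Summable.mul_of_nonneg (f := fun γ => ‖b γ‖) (g := fun γ => ‖c γ‖) b.summable_norm
    c.summable_norm (fun _ => norm_nonneg _) fun _ => norm_nonneg _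

lemma tsum_norm_mul (b c : PhaseAlg d) :
    ∑' p : Phase d × Phase d, ‖b p.1‖ * ‖c p.2‖ = ‖b‖ * ‖c‖ := by
  rw [norm_eq_tsum, norm_eq_tsum]
  exact (Summable.tsum_mul_tsum (f := fun γ => ‖b γ‖) (g := fun γ => ‖c γ‖) b.summable_norm
    c.summable_norm (summable_norm_mul b c)).symm

lemma norm_mulFun_le (b c : PhaseAlg d) : ‖mulFun b c‖ ≤ ‖b‖ * ‖c‖ := by
  rw [← tsum_norm_mul]
  refine (norm_tsum_le_tsum_norm (summable_mulFun b c)).trans ?_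
  refine (summable_mulFun b c).tsum_le_tsum (fun p => ?_) (summable_norm_mul b c)
  rw [norm_single]
  exact norm_mulL_le _ _

lemma summable_conj (b : PhaseAlg d) : Summable fun γ => ‖conjL (b (-γ))‖ := by
  simp_rw [norm_conjL]
  exact b.summable_norm.comp_injective neg_injective

/-- Complex conjugation of multiphase functions. -/
def conjFun (b : PhaseAlg d) : PhaseAlg d := mk (fun γ => conjL (b (-γ))) (summable_conj b)

lemma norm_conjFun (b : PhaseAlg d) : ‖conjFun b‖ = ‖b‖ := by
  rw [norm_eq_tsum, norm_eq_tsum, ← (Equiv.neg (Phase d)).tsum_eq]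
  simp [conjFun, mk_apply, norm_conjL]

instance : ConjAlg (PhaseAlg d) where
  mulL := LinearMap.mkContinuous₂
    (LinearMap.mk₂ ℂ mulFun
      (fun b b' c => by
        unfold mulFun
        rw [← (summable_mulFun b c).of_norm.tsum_add (summable_mulFun b' c).of_norm]
        refine tsum_congr fun p => ?_
        rw [← map_add, PhaseAlg.add_apply, map_add]; rfl)
      (fun a b c => by
        unfold mulFun
        rw [← (summable_mulFun b c).of_norm.tsum_const_smul]
        refine tsum_congr fun p => ?_
        rw [← map_smul, PhaseAlg.smul_apply, map_smul]; rfl)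
      (fun c b b' => by
        unfold mulFun
        rw [← (summable_mulFun c b).of_norm.tsum_add (summable_mulFun c b').of_norm]
        refine tsum_congr fun p => ?_
        rw [← map_add, PhaseAlg.add_apply, map_add])
      (fun a c b => by
        unfold mulFun
        rw [← (summable_mulFun c b).of_norm.tsum_const_smul]
        refine tsum_congr fun p => ?_
        rw [← map_smul, PhaseAlg.smul_apply, map_smul])) 1
    (fun x y => by simpa using norm_mulFun_le x y)
  norm_mulL_le := norm_mulFun_le
  conjL := LinearMap.mkContinuous
    { toFun := conjFun
      map_add' := fun x y => by
        refine PhaseAlg.ext fun γ => ?_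
        rw [PhaseAlg.add_apply]
        simp only [conjFun, mk_apply]
        rw [map_add, map_add]
      map_smul' := fun c x => by
        refine PhaseAlg.ext fun γ => ?_
        rw [PhaseAlg.smul_apply]
        simp only [conjFun, mk_apply]
        rw [map_smul, ContinuousLinearMap.map_smulₛₗ] } 1
    (fun x => by simpa using (norm_conjFun x).le)
  norm_conjL := norm_conjFun

lemma hasSum_mulL_single (b c : PhaseAlg d) : HasSum (fun p : Phase d × Phase d =>
    single (p.1 + p.2) (mulL (b p.1) (c p.2))) (mulL b c) :=
  (summable_mulFun b c).of_norm.hasSum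

lemma conjL_apply (b : PhaseAlg d) (γ : Phase d) : conjL b γ = conjL (b (-γ)) := rfl

lemma mulL_single (γ γ' : Phase d) (x y : WienerAlg d) :
    mulL (single γ x) (single γ' y) = single (γ + γ') (mulL x y) := by
  refine (hasSum_mulL_single _ _).unique ?_
  have h : ∀ p : Phase d × Phase d, p ≠ (γ, γ') →
      single (p.1 + p.2) (mulL (single γ x p.1) (single γ' y p.2)) = 0 := by
    intro p hp
    rw [single_apply, single_apply]
    split_ifs with h1 h2 h2
    · exact absurd (Prod.ext h1 h2) hp
    all_goals simp
  have := _root_.hasSum_single (γ, γ') h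
  simpa [single_apply] using this

end PhaseAlg

open MultiphaseNLS.WienerAlg (symb shift toLTwo ft)

/-- Uniformly bounded families of measurable symbols, indexed by phases. -/
def PhaseSymbol (m : Phase d → Space d → ℂ) : Prop :=
  (∀ γ, Measurable (m γ)) ∧ ∃ C : ℝ, ∀ γ ξ, ‖m γ ξ‖ ≤ C

namespace PhaseSymbol

lemma bdd {m : Phase d → Space d → ℂ} (hm : PhaseSymbol m) (γ : Phase d) : BddSymbol (m γ) :=
  ⟨hm.1 γ, hm.2.imp fun _ h => h γ⟩

lemma mul {m m' : Phase d → Space d → ℂ} (hm : PhaseSymbol m) (hm' : PhaseSymbol m') :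
    PhaseSymbol (fun γ ξ => m γ ξ * m' γ ξ) := by
  obtain ⟨C, hC⟩ := hm.2
  obtain ⟨C', hC'⟩ := hm'.2
  refine ⟨fun γ => (hm.1 γ).mul (hm'.1 γ), C * C', fun γ ξ => ?_⟩
  rw [norm_mul]
  exact mul_le_mul (hC γ ξ) (hC' γ ξ) (norm_nonneg _) ((norm_nonneg _).trans (hC γ ξ))

lemma sub {m m' : Phase d → Space d → ℂ} (hm : PhaseSymbol m) (hm' : PhaseSymbol m') :
    PhaseSymbol (fun γ ξ => m γ ξ - m' γ ξ) := by
  obtain ⟨C, hC⟩ := hm.2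
  obtain ⟨C', hC'⟩ := hm'.2
  exact ⟨fun γ => (hm.1 γ).sub (hm'.1 γ), C + C', fun γ ξ =>
    (norm_sub_le _ _).trans (add_le_add (hC γ ξ) (hC' γ ξ))⟩

end PhaseSymbol

namespace PhaseAlg

lemma summable_diag {m : Phase d → Space d → ℂ} (hm : PhaseSymbol m) (b : PhaseAlg d) :
    Summable fun γ => ‖symb (m γ) (b γ)‖ := by
  obtain ⟨C, hC⟩ := hm.2
  exact Summable.of_nonneg_of_le (fun _ => norm_nonneg _)
    (fun γ => WienerAlg.norm_symb_le (hm.bdd γ) (hC γ) (b γ)) (b.summable_norm.mul_left C)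

open Classical in
/-- The operator that applies to each amplitude a Fourier multiplier depending on the phase
(zero if the symbols are not uniformly bounded and measurable). -/
def diag (m : Phase d → Space d → ℂ) : PhaseAlg d →L[ℂ] PhaseAlg d :=
  if hm : PhaseSymbol m then
    LinearMap.mkContinuousOfExistsBound
      { toFun := fun b => mk (fun γ => symb (m γ) (b γ)) (summable_diag hm b)
        map_add' := fun b c => PhaseAlg.ext fun γ => by
          rw [PhaseAlg.add_apply]
          simp only [mk_apply]
          rw [map_add, map_add]
        map_smul' := fun a b => PhaseAlg.ext fun γ => by
          rw [PhaseAlg.smul_apply]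
          simp only [mk_apply]
          rw [map_smul, map_smul]; rfl }
      (by
        obtain ⟨C, hC⟩ := hm.2
        exact ⟨C, fun b => norm_le_mul fun γ => WienerAlg.norm_symb_le (hm.bdd γ) (hC γ) (b γ)⟩)
  else 0

lemma diag_apply {m : Phase d → Space d → ℂ} (hm : PhaseSymbol m) (b : PhaseAlg d) (γ : Phase d) :
    diag m b γ = symb (m γ) (b γ) := by
  rw [diag, dif_pos hm]; rfl

lemma diag_single {m : Phase d → Space d → ℂ} (hm : PhaseSymbol m) (γ : Phase d)
    (x : WienerAlg d) : diag m (single γ x) = single γ (symb (m γ) x) := by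
  refine PhaseAlg.ext fun γ' => ?_
  rw [diag_apply hm, single_apply, single_apply]
  split_ifs with h
  · rw [h]
  · exact map_zero _

lemma norm_diag_le_mul {m m' : Phase d → Space d → ℂ} (hm : PhaseSymbol m) (hm' : PhaseSymbol m')
    {c : ℝ} (hc : 0 ≤ c) (h : ∀ γ ξ, ‖m γ ξ‖ ≤ c * ‖m' γ ξ‖) (b : PhaseAlg d) :
    ‖diag m b‖ ≤ c * ‖diag m' b‖ := norm_le_mul fun γ => by
  rw [diag_apply hm, diag_apply hm']
  exact WienerAlg.norm_symb_le_mul (hm.bdd γ) (hm'.bdd γ) hc (h γ) _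

lemma norm_diag_le {m : Phase d → Space d → ℂ} (hm : PhaseSymbol m) {C : ℝ}
    (hC : ∀ γ ξ, ‖m γ ξ‖ ≤ C) (b : PhaseAlg d) : ‖diag m b‖ ≤ C * ‖b‖ := norm_le_mul fun γ => by
  rw [diag_apply hm]
  exact WienerAlg.norm_symb_le (hm.bdd γ) (hC γ) _

lemma diag_diag {m m' : Phase d → Space d → ℂ} (hm : PhaseSymbol m) (hm' : PhaseSymbol m')
    (b : PhaseAlg d) : diag m (diag m' b) = diag (fun γ ξ => m γ ξ * m' γ ξ) b :=
  PhaseAlg.ext fun γ => by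
    rw [diag_apply hm, diag_apply hm', diag_apply (hm.mul hm'),
      WienerAlg.symb_symb (hm.bdd γ) (hm'.bdd γ)]

lemma diag_comm {m m' : Phase d → Space d → ℂ} (hm : PhaseSymbol m) (hm' : PhaseSymbol m')
    (b : PhaseAlg d) : diag m (diag m' b) = diag m' (diag m b) := by
  rw [diag_diag hm hm', diag_diag hm' hm]
  simp only [mul_comm]

lemma diag_sub {m m' : Phase d → Space d → ℂ} (hm : PhaseSymbol m) (hm' : PhaseSymbol m')
    (b : PhaseAlg d) : diag m b - diag m' b = diag (fun γ ξ => m γ ξ - m' γ ξ) b :=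
  PhaseAlg.ext fun γ => by
    rw [PhaseAlg.sub_apply, diag_apply hm, diag_apply hm', diag_apply (hm.sub hm'),
      WienerAlg.symb_sub (hm.bdd γ) (hm'.bdd γ)]

lemma phaseSymbol_one : PhaseSymbol (fun (_ : Phase d) (_ : Space d) => (1 : ℂ)) :=
  ⟨fun _ => measurable_const, 1, fun _ _ => by simp⟩

lemma diag_one (b : PhaseAlg d) : diag (fun _ _ => 1) b = b := PhaseAlg.ext fun γ => by
  rw [diag_apply phaseSymbol_one, WienerAlg.symb_one]

lemma tendsto_of_dominated {ι : Type*} {l : Filter ι} {b : ι → PhaseAlg d} {b₀ c : PhaseAlg d}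
    {C : ℝ} (hb : ∀ᶠ i in l, ∀ γ, ‖b i γ - b₀ γ‖ ≤ C * ‖c γ‖)
    (h : ∀ γ, Tendsto (fun i => b i γ) l (𝓝 (b₀ γ))) : Tendsto b l (𝓝 b₀) := by
  rw [tendsto_iff_norm_sub_tendsto_zero]
  have e : ∀ i, ‖b i - b₀‖ = ∑' γ, ‖b i γ - b₀ γ‖ := fun i => by
    rw [norm_eq_tsum]; simp only [map_sub]
  simp_rw [e]
  have := tendsto_tsum_of_dominated_convergence (f := fun i γ => ‖b i γ - b₀ γ‖)
    (g := fun _ => (0 : ℝ)) (bound := fun γ => C * ‖c γ‖) (c.summable_norm.mul_left C)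
    (fun γ => tendsto_iff_norm_sub_tendsto_zero.1 (h γ))
    (by simpa using hb)
  simpa using this

lemma tendsto_diag {ι : Type*} {l : Filter ι} [l.IsCountablyGenerated]
    {m : ι → Phase d → Space d → ℂ} {m₀ : Phase d → Space d → ℂ} {C : ℝ}
    (hm : ∀ i γ, Measurable (m i γ)) (hC : ∀ i γ ξ, ‖m i γ ξ‖ ≤ C)
    (hm₀ : PhaseSymbol m₀) (h : ∀ γ, ∀ᵐ ξ, Tendsto (fun i => m i γ ξ) l (𝓝 (m₀ γ ξ)))
    (b : PhaseAlg d) : Tendsto (fun i => diag (m i) b) l (𝓝 (diag m₀ b)) := by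
  obtain ⟨C₀, hC₀⟩ := hm₀.2
  have hmi : ∀ i, PhaseSymbol (m i) := fun i => ⟨hm i, C, hC i⟩
  refine tendsto_of_dominated (C := C + C₀) (c := b) (Eventually.of_forall fun i γ => ?_)
    fun γ => ?_
  · rw [diag_apply (hmi i), diag_apply hm₀, WienerAlg.symb_sub ((hmi i).bdd γ) (hm₀.bdd γ)]
    exact WienerAlg.norm_symb_le (((hmi i).bdd γ).sub (hm₀.bdd γ))
      (fun ξ => (norm_sub_le _ _).trans (add_le_add (hC i γ ξ) (hC₀ γ ξ))) _
  · simp_rw [fun i => diag_apply (hmi i) b γ, diag_apply hm₀]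
    exact WienerAlg.tendsto_symb (Eventually.of_forall fun i => hm i γ)
      (Eventually.of_forall fun i => hC i γ) (hm₀.bdd γ) (h γ) _

/-- Weights that are subadditive up to a factor two define tame operators. -/
lemma isTame_diag {w : Phase d → Space d → ℂ} (hw : PhaseSymbol w)
    (hadd : ∀ γ γ' s t, ‖w (γ + γ') (s + t)‖ ≤ 2 * (‖w γ s‖ + ‖w γ' t‖))
    (hneg : ∀ γ s, ‖w γ (-s)‖ ≤ ‖w (-γ) s‖) : IsTame (diag w) := by
  have h2 : ∀ γ, BddSymbol (fun ξ => 2 * w γ ξ) := fun γ => (BddSymbol.const 2).mul (hw.bdd γ)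
  have hle : ∀ γ x, ‖symb (fun ξ => 2 * w γ ξ) x‖ ≤ 2 * ‖symb (w γ) x‖ := fun γ x =>
    WienerAlg.norm_symb_le_mul (h2 γ) (hw.bdd γ) zero_le_two (fun ξ => by simp) x
  constructor
  · intro b c
    have hs := (diag w).hasSum (hasSum_mulL_single b c)
    simp_rw [diag_single hw] at hs
    have hbound : ∀ p : Phase d × Phase d,
        ‖single (p.1 + p.2) (symb (w (p.1 + p.2)) (mulL (b p.1) (c p.2)))‖
          ≤ 2 * (‖diag w b p.1‖ * ‖c p.2‖ + ‖b p.1‖ * ‖diag w c p.2‖) := by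
      intro p
      rw [norm_single, diag_apply hw, diag_apply hw]
      refine (WienerAlg.norm_symb_mulL_le (hw.bdd _) (h2 p.1) (h2 p.2) (fun s t => ?_) _ _).trans ?_
      · rw [norm_mul, norm_mul, Complex.norm_ofNat, ← mul_add]
        exact hadd _ _ _ _
      · calc _ ≤ 2 * ‖symb (w p.1) (b p.1)‖ * ‖c p.2‖ + ‖b p.1‖ * (2 * ‖symb (w p.2) (c p.2)‖) := by
              gcongr <;> exact hle _ _
          _ = _ := by ring
    have hsum : HasSum (fun p : Phase d × Phase d =>
        2 * (‖diag w b p.1‖ * ‖c p.2‖ + ‖b p.1‖ * ‖diag w c p.2‖))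
        (2 * (‖diag w b‖ * ‖c‖ + ‖b‖ * ‖diag w c‖)) := by
      rw [← tsum_norm_mul, ← tsum_norm_mul]
      exact ((summable_norm_mul _ _).hasSum.add (summable_norm_mul _ _).hasSum).mul_left 2
    exact hs.norm_le_of_bounded hsum hbound
  · intro b
    have e : ‖diag w b‖ = ∑' γ, ‖symb (w (-γ)) (b (-γ))‖ := by
      rw [norm_eq_tsum, ← (Equiv.neg (Phase d)).tsum_eq]
      simp only [Equiv.neg_apply, diag_apply hw]
    rw [e, norm_eq_tsum]
    have hs : Summable fun γ => ‖symb (w (-γ)) (b (-γ))‖ :=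
      (summable_diag hw b).comp_injective neg_injective
    refine (summable_norm _).tsum_le_tsum (fun γ => ?_) hs
    rw [diag_apply hw, conjL_apply]
    exact WienerAlg.norm_symb_conjL_le (hw.bdd γ) (hw.bdd (-γ)) (hneg γ) _

/-! ### Evaluation of multiphase functions -/

/-- The time-dependent factor `e^{-iωt/(2ε)}` of a phase. -/
def timeFactor (ε t : ℝ) (γ : Phase d) : ℂ :=
  Complex.exp (((-(γ.2 * t / (2 * ε)) : ℝ) : ℂ) * Complex.I)

lemma norm_timeFactor (ε t : ℝ) (γ : Phase d) : ‖timeFactor ε t γ‖ = 1 :=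
  Complex.norm_exp_ofReal_mul_I _

lemma timeFactor_add (ε t : ℝ) (γ γ' : Phase d) :
    timeFactor ε t (γ + γ') = timeFactor ε t γ * timeFactor ε t γ' := by
  rw [timeFactor, timeFactor, timeFactor, ← Complex.exp_add]
  congr 1
  push_cast [Prod.snd_add]
  ring

lemma timeFactor_neg (ε t : ℝ) (γ : Phase d) :
    timeFactor ε t (-γ) = conj (timeFactor ε t γ) := by
  rw [timeFactor, timeFactor, ← Complex.exp_conj]
  congr 1
  simp only [map_mul, Complex.conj_ofReal, Complex.conj_I, Prod.snd_neg]
  push_cast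
  ring

/-- The frequency `κ/(2πε)` of the plane wave `e^{iκ·x/ε}`. -/
def freq (ε : ℝ) (κ : Fin d → ℤ) : Space d := WithLp.toLp 2 fun m => (κ m : ℝ) / (2 * Real.pi * ε)

lemma freq_add (ε : ℝ) (κ κ' : Fin d → ℤ) : freq ε (κ + κ') = freq ε κ + freq ε κ' := by
  ext m
  simp [freq, add_div]

lemma freq_neg (ε : ℝ) (κ : Fin d → ℤ) : freq ε (-κ) = -freq ε κ := by
  ext m
  simp [freq, neg_div]

/-- The plane wave modulation `x ↦ e^{i(κ·x - ω t/2)/ε} x`. -/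
def wave (ε t : ℝ) (γ : Phase d) (x : WienerAlg d) : WienerAlg d :=
  timeFactor ε t γ • shift (freq ε γ.1) x

lemma norm_wave (ε t : ℝ) (γ : Phase d) (x : WienerAlg d) : ‖wave ε t γ x‖ = ‖x‖ := by
  rw [wave, norm_smul, norm_timeFactor, one_mul, WienerAlg.norm_shift]

lemma wave_add (ε t : ℝ) (γ : Phase d) (x y : WienerAlg d) :
    wave ε t γ (x + y) = wave ε t γ x + wave ε t γ y := by
  rw [wave, map_add, smul_add]; rfl

lemma wave_smul (ε t : ℝ) (γ : Phase d) (c : ℂ) (x : WienerAlg d) :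
    wave ε t γ (c • x) = c • wave ε t γ x := by
  rw [wave, map_smul, smul_comm]; rfl

lemma summable_wave (ε t : ℝ) (b : PhaseAlg d) : Summable fun γ => ‖wave ε t γ (b γ)‖ := by
  simp_rw [norm_wave]; exact b.summable_norm

/-- The function `∑ b_(κ,ω)(x) e^{i(κ·x - ω t/2)/ε}` that a multiphase function stands for. -/
def ev (ε t : ℝ) : PhaseAlg d →L[ℂ] WienerAlg d :=
  LinearMap.mkContinuous
    { toFun := fun b => ∑' γ, wave ε t γ (b γ)
      map_add' := fun b c => by
        rw [← (summable_wave ε t b).of_norm.tsum_add (summable_wave ε t c).of_norm]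
        refine tsum_congr fun γ => ?_
        simp only [map_add, wave_add]
      map_smul' := fun a b => by
        rw [RingHom.id_apply, ← (summable_wave ε t b).of_norm.tsum_const_smul]
        refine tsum_congr fun γ => ?_
        simp only [map_smul, wave_smul] } 1
    (fun b => by
      rw [one_mul, norm_eq_tsum]
      refine (norm_tsum_le_tsum_norm (summable_wave ε t b)).trans (le_of_eq ?_)
      simp_rw [norm_wave])

lemma hasSum_ev (ε t : ℝ) (b : PhaseAlg d) : HasSum (fun γ => wave ε t γ (b γ)) (ev ε t b) :=
  (summable_wave ε t b).of_norm.hasSum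

lemma norm_ev_le (ε t : ℝ) (b : PhaseAlg d) : ‖ev ε t b‖ ≤ ‖b‖ := by
  rw [norm_eq_tsum]
  refine (norm_tsum_le_tsum_norm (summable_wave ε t b)).trans (le_of_eq ?_)
  simp_rw [norm_wave]

lemma ev_single (ε t : ℝ) (γ : Phase d) (x : WienerAlg d) :
    ev ε t (single γ x) = wave ε t γ x := by
  refine (hasSum_ev ε t _).unique ?_
  have := _root_.hasSum_single (f := fun γ' => wave ε t γ' (single γ x γ')) γ fun γ' h => by
    rw [single_apply, if_neg h, wave, map_zero, smul_zero]
  simpa [single_apply] using this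

lemma wave_mulL (ε t : ℝ) (γ γ' : Phase d) (x y : WienerAlg d) :
    wave ε t (γ + γ') (mulL x y) = mulL (wave ε t γ x) (wave ε t γ' y) := by
  simp only [wave, map_smul, _root_.smul_apply]
  rw [WienerAlg.mulL_shift, timeFactor_add, Prod.fst_add, freq_add, mul_smul, smul_comm]

lemma wave_conjL (ε t : ℝ) (γ : Phase d) (x : WienerAlg d) :
    conjL (wave ε t γ x) = wave ε t (-γ) (conjL x) := by
  rw [wave, wave, ContinuousLinearMap.map_smulₛₗ, WienerAlg.conjL_shift, timeFactor_neg,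
    Prod.fst_neg, freq_neg]

/-- Evaluation is multiplicative. -/
lemma ev_mulL (ε t : ℝ) (b c : PhaseAlg d) :
    ev ε t (mulL b c) = mulL (ev ε t b) (ev ε t c) := by
  have h1 := (ev ε t).hasSum (hasSum_mulL_single b c)
  have h2 := hasSum_mulL (hasSum_ev ε t b) (hasSum_ev ε t c) (summable_wave ε t b)
    (summable_wave ε t c)
  refine h1.unique ?_
  simp_rw [ev_single, wave_mulL]
  exact h2

lemma ev_conjL (ε t : ℝ) (b : PhaseAlg d) : ev ε t (conjL b) = conjL (ev ε t b) := by
  have h1 : HasSum (fun γ => conjL (wave ε t γ (b γ))) (conjL (ev ε t b)) :=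
    (hasSum_ev ε t b).mapL (conjL (B := WienerAlg d))
  refine (hasSum_ev ε t (conjL b)).unique ?_
  rw [← (Equiv.neg (Phase d)).hasSum_iff]
  convert! h1 using 2 with γ
  simp only [Function.comp_apply, Equiv.neg_apply, conjL_apply, neg_neg, wave_conjL]

lemma symb_wave {m : Space d → ℂ} (hm : BddSymbol m) (ε t : ℝ) (γ : Phase d) (x : WienerAlg d) :
    symb m (wave ε t γ x) = wave ε t γ (symb (fun ξ => m (ξ + freq ε γ.1)) x) := by
  rw [wave, wave, map_smul, WienerAlg.symb_shift hm]

lemma phaseSymbol_translate {m : Space d → ℂ} (hm : BddSymbol m) (ε : ℝ) :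
    PhaseSymbol (fun (γ : Phase d) ξ => m (ξ + freq ε γ.1)) :=
  ⟨fun _ => (hm.comp_add _).1, hm.2.imp fun _ h _ _ => h _⟩

/-- A Fourier multiplier acts on a modulated amplitude through its symbol, translated by the
frequency of the plane wave. -/
lemma symb_ev {m : Space d → ℂ} (hm : BddSymbol m) (ε t : ℝ) (b : PhaseAlg d) :
    symb m (ev ε t b) = ev ε t (diag (fun γ ξ => m (ξ + freq ε γ.1)) b) := by
  refine ((symb m).hasSum (hasSum_ev ε t b)).unique ?_
  simp_rw [symb_wave hm]
  have := hasSum_ev ε t (diag (fun γ ξ => m (ξ + freq ε γ.1)) b)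
  simpa only [diag_apply (phaseSymbol_translate hm ε)] using this

lemma phaseSymbol_timeFactor (ε t : ℝ) :
    PhaseSymbol (fun (γ : Phase d) (_ : Space d) => timeFactor ε t γ) :=
  ⟨fun _ => measurable_const, 1, fun γ _ => (norm_timeFactor ε t γ).le⟩

lemma ev_eq_ev_zero (ε t : ℝ) (b : PhaseAlg d) :
    ev ε t b = ev ε 0 (diag (fun γ _ => timeFactor ε t γ) b) := by
  refine (hasSum_ev ε t b).unique ?_
  have := hasSum_ev ε 0 (diag (fun γ _ => timeFactor ε t γ) b)
  convert! this using 2 with γ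
  rw [diag_apply (phaseSymbol_timeFactor ε t), WienerAlg.symb_const, wave_smul, wave, wave,
    show timeFactor ε 0 γ = 1 by simp [timeFactor], one_smul]

end PhaseAlg

open MultiphaseNLS.PhaseAlg (diag ev single timeFactor freq coord)

/-! ### Propagators, weights and frozen multipliers -/

/-- The symbol of `exp(i ε (t/2) Δ_η)`. -/
def schroSymbol (η : Fin d → ℤ) (ε t : ℝ) (ξ : Space d) : ℂ := Complex.exp
  (-(Complex.I * ((ε * t / 2 * ∑ m, (η m : ℝ) * (2 * Real.pi * ξ m) ^ 2 : ℝ) : ℂ)))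

/-- The symbol of `exp(-t ∑ η_m k_m ∂_m)`. -/
def transSymbol (η k : Fin d → ℤ) (t : ℝ) (ξ : Space d) : ℂ := Complex.exp
  (-(Complex.I * ((t * ∑ m, (η m : ℝ) * (k m : ℝ) * (2 * Real.pi * ξ m) : ℝ) : ℂ)))

/-- The oscillating factor `e^{i t (q(κ) - ω)/(2ε)}` with `q(κ) = ∑ η_m κ_m²`. It is constant
exactly for the phases that satisfy the eikonal equation. -/
def oscFactor (η : Fin d → ℤ) (ε t : ℝ) (γ : Phase d) : ℂ := Complex.exp
  (Complex.I * ((t * ((quadForm η γ.1 - γ.2 : ℤ) : ℝ) / (2 * ε) : ℝ) : ℂ))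

lemma norm_exp_I_mul (r : ℝ) : ‖Complex.exp (Complex.I * (r : ℂ))‖ = 1 := by
  rw [mul_comm]; exact Complex.norm_exp_ofReal_mul_I r

lemma norm_exp_neg_I_mul (r : ℝ) : ‖Complex.exp (-(Complex.I * (r : ℂ)))‖ = 1 := by
  rw [← mul_neg, ← Complex.ofReal_neg]; exact norm_exp_I_mul _

lemma norm_schroSymbol (η : Fin d → ℤ) (ε t : ℝ) (ξ : Space d) : ‖schroSymbol η ε t ξ‖ = 1 :=
  norm_exp_neg_I_mul _

lemma norm_transSymbol (η k : Fin d → ℤ) (t : ℝ) (ξ : Space d) : ‖transSymbol η k t ξ‖ = 1 :=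
  norm_exp_neg_I_mul _

lemma norm_oscFactor (η : Fin d → ℤ) (ε t : ℝ) (γ : Phase d) : ‖oscFactor η ε t γ‖ = 1 :=
  norm_exp_I_mul _

lemma measurable_schroSymbol (η : Fin d → ℤ) (ε t : ℝ) : Measurable (schroSymbol η ε t) := by
  unfold schroSymbol
  refine Continuous.measurable ?_
  fun_prop

lemma measurable_transSymbol (η k : Fin d → ℤ) (t : ℝ) : Measurable (transSymbol η k t) := by
  unfold transSymbol
  refine Continuous.measurable ?_
  fun_prop

lemma bddSymbol_schro (η : Fin d → ℤ) (ε t : ℝ) : BddSymbol (schroSymbol η ε t) :=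
  ⟨measurable_schroSymbol η ε t, 1, fun _ => (norm_schroSymbol ..).le⟩

lemma phaseSymbol_schro (η : Fin d → ℤ) (ε t : ℝ) :
    PhaseSymbol (fun (_ : Phase d) => schroSymbol η ε t) :=
  ⟨fun _ => measurable_schroSymbol η ε t, 1, fun _ _ => (norm_schroSymbol ..).le⟩

lemma phaseSymbol_trans (η : Fin d → ℤ) (t : ℝ) :
    PhaseSymbol (fun (γ : Phase d) => transSymbol η γ.1 t) :=
  ⟨fun _ => measurable_transSymbol η _ t, 1, fun _ _ => (norm_transSymbol ..).le⟩

lemma phaseSymbol_osc (η : Fin d → ℤ) (ε t : ℝ) :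
    PhaseSymbol (fun (γ : Phase d) (_ : Space d) => oscFactor η ε t γ) :=
  ⟨fun _ => measurable_const, 1, fun _ _ => (norm_oscFactor ..).le⟩

lemma schroSymbol_add (η : Fin d → ℤ) (ε s t : ℝ) (ξ : Space d) :
    schroSymbol η ε (s + t) ξ = schroSymbol η ε s ξ * schroSymbol η ε t ξ := by
  rw [schroSymbol, schroSymbol, schroSymbol, ← Complex.exp_add]
  congr 1
  push_cast
  ring

lemma transSymbol_add (η k : Fin d → ℤ) (s t : ℝ) (ξ : Space d) :
    transSymbol η k (s + t) ξ = transSymbol η k s ξ * transSymbol η k t ξ := by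
  rw [transSymbol, transSymbol, transSymbol, ← Complex.exp_add]
  congr 1
  push_cast
  ring

lemma schroSymbol_zero (η : Fin d → ℤ) (ε : ℝ) (ξ : Space d) : schroSymbol η ε 0 ξ = 1 := by
  simp [schroSymbol]

lemma transSymbol_zero (η k : Fin d → ℤ) (ξ : Space d) : transSymbol η k 0 ξ = 1 := by
  simp [transSymbol]

/-- The free Schrödinger propagator on `W ∩ L²`. -/
def schro (η : Fin d → ℤ) (ε t : ℝ) : WienerAlg d →L[ℂ] WienerAlg d := symb (schroSymbol η ε t)

/-- The free transport propagator on multiphase functions: the amplitude with phase `(κ, ω)` is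
transported with the group velocity `(η_m κ_m)_m`. -/
def trans (η : Fin d → ℤ) (t : ℝ) : PhaseAlg d →L[ℂ] PhaseAlg d :=
  diag (fun γ => transSymbol η γ.1 t)

/-- The free Schrödinger propagator, applied to each amplitude. -/
def schroPhase (η : Fin d → ℤ) (ε t : ℝ) : PhaseAlg d →L[ℂ] PhaseAlg d :=
  diag (fun _ => schroSymbol η ε t)

/-- Multiplication of each amplitude with its oscillating factor. -/
def osc (η : Fin d → ℤ) (ε t : ℝ) : PhaseAlg d →L[ℂ] PhaseAlg d :=
  diag (fun γ _ => oscFactor η ε t γ)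

lemma norm_schro_le (η : Fin d → ℤ) (ε t : ℝ) (x : WienerAlg d) : ‖schro η ε t x‖ ≤ ‖x‖ := by
  simpa [schro] using WienerAlg.norm_symb_le (bddSymbol_schro η ε t)
    (fun ξ => (norm_schroSymbol ..).le) x

lemma norm_trans_le (η : Fin d → ℤ) (t : ℝ) (b : PhaseAlg d) : ‖trans η t b‖ ≤ ‖b‖ := by
  simpa [trans] using PhaseAlg.norm_diag_le (phaseSymbol_trans η t)
    (fun γ ξ => (norm_transSymbol ..).le) b

lemma norm_osc_le (η : Fin d → ℤ) (ε t : ℝ) (b : PhaseAlg d) : ‖osc η ε t b‖ ≤ ‖b‖ := by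
  simpa [osc] using PhaseAlg.norm_diag_le (phaseSymbol_osc η ε t)
    (fun γ ξ => (norm_oscFactor ..).le) b

lemma schro_schro (η : Fin d → ℤ) (ε s t : ℝ) (x : WienerAlg d) :
    schro η ε s (schro η ε t x) = schro η ε (s + t) x := by
  rw [schro, schro, schro, WienerAlg.symb_symb (bddSymbol_schro ..) (bddSymbol_schro ..)]
  simp only [← schroSymbol_add]

lemma trans_trans (η : Fin d → ℤ) (s t : ℝ) (b : PhaseAlg d) :
    trans η s (trans η t b) = trans η (s + t) b := by
  rw [trans, trans, trans, PhaseAlg.diag_diag (phaseSymbol_trans ..) (phaseSymbol_trans ..)]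
  simp only [← transSymbol_add]

lemma schro_zero (η : Fin d → ℤ) (ε : ℝ) (x : WienerAlg d) : schro η ε 0 x = x := by
  rw [schro, show schroSymbol η ε 0 = fun _ => 1 from funext (schroSymbol_zero η ε),
    WienerAlg.symb_one]

lemma trans_zero (η : Fin d → ℤ) (b : PhaseAlg d) : trans η 0 b = b := by
  rw [trans, show (fun γ : Phase d => transSymbol η γ.1 0) = fun _ _ => 1 from
    funext fun γ => funext (transSymbol_zero η γ.1), PhaseAlg.diag_one]

lemma continuous_schro (η : Fin d → ℤ) (ε : ℝ) (x : WienerAlg d) :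
    Continuous fun t => schro η ε t x := by
  rw [continuous_iff_continuousAt]
  intro t
  refine WienerAlg.tendsto_symb (C := 1)
    (Eventually.of_forall fun t => measurable_schroSymbol η ε t)
    (Eventually.of_forall fun t ξ => (norm_schroSymbol ..).le) (bddSymbol_schro ..)
    (Eventually.of_forall fun ξ => ?_) x
  have : Continuous fun t => schroSymbol η ε t ξ := by unfold schroSymbol; fun_prop
  exact this.tendsto t

lemma continuous_trans (η : Fin d → ℤ) (b : PhaseAlg d) : Continuous fun t => trans η t b := by
  rw [continuous_iff_continuousAt]
  intro t
  refine PhaseAlg.tendsto_diag (C := 1) (fun t γ => measurable_transSymbol η γ.1 t)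
    (fun t γ ξ => (norm_transSymbol ..).le) (phaseSymbol_trans ..)
    (fun γ => Eventually.of_forall fun ξ => ?_) b
  have : Continuous fun t => transSymbol η γ.1 t ξ := by unfold transSymbol; fun_prop
  exact this.tendsto t

lemma continuous_osc (η : Fin d → ℤ) (ε : ℝ) (b : PhaseAlg d) :
    Continuous fun t => osc η ε t b := by
  rw [continuous_iff_continuousAt]
  intro t
  refine PhaseAlg.tendsto_diag (C := 1) (fun t γ => measurable_const)
    (fun t γ ξ => (norm_oscFactor ..).le) (phaseSymbol_osc ..)
    (fun γ => Eventually.of_forall fun ξ => ?_) b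
  have : Continuous fun t => oscFactor η ε t γ := by unfold oscFactor; fun_prop
  exact this.tendsto t

/-- Expansion of the Schrödinger symbol at the shifted frequency `ξ + κ/(2πε)`: the square of the
shift combines with the time factor of the phase to the oscillating factor, and the mixed term is the
transport. -/
lemma schroSymbol_freq (η : Fin d → ℤ) {ε : ℝ} (hε : ε ≠ 0) (t : ℝ) (γ : Phase d) (ξ : Space d) :
    timeFactor ε t γ * schroSymbol η ε (-t) (ξ + freq ε γ.1)
      = oscFactor η ε t γ * (transSymbol η γ.1 (-t) ξ * schroSymbol η ε (-t) ξ) := by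
  rw [timeFactor, oscFactor, transSymbol, schroSymbol, schroSymbol, ← Complex.exp_add,
    ← Complex.exp_add, ← Complex.exp_add]
  congr 1
  have key : ∑ m, (η m : ℝ) * (2 * Real.pi * (ξ + freq ε γ.1) m) ^ 2
      = ∑ m, (η m : ℝ) * (2 * Real.pi * ξ m) ^ 2
        + 2 / ε * ∑ m, (η m : ℝ) * (γ.1 m : ℝ) * (2 * Real.pi * ξ m)
        + 1 / ε ^ 2 * ((quadForm η γ.1 : ℤ) : ℝ) := by
    rw [quadForm, Finset.mul_sum]
    push_cast
    rw [Finset.mul_sum, ← Finset.sum_add_distrib, ← Finset.sum_add_distrib]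
    refine Finset.sum_congr rfl fun m _ => ?_
    have hpi := Real.pi_ne_zero
    simp only [freq, PiLp.add_apply]
    field_simp
    ring
  rw [key]
  have hε' : (ε : ℂ) ≠ 0 := by exact_mod_cast hε
  generalize ∑ m, (η m : ℝ) * (2 * Real.pi * ξ m) ^ 2 = A
  generalize ∑ m, (η m : ℝ) * (γ.1 m : ℝ) * (2 * Real.pi * ξ m) = B
  generalize quadForm η γ.1 = q
  push_cast
  field_simp
  ring

/-- The Schrödinger flow on multiphase functions: in the interaction picture, it factors into a
fast oscillation of the nonresonant amplitudes, the transport, and a slow dispersion. -/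
lemma schro_neg_ev (η : Fin d → ℤ) {ε : ℝ} (hε : ε ≠ 0) (t : ℝ) (b : PhaseAlg d) :
    schro η ε (-t) (ev ε t b)
      = ev ε 0 (osc η ε t (trans η (-t) (schroPhase η ε (-t) b))) := by
  rw [schro, PhaseAlg.symb_ev (bddSymbol_schro ..), PhaseAlg.ev_eq_ev_zero,
    PhaseAlg.diag_diag (PhaseAlg.phaseSymbol_timeFactor ..)
      (PhaseAlg.phaseSymbol_translate (bddSymbol_schro ..) ε), trans, schroPhase, osc,
    PhaseAlg.diag_diag (phaseSymbol_trans ..) (phaseSymbol_schro ..),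
    PhaseAlg.diag_diag (phaseSymbol_osc ..) ((phaseSymbol_trans ..).mul (phaseSymbol_schro ..))]
  simp only [schroSymbol_freq η hε]

/-- The weight `1 + |κ|² + |2πξ|²`. -/
def bracket (γ : Phase d) (ξ : Space d) : ℝ :=
  1 + ∑ m, (γ.1 m : ℝ) ^ 2 + ∑ m, (2 * Real.pi * ξ m) ^ 2

lemma one_le_bracket (γ : Phase d) (ξ : Space d) : 1 ≤ bracket γ ξ := by
  have h1 : 0 ≤ ∑ m, (γ.1 m : ℝ) ^ 2 := Finset.sum_nonneg fun _ _ => sq_nonneg _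
  have h2 : 0 ≤ ∑ m, (2 * Real.pi * ξ m) ^ 2 := Finset.sum_nonneg fun _ _ => sq_nonneg _
  unfold bracket
  linarith

lemma sum_add_sq_le {ι : Type*} (s : Finset ι) (f g : ι → ℝ) :
    ∑ m ∈ s, (f m + g m) ^ 2 ≤ 2 * (∑ m ∈ s, f m ^ 2 + ∑ m ∈ s, g m ^ 2) := by
  rw [← Finset.sum_add_distrib, Finset.mul_sum]
  exact Finset.sum_le_sum fun m _ => by nlinarith [sq_nonneg (f m - g m)]

lemma bracket_add_le (γ γ' : Phase d) (s t : Space d) :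
    bracket (γ + γ') (s + t) ≤ 2 * (bracket γ s + bracket γ' t) := by
  have h1 := sum_add_sq_le Finset.univ (fun m => (γ.1 m : ℝ)) fun m => (γ'.1 m : ℝ)
  have h2 := sum_add_sq_le Finset.univ (fun m => 2 * Real.pi * s m) fun m => 2 * Real.pi * t m
  simp only [bracket, Prod.fst_add, Pi.add_apply, PiLp.add_apply, Int.cast_add, mul_add]
  linarith

/-- The weight `1 + |κ|² + |2πξ|²`, truncated at the height `M`. -/
def weight (M : ℝ) (γ : Phase d) (ξ : Space d) : ℂ := ((min (bracket γ ξ) M : ℝ) : ℂ)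

lemma norm_weight {M : ℝ} (hM : 0 ≤ M) (γ : Phase d) (ξ : Space d) :
    ‖weight M γ ξ‖ = min (bracket γ ξ) M := by
  rw [weight, Complex.norm_real, Real.norm_eq_abs, abs_of_nonneg]
  exact le_min (zero_le_one.trans (one_le_bracket γ ξ)) hM

lemma phaseSymbol_weight {M : ℝ} (hM : 0 ≤ M) : PhaseSymbol (weight M : Phase d → Space d → ℂ) := by
  refine ⟨fun γ => Continuous.measurable ?_, M, fun γ ξ => ?_⟩
  · unfold weight bracket; fun_prop
  · rw [norm_weight hM]; exact min_le_right _ _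

lemma isTame_weight {M : ℝ} (hM : 0 ≤ M) : IsTame (diag (weight M : Phase d → Space d → ℂ)) := by
  refine PhaseAlg.isTame_diag (phaseSymbol_weight hM) (fun γ γ' s t => ?_) fun γ s => ?_
  · simp only [norm_weight hM]
    have h := bracket_add_le γ γ' s t
    have h1 := one_le_bracket γ s
    have h2 := one_le_bracket γ' t
    rcases le_total (bracket γ s) M with h3 | h3 <;> rcases le_total (bracket γ' t) M with h4 | h4
    · rw [min_eq_left h3, min_eq_left h4]; exact (min_le_left _ _).trans h
    · rw [min_eq_left h3, min_eq_right h4]; exact (min_le_right _ _).trans (by linarith)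
    · rw [min_eq_right h3, min_eq_left h4]; exact (min_le_right _ _).trans (by linarith)
    · rw [min_eq_right h3, min_eq_right h4]; exact (min_le_right _ _).trans (by linarith)
  · simp [norm_weight hM, bracket]

/-- `b` is bounded by `Y` in the norm with weight `1 + |κ|² + |2πξ|²`, expressed through the
truncated weights, for which the norm is finite from the outset. -/
def WeightBound (Y : ℝ) (b : PhaseAlg d) : Prop := ∀ M : ℝ, 0 ≤ M → ‖diag (weight M) b‖ ≤ Y

/-- A multiplier of size at most `c (1 + |κ|² + |2πξ|²)` is of size `c` on families with bounded
weighted norm. -/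
lemma WeightBound.norm_diag_le {Y : ℝ} {b : PhaseAlg d} (hb : WeightBound Y b)
    {m : Phase d → Space d → ℂ} (hm : PhaseSymbol m) {c : ℝ} (hc : 0 < c)
    (h2 : ∀ γ ξ, ‖m γ ξ‖ ≤ 2) (h : ∀ γ ξ, ‖m γ ξ‖ ≤ c * bracket γ ξ) : ‖diag m b‖ ≤ c * Y := by
  have hM : 0 ≤ 2 / c := by positivity
  refine (PhaseAlg.norm_diag_le_mul hm (phaseSymbol_weight hM) hc.le (fun γ ξ => ?_) b).trans
    (mul_le_mul_of_nonneg_left (hb _ hM) hc.le)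
  rw [norm_weight hM, mul_min_of_nonneg _ _ hc.le, mul_div_cancel₀ _ hc.ne']
  exact le_min (h γ ξ) (h2 γ ξ)

lemma WeightBound.nonneg {Y : ℝ} {b : PhaseAlg d} (hb : WeightBound Y b) : 0 ≤ Y :=
  (norm_nonneg _).trans (hb 0 le_rfl)

lemma WeightBound.norm_le {Y : ℝ} {b : PhaseAlg d} (hb : WeightBound Y b) : ‖b‖ ≤ Y := by
  have := PhaseAlg.norm_diag_le_mul (m := fun _ _ => 1) (m' := weight 1) PhaseAlg.phaseSymbol_one
    (phaseSymbol_weight zero_le_one) zero_le_one (fun γ ξ => by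
      rw [norm_weight zero_le_one, min_eq_right (one_le_bracket γ ξ)]; simp) b
  rw [PhaseAlg.diag_one, one_mul] at this
  exact this.trans (hb 1 zero_le_one)

lemma WeightBound.diag {Y : ℝ} {b : PhaseAlg d} (hb : WeightBound Y b)
    {m : Phase d → Space d → ℂ} (hm : PhaseSymbol m) (h1 : ∀ γ ξ, ‖m γ ξ‖ ≤ 1) :
    WeightBound Y (diag m b) := fun M hM => by
  rw [PhaseAlg.diag_comm (phaseSymbol_weight hM) hm]
  refine (PhaseAlg.norm_diag_le hm h1 _).trans ?_
  rw [one_mul]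
  exact hb M hM

lemma norm_exp_sub_exp_le (r s : ℝ) :
    ‖Complex.exp (-(Complex.I * (r : ℂ))) - Complex.exp (-(Complex.I * (s : ℂ)))‖ ≤ |r - s| := by
  have e : Complex.exp (-(Complex.I * (r : ℂ))) - Complex.exp (-(Complex.I * (s : ℂ)))
      = Complex.exp (-(Complex.I * (s : ℂ))) * (Complex.exp (Complex.I * ((s - r : ℝ) : ℂ)) - 1) := by
    rw [mul_sub, ← Complex.exp_add, mul_one]
    congr 2
    push_cast; ring
  rw [e, norm_mul, norm_exp_neg_I_mul, one_mul, abs_sub_comm]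
  simpa using Real.norm_exp_I_mul_ofReal_sub_one_le (x := s - r)

lemma abs_sum_eta_le {η : Fin d → ℤ} (hη : ∀ m, η m = 1 ∨ η m = -1) (f : Fin d → ℝ) :
    |∑ m, (η m : ℝ) * f m| ≤ ∑ m, |f m| := by
  refine (Finset.abs_sum_le_sum_abs _ _).trans (Finset.sum_le_sum fun m _ => ?_)
  rcases hη m with h | h <;> simp [h]

/-- The dispersion is of size `ε` on regular amplitudes. -/
lemma norm_schroPhase_sub_le {η : Fin d → ℤ} (hη : ∀ m, η m = 1 ∨ η m = -1) {ε t T Y : ℝ}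
    (hε : 0 < ε) (hT : 0 < T) (ht : |t| ≤ T) {b : PhaseAlg d} (hb : WeightBound Y b) :
    ‖schroPhase η ε t b - b‖ ≤ ε * T * Y := by
  have e : schroPhase η ε t b - b
      = diag (fun (_ : Phase d) ξ => schroSymbol η ε t ξ - 1) b := by
    conv_lhs => rw [← PhaseAlg.diag_one b, schroPhase, PhaseAlg.diag_one]
    nth_rewrite 2 [← PhaseAlg.diag_one b]
    exact PhaseAlg.diag_sub (phaseSymbol_schro ..) PhaseAlg.phaseSymbol_one b
  rw [e]
  refine hb.norm_diag_le ((phaseSymbol_schro ..).sub PhaseAlg.phaseSymbol_one) (mul_pos hε hT)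
    (fun γ ξ => ?_) fun γ ξ => ?_
  · refine (norm_sub_le _ _).trans ?_
    rw [norm_schroSymbol, norm_one]; norm_num
  · have h := norm_exp_sub_exp_le (ε * t / 2 * ∑ m, (η m : ℝ) * (2 * Real.pi * ξ m) ^ 2) 0
    rw [Complex.ofReal_zero, mul_zero, neg_zero, Complex.exp_zero, sub_zero] at h
    refine h.trans ?_
    have h1 := abs_sum_eta_le hη fun m => (2 * Real.pi * ξ m) ^ 2
    simp only [abs_pow, sq_abs] at h1
    have h2 : ∑ m, (2 * Real.pi * ξ m) ^ 2 ≤ bracket γ ξ := by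
      have : 0 ≤ ∑ m, (γ.1 m : ℝ) ^ 2 := Finset.sum_nonneg fun _ _ => sq_nonneg _
      unfold bracket; linarith
    have h3 : |ε * t / 2| ≤ ε * T := by
      rw [abs_div, abs_mul, abs_of_pos hε, abs_two]
      have : ε * |t| ≤ ε * T := by gcongr
      have : 0 ≤ ε * |t| := by positivity
      linarith
    rw [abs_mul]
    exact mul_le_mul h3 (h1.trans h2) (abs_nonneg _) (by positivity)

/-- The transport is Lipschitz in time on regular amplitudes. -/
lemma norm_trans_sub_le {η : Fin d → ℤ} (hη : ∀ m, η m = 1 ∨ η m = -1) {Y : ℝ} (s t : ℝ)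
    {b : PhaseAlg d} (hb : WeightBound Y b) : ‖trans η t b - trans η s b‖ ≤ |t - s| * Y := by
  rcases eq_or_ne t s with rfl | hts
  · simp
  rw [trans, trans, PhaseAlg.diag_sub (phaseSymbol_trans ..) (phaseSymbol_trans ..)]
  refine hb.norm_diag_le ((phaseSymbol_trans ..).sub (phaseSymbol_trans ..))
    (abs_pos.2 (sub_ne_zero.2 hts)) (fun γ ξ => ?_) fun γ ξ => ?_
  · refine (norm_sub_le _ _).trans ?_
    rw [norm_transSymbol, norm_transSymbol]; norm_num
  · refine (norm_exp_sub_exp_le _ _).trans ?_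
    rw [← sub_mul, abs_mul]
    gcongr
    simp only [mul_assoc (_ : ℝ) _ (2 * Real.pi * _)]
    refine (abs_sum_eta_le hη fun m => (γ.1 m : ℝ) * (2 * Real.pi * ξ m)).trans ?_
    have h1 : ∑ m, |(γ.1 m : ℝ) * (2 * Real.pi * ξ m)|
        ≤ ∑ m, ((γ.1 m : ℝ) ^ 2 + (2 * Real.pi * ξ m) ^ 2) := by
      refine Finset.sum_le_sum fun m _ => abs_le.2 ⟨?_, ?_⟩
      · nlinarith [sq_nonneg ((γ.1 m : ℝ) + 2 * Real.pi * ξ m), sq_nonneg (γ.1 m : ℝ),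
          sq_nonneg (2 * Real.pi * ξ m)]
      · nlinarith [sq_nonneg ((γ.1 m : ℝ) - 2 * Real.pi * ξ m), sq_nonneg (γ.1 m : ℝ),
          sq_nonneg (2 * Real.pi * ξ m)]
    rw [Finset.sum_add_distrib] at h1
    unfold bracket
    linarith

/-! ### Mild solutions of evolution equations -/

/-- A strongly continuous one-parameter group of linear contractions. -/
structure IsContractionGroup {B : Type*} [NormedAddCommGroup B] [NormedSpace ℂ B]
    (S : ℝ → B →L[ℂ] B) : Prop where
  zero : ∀ x, S 0 x = x
  add : ∀ s t x, S s (S t x) = S (s + t) x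
  norm_le : ∀ t x, ‖S t x‖ ≤ ‖x‖
  cont : ∀ x, Continuous fun t => S t x

namespace IsContractionGroup

variable {B : Type*} [NormedAddCommGroup B] [NormedSpace ℂ B] {S : ℝ → B →L[ℂ] B}

lemma neg_apply (hS : IsContractionGroup S) (t : ℝ) (x : B) : S (-t) (S t x) = x := by
  rw [hS.add, neg_add_cancel, hS.zero]

lemma apply_neg (hS : IsContractionGroup S) (t : ℝ) (x : B) : S t (S (-t) x) = x := by
  rw [hS.add, add_neg_cancel, hS.zero]

lemma norm_eq (hS : IsContractionGroup S) (t : ℝ) (x : B) : ‖S t x‖ = ‖x‖ := by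
  refine le_antisymm (hS.norm_le t x) ?_
  conv_lhs => rw [← hS.neg_apply t x]
  exact hS.norm_le _ _

lemma continuous_apply (hS : IsContractionGroup S) {ι : Type*} [TopologicalSpace ι] {f : ι → ℝ}
    {g : ι → B} (hf : Continuous f) (hg : Continuous g) : Continuous fun i => S (f i) (g i) :=
  continuous_contraction_apply (S := fun i => S (f i)) (fun _ x y => (map_sub _ x y).symm)
    (fun _ x => hS.norm_le _ x) (fun x => (hS.cont x).comp hf) hg

lemma integral_eq [CompleteSpace B] (hS : IsContractionGroup S) {g : ℝ → B} (hg : Continuous g)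
    (t : ℝ) : ∫ τ in (0 : ℝ)..t, S (t - τ) (g τ) = S t (∫ τ in (0 : ℝ)..t, S (-τ) (g τ)) := by
  have h := (S t).intervalIntegral_comp_comm (μ := volume) (a := 0) (b := t)
    (f := fun τ => S (-τ) (g τ))
    ((hS.continuous_apply continuous_neg hg).intervalIntegrable 0 t)
  rw [← h]
  simp only [hS.add, sub_eq_add_neg]

/-- Duhamel's formula in the interaction picture. -/
lemma duhamel_iff [CompleteSpace B] (hS : IsContractionGroup S) {g : ℝ → B} (hg : Continuous g)
    {t : ℝ} {x u₀ : B} : x = S t u₀ + ∫ τ in (0 : ℝ)..t, S (t - τ) (g τ) ↔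
      S (-t) x = u₀ + ∫ τ in (0 : ℝ)..t, S (-τ) (g τ) := by
  rw [hS.integral_eq hg, ← map_add]
  exact ⟨fun h => by rw [h, hS.neg_apply], fun h => by rw [← h, hS.apply_neg]⟩

/-- In the interaction picture `y(t) = S(-t) u(t)`, a mild solution solves an ordinary differential
equation. -/
lemma exists_mild_solution [CompleteSpace B] (hS : IsContractionGroup S) {N : B → B} {L M T : ℝ}
    (hL : ∀ x y, ‖N x - N y‖ ≤ L * ‖x - y‖) (hL0 : 0 ≤ L) (hM : ∀ x, ‖N x‖ ≤ M) (hT : 0 ≤ T)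
    (u₀ : B) : ∃ u : ℝ → B, Continuous u ∧
      ∀ t ∈ Icc 0 T, u t = S t u₀ + ∫ τ in (0 : ℝ)..t, S (t - τ) (N (u τ)) := by
  have hNc : Continuous N :=
    (LipschitzWith.of_dist_le_mul (K := ⟨L, hL0⟩) fun x y => by
      rw [dist_eq_norm, dist_eq_norm]; exact hL x y).continuous
  obtain ⟨y, hy, hy'⟩ := exists_integral_solution hT (fun τ x => S (-τ) (N (S τ x)))
    (fun x => hS.continuous_apply continuous_neg (hNc.comp (hS.cont x))) hL0
    ((norm_nonneg _).trans (hM 0))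
    (fun t x y => by
      rw [← map_sub, hS.norm_eq]
      refine (hL _ _).trans_eq ?_
      rw [← map_sub, hS.norm_eq])
    (fun t x => by rw [hS.norm_eq]; exact hM _) u₀
  have hu : Continuous fun t => S t (y t) := hS.continuous_apply continuous_id hy
  refine ⟨fun t => S t (y t), hu, fun t ht => ?_⟩
  refine (hS.duhamel_iff (hNc.comp hu)).2 ?_
  rw [hS.neg_apply, hy' t ht]
  rfl

/-- Gronwall's inequality for the difference of two mild solutions. -/
lemma mild_solution_unique [CompleteSpace B] (hS : IsContractionGroup S) {N : B → B}
    (hN : Continuous N) {R L T : ℝ} (hL0 : 0 ≤ L)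
    (hL : ∀ x y, ‖x‖ ≤ R → ‖y‖ ≤ R → ‖N x - N y‖ ≤ L * ‖x - y‖) {u₀ : B} {u v : ℝ → B}
    (hu : Continuous u) (hv : Continuous v) (huR : ∀ t ∈ Icc 0 T, ‖u t‖ ≤ R)
    (hvR : ∀ t ∈ Icc 0 T, ‖v t‖ ≤ R)
    (hu' : ∀ t ∈ Icc 0 T, u t = S t u₀ + ∫ τ in (0 : ℝ)..t, S (t - τ) (N (u τ)))
    (hv' : ∀ t ∈ Icc 0 T, v t = S t u₀ + ∫ τ in (0 : ℝ)..t, S (t - τ) (N (v τ))) :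
    ∀ t ∈ Icc 0 T, u t = v t := by
  have key := gronwall_integral (f := fun t => ‖u t - v t‖) (hu.sub hv).norm
    (fun t => norm_nonneg _) le_rfl hL0 (T := T) fun t ht => ?_
  · intro t ht
    have := key t ht
    rw [zero_mul] at this
    exact sub_eq_zero.1 (norm_le_zero_iff.1 this)
  have hc1 : Continuous fun τ => S (t - τ) (N (u τ)) :=
    hS.continuous_apply (by fun_prop) (hN.comp hu)
  have hc2 : Continuous fun τ => S (t - τ) (N (v τ)) :=
    hS.continuous_apply (by fun_prop) (hN.comp hv)
  have e : u t - v t = ∫ τ in (0 : ℝ)..t, S (t - τ) (N (u τ) - N (v τ)) := by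
    simp only [map_sub]
    rw [intervalIntegral.integral_sub (hc1.intervalIntegrable _ _) (hc2.intervalIntegrable _ _)]
    rw [hu' t ht, hv' t ht]
    abel
  rw [zero_add, e, ← intervalIntegral.integral_const_mul]
  refine intervalIntegral.norm_integral_le_of_norm_le ht.1 (ae_of_all _ fun τ hτ => ?_)
    ((continuous_const.mul (hu.sub hv).norm).intervalIntegrable _ _)
  have hτ' : τ ∈ Icc 0 T := ⟨hτ.1.le, hτ.2.trans ht.2⟩
  exact (hS.norm_le _ _).trans (hL _ _ (huR τ hτ') (hvR τ hτ'))

end IsContractionGroup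

lemma isContractionGroup_schro (η : Fin d → ℤ) (ε : ℝ) : IsContractionGroup (schro η ε) :=
  ⟨schro_zero η ε, schro_schro η ε, norm_schro_le η ε, continuous_schro η ε⟩

lemma isContractionGroup_trans (η : Fin d → ℤ) : IsContractionGroup (trans η) :=
  ⟨trans_zero η, trans_trans η, norm_trans_le η, continuous_trans η⟩

/-! ### The nonlocal multiplier on multiphase functions -/

/-- A function that is homogeneous of degree zero takes its values on the unit sphere, which is
compact, and at the origin. -/
lemma IsDegreeZeroKernel.bddSymbol {K : 𝓢'(Space d, ℂ)} {Khat : Space d → ℂ}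
    (hK : IsDegreeZeroKernel K Khat) : BddSymbol Khat := by
  refine ⟨measurable_of_continuousOn_compl_singleton 0 hK.continuousOn, ?_⟩
  obtain ⟨C, hC⟩ := (isCompact_sphere (0 : Space d) 1).exists_bound_of_continuousOn
    (hK.continuousOn.mono fun ξ hξ => by
      rintro rfl
      simp at hξ)
  refine ⟨max C ‖Khat 0‖, fun ξ => ?_⟩
  rcases eq_or_ne ξ 0 with rfl | hξ
  · exact le_max_right _ _
  · refine le_trans ?_ (le_max_left _ _)
    rw [← hK.homogeneous ‖ξ‖⁻¹ (inv_pos.2 (norm_pos_iff.2 hξ)) ξ hξ]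
    refine hC _ ?_
    simp [norm_smul, norm_ne_zero_iff.2 hξ]

/-- The symbol of `E`, frozen at the wave vector `κ` unless `κ = 0`: a multiplier that is
homogeneous of degree zero sees, in the limit, only the rapid oscillation. -/
def frozenSymbol (Khat : Space d → ℂ) (γ : Phase d) (ξ : Space d) : ℂ :=
  if γ.1 = 0 then Khat ξ else Khat (WithLp.toLp 2 fun m => (γ.1 m : ℝ))

lemma BddSymbol.frozen {Khat : Space d → ℂ} (hK : BddSymbol Khat) :
    PhaseSymbol (frozenSymbol Khat) := by
  refine ⟨fun γ => ?_, hK.2.imp fun C h γ ξ => ?_⟩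
  · unfold frozenSymbol
    split_ifs
    exacts [hK.1, measurable_const]
  · unfold frozenSymbol
    split_ifs
    exacts [h _, h _]

lemma norm_frozenSymbol_le {Khat : Space d → ℂ} {Λ : ℝ} (h : ∀ ξ, ‖Khat ξ‖ ≤ Λ) (γ : Phase d)
    (ξ : Space d) : ‖frozenSymbol Khat γ ξ‖ ≤ Λ := by
  unfold frozenSymbol
  split_ifs
  exacts [h _, h _]

/-- By homogeneity, the value at `ξ + κ/(2πε)` is the value at `2πεξ + κ`, which converges by
continuity at `κ ≠ 0`. -/
lemma IsDegreeZeroKernel.tendsto_translate {K : 𝓢'(Space d, ℂ)} {Khat : Space d → ℂ}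
    (hK : IsDegreeZeroKernel K Khat) (γ : Phase d) (ξ : Space d) :
    Tendsto (fun ε : ℝ => Khat (ξ + freq ε γ.1)) (𝓝[>] 0) (𝓝 (frozenSymbol Khat γ ξ)) := by
  unfold frozenSymbol
  split_ifs with h
  · have : ∀ ε : ℝ, freq ε γ.1 = 0 := fun ε => by ext m; simp [freq, h]
    simp [this]
  · set k : Space d := WithLp.toLp 2 fun m => (γ.1 m : ℝ) with hk
    have hk0 : k ≠ 0 := fun h0 => h <| by
      ext m
      have := congrArg (fun v : Space d => v m) h0
      simpa [hk] using this
    have h1 : Tendsto (fun ε : ℝ => (2 * Real.pi * ε) • ξ + k) (𝓝[>] 0) (𝓝 k) := by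
      have : Continuous fun ε : ℝ => (2 * Real.pi * ε) • ξ + k := by fun_prop
      have := this.tendsto 0
      simp only [mul_zero, zero_smul, zero_add] at this
      exact this.mono_left nhdsWithin_le_nhds
    have h2 : ContinuousAt Khat k :=
      hK.continuousOn.continuousAt (isOpen_compl_singleton.mem_nhds hk0)
    refine (h2.tendsto.comp h1).congr' ?_
    filter_upwards [self_mem_nhdsWithin, h1.eventually_ne hk0] with ε hε hne
    have hε' : (0 : ℝ) < 2 * Real.pi * ε := mul_pos Real.two_pi_pos hε
    have e : (2 * Real.pi * ε) • ξ + k = (2 * Real.pi * ε) • (ξ + freq ε γ.1) := by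
      rw [smul_add]
      congr 1
      ext m
      have := (Set.mem_Ioi.1 hε).ne'
      have := Real.pi_ne_zero
      simp only [hk, freq, PiLp.smul_apply, smul_eq_mul]
      field_simp
    rw [Function.comp_apply, e]
    refine hK.homogeneous _ hε' _ fun h0 => hne ?_
    rw [e, h0, smul_zero]

/-- The operator `E` on multiphase functions with wave vectors of size `1/ε`. -/
def phaseMult (Khat : Space d → ℂ) (ε : ℝ) : PhaseAlg d →L[ℂ] PhaseAlg d :=
  diag fun γ ξ => Khat (ξ + freq ε γ.1)

/-- The limit of the operator `E` on multiphase functions, as `ε → 0`. -/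
def frozenMult (Khat : Space d → ℂ) : PhaseAlg d →L[ℂ] PhaseAlg d := diag (frozenSymbol Khat)

lemma norm_phaseMult_le {Khat : Space d → ℂ} (hK : BddSymbol Khat) {Λ : ℝ}
    (h : ∀ ξ, ‖Khat ξ‖ ≤ Λ) (ε : ℝ) (b : PhaseAlg d) : ‖phaseMult Khat ε b‖ ≤ Λ * ‖b‖ :=
  PhaseAlg.norm_diag_le (PhaseAlg.phaseSymbol_translate hK ε) (fun _ _ => h _) b

lemma norm_frozenMult_le {Khat : Space d → ℂ} (hK : BddSymbol Khat) {Λ : ℝ}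
    (h : ∀ ξ, ‖Khat ξ‖ ≤ Λ) (b : PhaseAlg d) : ‖frozenMult Khat b‖ ≤ Λ * ‖b‖ :=
  PhaseAlg.norm_diag_le hK.frozen (norm_frozenSymbol_le h) b

lemma IsDegreeZeroKernel.tendsto_phaseMult {K : 𝓢'(Space d, ℂ)} {Khat : Space d → ℂ}
    (hK : IsDegreeZeroKernel K Khat) (b : PhaseAlg d) :
    Tendsto (fun ε => phaseMult Khat ε b) (𝓝[>] 0) (𝓝 (frozenMult Khat b)) := by
  obtain ⟨Λ, hΛ⟩ := hK.bddSymbol.2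
  exact PhaseAlg.tendsto_diag (fun ε => (PhaseAlg.phaseSymbol_translate hK.bddSymbol ε).1)
    (fun _ _ _ => hΛ _) hK.bddSymbol.frozen
    (fun γ => Eventually.of_forall fun ξ => hK.tendsto_translate γ ξ) b

/-! ### Restriction to a set of phases -/

open Classical in
/-- The restriction of a multiphase function to the phases in `S`. -/
def proj (S : Set (Phase d)) : PhaseAlg d →L[ℂ] PhaseAlg d := diag fun γ _ => if γ ∈ S then 1 else 0

open Classical in
lemma phaseSymbol_proj (S : Set (Phase d)) :
    PhaseSymbol (fun (γ : Phase d) (_ : Space d) => if γ ∈ S then (1 : ℂ) else 0) :=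
  ⟨fun _ => measurable_const, 1, fun γ _ => by beta_reduce; split_ifs <;> simp⟩

open Classical in
lemma proj_apply (S : Set (Phase d)) (b : PhaseAlg d) (γ : Phase d) :
    proj S b γ = if γ ∈ S then b γ else 0 := by
  rw [proj, PhaseAlg.diag_apply (phaseSymbol_proj S), WienerAlg.symb_const]
  split_ifs <;> simp

lemma norm_proj_le (S : Set (Phase d)) (b : PhaseAlg d) : ‖proj S b‖ ≤ ‖b‖ := by
  classical
  simpa [proj] using PhaseAlg.norm_diag_le (phaseSymbol_proj S) (C := 1)
    (fun γ _ => by split_ifs <;> simp) b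

lemma proj_eq_self_iff {S : Set (Phase d)} {b : PhaseAlg d} :
    proj S b = b ↔ ∀ γ, γ ∉ S → b γ = 0 := by
  classical
  constructor
  · intro h γ hγ
    rw [← h, proj_apply, if_neg hγ]
  · intro h
    refine PhaseAlg.ext fun γ => ?_
    rw [proj_apply]
    split_ifs with hγ
    exacts [rfl, (h γ hγ).symm]

lemma proj_proj (S : Set (Phase d)) (b : PhaseAlg d) : proj S (proj S b) = proj S b := by
  classical
  rw [proj_eq_self_iff]
  intro γ hγ
  rw [proj_apply, if_neg hγ]

lemma proj_diag (S : Set (Phase d)) {m : Phase d → Space d → ℂ} (hm : PhaseSymbol m)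
    (b : PhaseAlg d) : proj S (diag m b) = diag m (proj S b) :=
  PhaseAlg.diag_comm (phaseSymbol_proj S) hm b

lemma proj_add_proj_compl (S : Set (Phase d)) (b : PhaseAlg d) : proj S b + proj Sᶜ b = b := by
  classical
  refine PhaseAlg.ext fun γ => ?_
  rw [PhaseAlg.add_apply, proj_apply, proj_apply]
  by_cases h : γ ∈ S <;> simp [h]

/-! ### Regularity of the profile -/

/-- The limit of the nonlinearity on multiphase functions, as `ε → 0`, before the restriction to
resonant phases; the power of the modulus is `n + 1`. -/
def phaseNonlin (lam mu : ℝ) (n : ℕ) (Khat : Space d → ℂ) (b : PhaseAlg d) : PhaseAlg d :=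
  powerNonlin lam mu (n + 1) (frozenMult Khat) b

/-- Mild solutions of the resonant transport system, written for multiphase functions: the
nonlinearity is restricted to the set `S` of resonant phases. -/
structure IsPhaseProfile (lam mu : ℝ) (n : ℕ) (η : Fin d → ℤ) (Khat : Space d → ℂ)
    (S : Set (Phase d)) (T : ℝ) (b₀ : PhaseAlg d) (b : ℝ → PhaseAlg d) : Prop where
  cont : Continuous b
  duhamel : ∀ t ∈ Icc 0 T, b t = trans η t b₀ + ∫ τ in (0 : ℝ)..t,
    trans η (t - τ) (-Complex.I • proj S (phaseNonlin lam mu n Khat (b τ)))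

lemma continuous_phaseNonlin (lam mu : ℝ) (n : ℕ) (Khat : Space d → ℂ) :
    Continuous (phaseNonlin lam mu n Khat) := continuous_powerNonlin ..

lemma continuous_neg_I_proj (lam mu : ℝ) (n : ℕ) (Khat : Space d → ℂ) (S : Set (Phase d)) :
    Continuous fun b : PhaseAlg d => -Complex.I • proj S (phaseNonlin lam mu n Khat b) := by
  have h : Continuous fun b => proj S (phaseNonlin lam mu n Khat b) :=
    (proj S).continuous.comp (continuous_phaseNonlin lam mu n Khat)
  exact h.const_smul (-Complex.I)

lemma norm_neg_I_smul {B : Type*} [NormedAddCommGroup B] [NormedSpace ℂ B] (x : B) :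
    ‖-Complex.I • x‖ = ‖x‖ := by
  rw [norm_smul, norm_neg, Complex.norm_I, one_mul]

/-- The Lipschitz constant of the nonlinearity on a ball of radius `R`. -/
def lipConst (lam mu Λ : ℝ) (n : ℕ) (R : ℝ) : ℝ := (|lam| * Λ + |mu|) * ((n + 2) * R ^ (n + 1))

/-- The constant of the weighted estimate of the nonlinearity on a ball of radius `R`. -/
def tameConst (lam mu Λ : ℝ) (n : ℕ) (R : ℝ) : ℝ :=
  (|lam| * Λ + |mu|) * (4 ^ (n + 1) * R ^ (n + 1))

lemma lipConst_nonneg {lam mu Λ R : ℝ} (hΛ : 0 ≤ Λ) (hR : 0 ≤ R) (n : ℕ) :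
    0 ≤ lipConst lam mu Λ n R := by unfold lipConst; positivity

lemma tameConst_nonneg {lam mu Λ R : ℝ} (hΛ : 0 ≤ Λ) (hR : 0 ≤ R) (n : ℕ) :
    0 ≤ tameConst lam mu Λ n R := by unfold tameConst; positivity

section
variable {lam mu Λ : ℝ} {n : ℕ} {η : Fin d → ℤ} {Khat : Space d → ℂ} {S : Set (Phase d)}
  {T R : ℝ} {b₀ : PhaseAlg d} {b : ℝ → PhaseAlg d}

lemma norm_phaseNonlin_sub_le (hK : BddSymbol Khat) (hΛ : ∀ ξ, ‖Khat ξ‖ ≤ Λ) {x y : PhaseAlg d}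
    (hx : ‖x‖ ≤ R) (hy : ‖y‖ ≤ R) :
    ‖phaseNonlin lam mu n Khat x - phaseNonlin lam mu n Khat y‖
      ≤ lipConst lam mu Λ n R * ‖x - y‖ :=
  norm_powerNonlin_sub_le n (norm_frozenMult_le hK hΛ) ((norm_nonneg _).trans (hΛ 0)) hx hy

lemma norm_phaseNonlin_le (hK : BddSymbol Khat) (hΛ : ∀ ξ, ‖Khat ξ‖ ≤ Λ) {x : PhaseAlg d}
    (hx : ‖x‖ ≤ R) : ‖phaseNonlin lam mu n Khat x‖ ≤ lipConst lam mu Λ n R * R := by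
  have hR : 0 ≤ R := (norm_nonneg _).trans hx
  have h := norm_phaseNonlin_sub_le (lam := lam) (mu := mu) (n := n) hK hΛ hx
    (y := 0) (by simpa using hR)
  rw [phaseNonlin, phaseNonlin, powerNonlin_zero, sub_zero, sub_zero] at h
  exact h.trans (mul_le_mul_of_nonneg_left hx
    (lipConst_nonneg ((norm_nonneg _).trans (hΛ 0)) hR n))

lemma norm_weight_phaseNonlin_le (hK : BddSymbol Khat) (hΛ : ∀ ξ, ‖Khat ξ‖ ≤ Λ) {x : PhaseAlg d}
    (hx : ‖x‖ ≤ R) {M : ℝ} (hM : 0 ≤ M) :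
    ‖diag (weight M) (phaseNonlin lam mu n Khat x)‖
      ≤ tameConst lam mu Λ n R * ‖diag (weight M) x‖ := by
  refine (isTame_weight hM).powerNonlin_le n (norm_frozenMult_le hK hΛ) (fun y => ?_)
    ((norm_nonneg _).trans (hΛ 0)) hx
  rw [frozenMult, PhaseAlg.diag_comm (phaseSymbol_weight hM) hK.frozen]
  exact norm_frozenMult_le hK hΛ _

lemma WeightBound.phaseNonlin (hK : BddSymbol Khat) (hΛ : ∀ ξ, ‖Khat ξ‖ ≤ Λ) {x : PhaseAlg d}
    (hx : ‖x‖ ≤ R) {Y : ℝ} (hY : WeightBound Y x) :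
    WeightBound (tameConst lam mu Λ n R * Y) (phaseNonlin lam mu n Khat x) := fun M hM =>
  (norm_weight_phaseNonlin_le hK hΛ hx hM).trans (mul_le_mul_of_nonneg_left (hY M hM)
    (tameConst_nonneg ((norm_nonneg _).trans (hΛ 0)) ((norm_nonneg _).trans hx) n))

lemma WeightBound.proj {Y : ℝ} {x : PhaseAlg d} (hx : WeightBound Y x) (S : Set (Phase d)) :
    WeightBound Y (proj S x) := by
  classical
  exact hx.diag (phaseSymbol_proj S) fun γ ξ => by split_ifs <;> simp

lemma WeightBound.trans {Y : ℝ} {x : PhaseAlg d} (hx : WeightBound Y x) (η : Fin d → ℤ) (t : ℝ) :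
    WeightBound Y (trans η t x) :=
  hx.diag (phaseSymbol_trans η t) fun _ _ => (norm_transSymbol ..).le

/-- Propagation of regularity: a weighted bound of the initial amplitudes persists as long as the
profile exists. -/
lemma IsPhaseProfile.weightBound (hb : IsPhaseProfile lam mu n η Khat S T b₀ b)
    (hK : BddSymbol Khat) (hΛ : ∀ ξ, ‖Khat ξ‖ ≤ Λ) (hR : ∀ t ∈ Icc 0 T, ‖b t‖ ≤ R) (hT : 0 ≤ T)
    {Y₀ : ℝ} (hY₀ : WeightBound Y₀ b₀) :
    ∀ t ∈ Icc 0 T, WeightBound (Y₀ * Real.exp (tameConst lam mu Λ n R * T)) (b t) := by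
  intro t ht M hM
  have hR0 : 0 ≤ R := (norm_nonneg _).trans (hR 0 ⟨le_rfl, hT⟩)
  have hC := tameConst_nonneg (lam := lam) (mu := mu) ((norm_nonneg _).trans (hΛ 0)) hR0 n
  set D := diag (weight M : Phase d → Space d → ℂ)
  refine gronwall_integral (f := fun t => ‖D (b t)‖) (D.continuous.comp hb.cont).norm
    (fun t => norm_nonneg _) hY₀.nonneg hC (fun t ht => ?_) t ht
  have hF : Continuous fun τ => -Complex.I • MultiphaseNLS.proj S
      (MultiphaseNLS.phaseNonlin lam mu n Khat (b τ)) :=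
    (continuous_neg_I_proj lam mu n Khat S).comp hb.cont
  have hc : Continuous fun τ => MultiphaseNLS.trans η (t - τ) (-Complex.I • MultiphaseNLS.proj S
      (MultiphaseNLS.phaseNonlin lam mu n Khat (b τ))) :=
    (isContractionGroup_trans η).continuous_apply (by fun_prop) hF
  have hcomm : ∀ s x, D (MultiphaseNLS.trans η s x) = MultiphaseNLS.trans η s (D x) := fun s x =>
    PhaseAlg.diag_comm (phaseSymbol_weight hM) (phaseSymbol_trans η s) x
  rw [hb.duhamel t ht, map_add, hcomm,
    ← D.intervalIntegral_comp_comm (hc.intervalIntegrable _ _)]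
  refine (norm_add_le _ _).trans (add_le_add ((norm_trans_le _ _ _).trans (hY₀ M hM)) ?_)
  rw [← intervalIntegral.integral_const_mul]
  refine intervalIntegral.norm_integral_le_of_norm_le ht.1 (ae_of_all _ fun τ hτ => ?_)
    ((continuous_const.mul (D.continuous.comp hb.cont).norm).intervalIntegrable _ _)
  rw [hcomm, map_smul, ← proj_diag S (phaseSymbol_weight hM)]
  refine (norm_trans_le _ _ _).trans ?_
  rw [norm_neg_I_smul]
  exact (norm_proj_le _ _).trans
    (norm_weight_phaseNonlin_le hK hΛ (hR τ ⟨hτ.1.le, hτ.2.trans ht.2⟩) hM)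

/-- The profile stays supported on the resonant phases. -/
lemma IsPhaseProfile.proj_eq (hb : IsPhaseProfile lam mu n η Khat S T b₀ b)
    (hb₀ : proj S b₀ = b₀) : ∀ t ∈ Icc 0 T, proj S (b t) = b t := by
  intro t ht
  have hF : Continuous fun τ => -Complex.I • proj S (phaseNonlin lam mu n Khat (b τ)) :=
    (continuous_neg_I_proj lam mu n Khat S).comp hb.cont
  have hc : Continuous fun τ => trans η (t - τ)
      (-Complex.I • proj S (phaseNonlin lam mu n Khat (b τ))) :=
    (isContractionGroup_trans η).continuous_apply (by fun_prop) hF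
  have hcomm : ∀ s x, proj S (trans η s x) = trans η s (proj S x) := fun s x =>
    proj_diag S (phaseSymbol_trans η s) x
  rw [hb.duhamel t ht, map_add, hcomm, hb₀,
    ← (proj S).intervalIntegral_comp_comm (hc.intervalIntegrable _ _)]
  simp only [hcomm, map_smul, proj_proj]

/-- Regular profiles are Lipschitz in time. -/
lemma IsPhaseProfile.lipschitz (hb : IsPhaseProfile lam mu n η Khat S T b₀ b)
    (hη : ∀ m, η m = 1 ∨ η m = -1)
    (hK : BddSymbol Khat) (hΛ : ∀ ξ, ‖Khat ξ‖ ≤ Λ) (hR : ∀ t ∈ Icc 0 T, ‖b t‖ ≤ R)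
    {Y : ℝ} (hY : ∀ t ∈ Icc 0 T, WeightBound Y (b t)) :
    ∀ s ∈ Icc 0 T, ∀ t ∈ Icc 0 T,
      ‖b t - b s‖ ≤ (lipConst lam mu Λ n R * R + Y) * |t - s| := by
  intro s hs t ht
  have hG := isContractionGroup_trans η
  have hF : Continuous fun τ => -Complex.I • proj S (phaseNonlin lam mu n Khat (b τ)) :=
    (continuous_neg_I_proj lam mu n Khat S).comp hb.cont
  have hc : Continuous fun τ => trans η (-τ)
      (-Complex.I • proj S (phaseNonlin lam mu n Khat (b τ))) :=
    hG.continuous_apply continuous_neg hF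
  have hw : ∀ r ∈ Icc 0 T, trans η (-r) (b r) = b₀ + ∫ τ in (0 : ℝ)..r, trans η (-τ)
      (-Complex.I • proj S (phaseNonlin lam mu n Khat (b τ))) := fun r hr =>
    (hG.duhamel_iff hF).1 (hb.duhamel r hr)
  have h1 : ‖trans η (-t) (b t) - trans η (-s) (b s)‖
      ≤ lipConst lam mu Λ n R * R * |t - s| := by
    rw [hw t ht, hw s hs, add_sub_add_left_eq_sub,
      intervalIntegral.integral_interval_sub_left (hc.intervalIntegrable _ _)
        (hc.intervalIntegrable _ _)]
    refine intervalIntegral.norm_integral_le_of_norm_le_const fun τ hτ => ?_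
    have hτ' : τ ∈ Icc 0 T := by
      rcases le_total s t with hst | hst
      · rw [uIoc_of_le hst] at hτ; exact ⟨hs.1.trans hτ.1.le, hτ.2.trans ht.2⟩
      · rw [uIoc_of_ge hst] at hτ; exact ⟨ht.1.trans hτ.1.le, hτ.2.trans hs.2⟩
    refine (norm_trans_le _ _ _).trans ?_
    rw [norm_neg_I_smul]
    exact (norm_proj_le _ _).trans (norm_phaseNonlin_le hK hΛ (hR τ hτ'))
  have e : b t - b s = trans η t (trans η (-t) (b t) - trans η (-s) (b s))
      + (trans η t (trans η (-s) (b s)) - trans η s (trans η (-s) (b s))) := by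
    rw [map_sub, hG.apply_neg, hG.apply_neg]
    abel
  rw [e, add_mul]
  refine (norm_add_le _ _).trans (add_le_add ((norm_trans_le _ _ _).trans h1) ?_)
  rw [mul_comm]
  exact norm_trans_sub_le hη s t ((hY s hs).trans η (-s))

end

/-! ### Oscillating factors -/

lemma osc_apply (η : Fin d → ℤ) (ε t : ℝ) (b : PhaseAlg d) (γ : Phase d) :
    osc η ε t b γ = oscFactor η ε t γ • b γ := by
  rw [osc, PhaseAlg.diag_apply (phaseSymbol_osc η ε t), WienerAlg.symb_const]

/-- The oscillating factors are trivial on phases that satisfy the eikonal equation. -/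
lemma osc_eq_self {η : Fin d → ℤ} {b : PhaseAlg d} (h : ∀ γ, γ.2 ≠ quadForm η γ.1 → b γ = 0)
    (ε t : ℝ) : osc η ε t b = b := by
  refine PhaseAlg.ext fun γ => ?_
  rw [osc_apply]
  by_cases hγ : γ.2 = quadForm η γ.1
  · simp [oscFactor, hγ]
  · rw [h γ hγ, smul_zero]

lemma integral_oscFactor {η : Fin d → ℤ} {ε : ℝ} (hε : ε ≠ 0) {γ : Phase d}
    (hγ : γ.2 ≠ quadForm η γ.1) (s : ℝ) :
    ∫ τ in s..s + 4 * Real.pi * ε, oscFactor η ε τ γ = 0 := by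
  set N : ℤ := quadForm η γ.1 - γ.2 with hN
  have hN0 : (N : ℂ) ≠ 0 := by
    rw [Int.cast_ne_zero]; exact sub_ne_zero.2 (Ne.symm hγ)
  have hε' : (ε : ℂ) ≠ 0 := by exact_mod_cast hε
  set c : ℂ := Complex.I * N / (2 * ε) with hc
  have hc0 : c ≠ 0 := by rw [hc]; simp [hN0, hε']
  have e : ∀ τ, oscFactor η ε τ γ = Complex.exp (c * τ) := fun τ => by
    rw [oscFactor, hc, ← hN]
    congr 1
    push_cast
    ring
  simp only [e]
  rw [integral_exp_mul_complex hc0]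
  have h2 : c * ((s + 4 * Real.pi * ε : ℝ) : ℂ) = c * s + N * (2 * Real.pi * Complex.I) := by
    rw [hc]
    push_cast
    field_simp
    ring
  rw [h2, Complex.exp_add, Complex.exp_int_mul_two_pi_mul_I, mul_one, sub_self, zero_div]

/-- The oscillating factors have mean zero over the period `4πε` on phases that violate the eikonal
equation. -/
lemma integral_osc {η : Fin d → ℤ} {ε : ℝ} (hε : ε ≠ 0) {b : PhaseAlg d}
    (h : ∀ γ, γ.2 = quadForm η γ.1 → b γ = 0) (s : ℝ) :
    ∫ τ in s..s + 4 * Real.pi * ε, osc η ε τ b = 0 := by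
  refine PhaseAlg.ext fun γ => ?_
  have h1 : (∫ τ in s..s + 4 * Real.pi * ε, osc η ε τ b) γ
      = ∫ τ in s..s + 4 * Real.pi * ε, osc η ε τ b γ :=
    ((coord γ).intervalIntegral_comp_comm ((continuous_osc η ε b).intervalIntegrable _ _)).symm
  rw [h1]
  simp only [osc_apply]
  by_cases hγ : γ.2 = quadForm η γ.1
  · have h0 : coord γ b = 0 := h γ hγ
    simp [h0]
  · rw [intervalIntegral.integral_smul_const, integral_oscFactor hε hγ, zero_smul]
    simp

/-! ### The error estimate -/

lemma continuous_ev (ε : ℝ) {b : ℝ → PhaseAlg d} (hb : Continuous b) :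
    Continuous fun t => ev ε t (b t) := by
  simp only [PhaseAlg.ev_eq_ev_zero ε _ (b _)]
  refine (ev ε 0).continuous.comp ?_
  refine continuous_contraction_apply
    (S := fun t x => diag (fun (γ : Phase d) (_ : Space d) => timeFactor ε t γ) x)
    (fun t x y => (map_sub _ x y).symm) (fun t x => ?_) (fun x => ?_) hb
  · simpa using PhaseAlg.norm_diag_le (PhaseAlg.phaseSymbol_timeFactor ε t) (C := 1)
      (fun γ _ => (PhaseAlg.norm_timeFactor ε t γ).le) x
  · rw [continuous_iff_continuousAt]
    intro t
    refine PhaseAlg.tendsto_diag (C := 1) (fun t γ => measurable_const)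
      (fun t γ ξ => (PhaseAlg.norm_timeFactor ..).le) (PhaseAlg.phaseSymbol_timeFactor ..)
      (fun γ => Eventually.of_forall fun ξ => ?_) x
    have : Continuous fun t => timeFactor ε t γ := by unfold timeFactor; fun_prop
    exact this.tendsto t

/-- The nonlinearity `λ E(|u|^{n+1}) u + μ |u|^{n+1} u` on `W ∩ L²`. -/
def wienerNonlin (lam mu : ℝ) (n : ℕ) (Khat : Space d → ℂ) (x : WienerAlg d) : WienerAlg d :=
  powerNonlin lam mu (n + 1) (symb Khat) x

section
variable {lam mu Λ : ℝ} {n : ℕ} {η : Fin d → ℤ} {Khat : Space d → ℂ} {S : Set (Phase d)}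
  {T R : ℝ} {b₀ : PhaseAlg d} {b : ℝ → PhaseAlg d}

lemma norm_wienerNonlin_sub_le (hK : BddSymbol Khat) (hΛ : ∀ ξ, ‖Khat ξ‖ ≤ Λ) {x y : WienerAlg d}
    (hx : ‖x‖ ≤ R) (hy : ‖y‖ ≤ R) :
    ‖wienerNonlin lam mu n Khat x - wienerNonlin lam mu n Khat y‖
      ≤ lipConst lam mu Λ n R * ‖x - y‖ :=
  norm_powerNonlin_sub_le n (WienerAlg.norm_symb_le hK hΛ) ((norm_nonneg _).trans (hΛ 0)) hx hy

lemma continuous_wienerNonlin (lam mu : ℝ) (n : ℕ) (Khat : Space d → ℂ) :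
    Continuous (wienerNonlin lam mu n Khat) := continuous_powerNonlin ..

/-- Evaluation is a homomorphism that intertwines `E` with its translated symbols, so the
nonlinearity lifts to multiphase functions without error. -/
lemma wienerNonlin_ev (hK : BddSymbol Khat) (ε t : ℝ) (c : PhaseAlg d) :
    wienerNonlin lam mu n Khat (ev ε t c)
      = ev ε t (powerNonlin lam mu (n + 1) (phaseMult Khat ε) c) :=
  (map_powerNonlin (f := ev ε t) (PhaseAlg.ev_mulL ε t) (PhaseAlg.ev_conjL ε t)
    (fun x => (PhaseAlg.symb_ev hK ε t x).symm) lam mu (n + 1) c).symm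

/-- The error density that stems from freezing the symbol of `E`. -/
def freezeError (lam : ℝ) (n : ℕ) (Khat : Space d → ℂ) (ε : ℝ) (c : PhaseAlg d) : ℝ :=
  |lam| * (‖phaseMult Khat ε (altPow (n + 1) c) - frozenMult Khat (altPow (n + 1) c)‖ * ‖c‖)

lemma freezeError_nonneg (lam : ℝ) (n : ℕ) (Khat : Space d → ℂ) (ε : ℝ) (c : PhaseAlg d) :
    0 ≤ freezeError lam n Khat ε c := by unfold freezeError; positivity

lemma continuous_freezeError (lam : ℝ) (n : ℕ) (Khat : Space d → ℂ) (ε : ℝ) :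
    Continuous (freezeError (d := d) lam n Khat ε) := by
  have h : Continuous (altPow (n + 1) : PhaseAlg d → PhaseAlg d) := continuous_altPow _
  unfold freezeError
  exact continuous_const.mul (((((phaseMult Khat ε).continuous.comp h).sub
    ((frozenMult Khat).continuous.comp h)).norm).mul continuous_norm)

/-- Freezing the symbol of `E` costs `o(1)`, by dominated convergence. No rate is available, as the
symbol is merely continuous. -/
lemma tendsto_integral_freezeError {K : 𝓢'(Space d, ℂ)} (hK : IsDegreeZeroKernel K Khat)
    (hb : Continuous b) (T : ℝ) :
    Tendsto (fun ε => ∫ τ in (0 : ℝ)..T, freezeError lam n Khat ε (b τ)) (𝓝[>] 0) (𝓝 0) := by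
  obtain ⟨Λ, hΛ⟩ := hK.bddSymbol.2
  have hA : Continuous fun τ => altPow (n + 1) (b τ) := (continuous_altPow _).comp hb
  suffices h : Tendsto (fun ε => ∫ τ in (0 : ℝ)..T, freezeError lam n Khat ε (b τ)) (𝓝[>] 0)
      (𝓝 (∫ τ in (0 : ℝ)..T, (0 : ℝ))) by simpa using h
  refine intervalIntegral.tendsto_integral_filter_of_dominated_convergence
    (fun τ => |lam| * ((Λ * ‖altPow (n + 1) (b τ)‖ + Λ * ‖altPow (n + 1) (b τ)‖) * ‖b τ‖))
    (Eventually.of_forall fun ε =>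
      ((continuous_freezeError lam n Khat ε).comp hb).aestronglyMeasurable)
    (Eventually.of_forall fun ε => ae_of_all _ fun τ _ => ?_)
    (Continuous.intervalIntegrable (μ := volume) (by fun_prop) _ _) (ae_of_all _ fun τ _ => ?_)
  · rw [Real.norm_eq_abs, abs_of_nonneg (freezeError_nonneg ..), freezeError]
    gcongr
    exact (norm_sub_le _ _).trans (add_le_add (norm_phaseMult_le hK.bddSymbol hΛ _ _)
      (norm_frozenMult_le hK.bddSymbol hΛ _))
  · have h1 := (hK.tendsto_phaseMult (altPow (n + 1) (b τ))).sub_const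
      (frozenMult Khat (altPow (n + 1) (b τ)))
    rw [sub_self] at h1
    have h2 := ((h1.norm.mul_const ‖b τ‖).const_mul |lam|)
    simpa [freezeError] using h2

lemma trans_neg_sub {R' : ℝ} (hη : ∀ m, η m = 1 ∨ η m = -1) {g : ℝ → PhaseAlg d} {Y : ℝ} {s t : ℝ}
    (hg : ‖g t - g s‖ ≤ R' * |t - s|) (hY : WeightBound Y (g s)) :
    ‖trans η (-t) (g t) - trans η (-s) (g s)‖ ≤ (R' + Y) * |t - s| := by
  have e : trans η (-t) (g t) - trans η (-s) (g s)
      = trans η (-t) (g t - g s) + (trans η (-t) (g s) - trans η (-s) (g s)) := by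
    rw [map_sub]; abel
  rw [e, add_mul]
  refine (norm_add_le _ _).trans (add_le_add ((norm_trans_le _ _ _).trans hg) ?_)
  refine (norm_trans_sub_le hη _ _ hY).trans_eq ?_
  rw [neg_sub_neg, abs_sub_comm, mul_comm]

/-- In the interaction picture, the dispersion of the amplitudes costs `O(ε)`. -/
lemma norm_schro_ev_sub_le (hη : ∀ m, η m = 1 ∨ η m = -1) {ε : ℝ} (hε : 0 < ε) {t : ℝ}
    (hT : 0 < T) (ht : |t| ≤ T) {c : PhaseAlg d} {Y : ℝ} (hY : WeightBound Y c) :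
    ‖schro η ε (-t) (ev ε t c) - ev ε 0 (osc η ε t (trans η (-t) c))‖ ≤ ε * T * Y := by
  rw [schro_neg_ev η hε.ne', ← map_sub, ← map_sub, ← map_sub]
  refine (PhaseAlg.norm_ev_le _ _ _).trans ((norm_osc_le _ _ _ _).trans
    ((norm_trans_le _ _ _).trans ?_))
  exact norm_schroPhase_sub_le hη hε hT (by rwa [abs_neg]) hY

lemma proj_trans (S : Set (Phase d)) (η : Fin d → ℤ) (t : ℝ) (c : PhaseAlg d) :
    proj S (trans η t c) = trans η t (proj S c) := proj_diag S (phaseSymbol_trans η t) c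

lemma osc_trans_eq_self (hS : ∀ γ ∈ S, γ.2 = quadForm η γ.1) {c : PhaseAlg d} (hc : proj S c = c)
    (ε s t : ℝ) : osc η ε s (trans η t c) = trans η t c := by
  refine osc_eq_self (fun γ hγ => ?_) ε s
  refine proj_eq_self_iff.1 (show proj S (trans η t c) = trans η t c from ?_) γ
    fun hγS => hγ (hS γ hγS)
  rw [proj_trans, hc]

lemma trans_proj_compl_apply_eq_zero {c : PhaseAlg d} {t : ℝ}
    (h : ∀ γ, γ.2 = quadForm η γ.1 → γ ∉ S → c γ = 0) :
    ∀ γ, γ.2 = quadForm η γ.1 → trans η t (proj Sᶜ c) γ = 0 := by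
  classical
  intro γ hγ
  have e : coord γ (proj Sᶜ c) = 0 := by
    refine (proj_apply Sᶜ c γ).trans ?_
    split_ifs with hγS
    exacts [h γ hγ hγS, rfl]
  refine (PhaseAlg.diag_apply (phaseSymbol_trans η t) _ γ).trans ?_
  beta_reduce
  rw [e, map_zero]

/-- The nonresonant part of the nonlinearity averages out at the rate `ε`. -/
lemma norm_integral_osc_le (hη : ∀ m, η m = 1 ∨ η m = -1) {ε : ℝ} (hε : 0 < ε)
    {Q : ℝ → PhaseAlg d} (hQ : Continuous Q)
    (hres : ∀ τ γ, γ.2 = quadForm η γ.1 → γ ∉ S → Q τ γ = 0) {Lq Y : ℝ} (hLq : 0 ≤ Lq)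
    (hlip : ∀ s ∈ Icc 0 T, ∀ t ∈ Icc 0 T, ‖Q t - Q s‖ ≤ Lq * |t - s|)
    (hY : ∀ t ∈ Icc 0 T, WeightBound Y (Q t)) :
    ∀ t ∈ Icc 0 T, ‖∫ τ in (0 : ℝ)..t, osc η ε τ (trans η (-τ) (proj Sᶜ (Q τ)))‖
      ≤ 4 * Real.pi * ε * (T * (Lq + Y) + Y) := by
  intro t ht
  have hY0 : 0 ≤ Y := (hY t ht).nonneg
  have hhc : Continuous fun τ => trans η (-τ) (proj Sᶜ (Q τ)) :=
    (isContractionGroup_trans η).continuous_apply continuous_neg ((proj Sᶜ).continuous.comp hQ)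
  refine norm_integral_averaging_le (O := fun τ x => osc η ε τ x)
    (h := fun τ => trans η (-τ) (proj Sᶜ (Q τ))) (by positivity)
    (by positivity) (fun _ x y => (map_sub _ x y).symm) (fun _ x => norm_osc_le _ _ _ _)
    (fun x => continuous_osc η ε x)
    (continuous_contraction_apply (S := fun τ x => osc η ε τ x)
      (fun _ x y => (map_sub _ x y).symm) (fun _ x => norm_osc_le _ _ _ _)
      (fun x => continuous_osc η ε x) hhc)
    (fun s r => integral_osc hε.ne' (trans_proj_compl_apply_eq_zero (hres r)) s)
    (fun s hs t ht => trans_neg_sub (g := fun τ => proj Sᶜ (Q τ)) hη ?_ ((hY s hs).proj Sᶜ))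
    (fun t ht => (norm_trans_le _ _ _).trans ((norm_proj_le _ _).trans (hY t ht).norm_le)) t ht
  rw [← map_sub]
  exact (norm_proj_le _ _).trans (hlip s hs t ht)

/-- The constant in front of `ε` in the error estimate, before Gronwall's inequality. -/
def rateConst (L Y Y' Lb T : ℝ) : ℝ :=
  T * (L * (T * Y) + T * Y') + 4 * Real.pi * (T * (L * Lb + Y') + Y')

set_option maxHeartbeats 800000 in
/-- The error estimate for the solution of the equation with truncated nonlinearity. In the
interaction picture, the exact and the approximate solution differ by the dispersion of the
amplitudes, by the freezing of the symbol of `E`, and by the nonresonant part of the nonlinearity,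
whose time integral is of size `ε` because it oscillates with the period `4πε`. -/
lemma IsPhaseProfile.norm_sub_ev_le (hb : IsPhaseProfile lam mu n η Khat S T b₀ b)
    (hη : ∀ m, η m = 1 ∨ η m = -1) (hK : BddSymbol Khat) (hΛ : ∀ ξ, ‖Khat ξ‖ ≤ Λ)
    (hS : ∀ γ ∈ S, γ.2 = quadForm η γ.1)
    (hres : ∀ c : PhaseAlg d, proj S c = c → ∀ γ, γ.2 = quadForm η γ.1 → γ ∉ S →
      phaseNonlin lam mu n Khat c γ = 0)
    (hsupp : ∀ t, proj S (b t) = b t) (hT : 0 < T) (hR0 : 0 < R)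
    (hR : ∀ t ∈ Icc 0 T, ‖b t‖ ≤ R) {Y Y' : ℝ} (hY : ∀ t ∈ Icc 0 T, WeightBound Y (b t))
    (hY' : ∀ t ∈ Icc 0 T, WeightBound Y' (phaseNonlin lam mu n Khat (b t)))
    {Lb : ℝ} (hLb0 : 0 ≤ Lb) (hLb : ∀ s ∈ Icc 0 T, ∀ t ∈ Icc 0 T, ‖b t - b s‖ ≤ Lb * |t - s|)
    {ε : ℝ} (hε : 0 < ε) {u : ℝ → WienerAlg d} (hu : Continuous u)
    (hu' : ∀ t ∈ Icc 0 T, u t = schro η ε t (ev ε 0 b₀) + ∫ τ in (0 : ℝ)..t,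
      schro η ε (t - τ) (-Complex.I • wienerNonlin lam mu n Khat (retract R (u τ)))) :
    ∀ t ∈ Icc 0 T, ‖u t - ev ε t (b t)‖
      ≤ (ε * rateConst (2 * lipConst lam mu Λ n R) Y Y' Lb T
          + ∫ τ in (0 : ℝ)..T, freezeError lam n Khat ε (b τ))
          * Real.exp (2 * lipConst lam mu Λ n R * T) + ε * (T * Y) := by
  set L := 2 * lipConst lam mu Λ n R with hL
  have hΛ0 : 0 ≤ Λ := (norm_nonneg _).trans (hΛ 0)
  have hlip0 : 0 ≤ lipConst lam mu Λ n R := lipConst_nonneg hΛ0 hR0.le n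
  have hL0 : 0 ≤ L := by positivity
  have h0T : (0 : ℝ) ∈ Icc 0 T := ⟨le_rfl, hT.le⟩
  have hY0 : 0 ≤ Y := (hY 0 h0T).nonneg
  have hY'0 : 0 ≤ Y' := (hY' 0 h0T).nonneg
  have hG := isContractionGroup_trans η
  have hSg := isContractionGroup_schro η ε
  set Q : ℝ → PhaseAlg d := fun τ => phaseNonlin lam mu n Khat (b τ) with hQ
  have hQc : Continuous Q := (continuous_phaseNonlin ..).comp hb.cont
  set NR : WienerAlg d → WienerAlg d := fun x => wienerNonlin lam mu n Khat (retract R x) with hNR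
  have hNRlip : ∀ x y, ‖NR x - NR y‖ ≤ L * ‖x - y‖ := fun x y => by
    refine (norm_wienerNonlin_sub_le hK hΛ (norm_retract_le hR0 x) (norm_retract_le hR0 y)).trans ?_
    refine (mul_le_mul_of_nonneg_left (norm_retract_sub_le hR0 x y) hlip0).trans_eq ?_
    rw [hL]; ring
  have hNRc : Continuous NR :=
    (LipschitzWith.of_dist_le_mul (K := ⟨L, hL0⟩) fun x y => by
      rw [dist_eq_norm, dist_eq_norm]; exact hNRlip x y).continuous
  set ua : ℝ → WienerAlg d := fun t => ev ε t (b t) with hua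
  -- the nonresonant part of the nonlinearity, in the interaction picture
  set h : ℝ → PhaseAlg d := fun τ => trans η (-τ) (proj Sᶜ (Q τ)) with hh
  have hhc : Continuous h := hG.continuous_apply continuous_neg ((proj Sᶜ).continuous.comp hQc)
  have hoh : Continuous fun τ => osc η ε τ (h τ) :=
    continuous_contraction_apply (S := fun τ x => osc η ε τ x)
      (fun _ x y => (map_sub _ x y).symm) (fun _ x => norm_osc_le _ _ _ _)
      (fun x => continuous_osc η ε x) hhc
  have hosc : ∀ c : PhaseAlg d, proj S c = c → ∀ s t, osc η ε s (trans η t c) = trans η t c := by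
    intro c hc s t
    exact osc_trans_eq_self hS hc ε s t
  have havg : ∀ t ∈ Icc 0 T, ‖∫ τ in (0 : ℝ)..t, osc η ε τ (h τ)‖
      ≤ 4 * Real.pi * ε * (T * (L * Lb + Y') + Y') := by
    refine norm_integral_osc_le hη hε hQc (fun r γ hγ hγS => hres (b r) (hsupp r) γ hγ hγS)
      (by positivity) (fun s hs t ht => ?_) hY'
    refine (norm_phaseNonlin_sub_le hK hΛ (hR t ht) (hR s hs)).trans ?_
    calc lipConst lam mu Λ n R * ‖b t - b s‖ ≤ lipConst lam mu Λ n R * (Lb * |t - s|) :=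
          mul_le_mul_of_nonneg_left (hLb s hs t ht) hlip0
      _ ≤ L * Lb * |t - s| := by
          rw [hL]
          have : 0 ≤ lipConst lam mu Λ n R * (Lb * |t - s|) := by positivity
          linarith
  -- the approximate solution, up to dispersion, and the exact one, both in the interaction picture
  set z : ℝ → WienerAlg d := fun t => ev ε 0 (trans η (-t) (b t)) with hz
  set y : ℝ → WienerAlg d := fun t => schro η ε (-t) (u t) with hy
  have hzc : Continuous z := (ev ε 0).continuous.comp (hG.continuous_apply continuous_neg hb.cont)
  have hyc : Continuous y := hSg.continuous_apply continuous_neg hu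
  have habs : ∀ t ∈ Icc 0 T, |t| ≤ T := fun t ht => by rw [abs_of_nonneg ht.1]; exact ht.2
  have huaz : ∀ t ∈ Icc 0 T, ‖schro η ε (-t) (ua t) - z t‖ ≤ ε * T * Y := fun t ht => by
    have := norm_schro_ev_sub_le hη hε hT (habs t ht) (hY t ht)
    rwa [hosc _ (hsupp t)] at this
  have huua : ∀ t ∈ Icc 0 T, ‖u t - ua t‖ ≤ ‖y t - z t‖ + ε * T * Y := fun t ht => by
    rw [← hSg.norm_eq (-t), map_sub]
    refine (norm_sub_le_norm_sub_add_norm_sub _ (z t) _).trans ?_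
    rw [norm_sub_rev (z t)]
    exact add_le_add le_rfl (huaz t ht)
  have hI1c : Continuous fun τ => schro η ε (-τ) (-Complex.I • NR (u τ)) :=
    hSg.continuous_apply continuous_neg ((hNRc.comp hu).const_smul (-Complex.I))
  have hFc : Continuous fun τ => -Complex.I • proj S (Q τ) :=
    (continuous_neg_I_proj lam mu n Khat S).comp hb.cont
  have hI2c : Continuous fun τ => trans η (-τ) (-Complex.I • proj S (Q τ)) :=
    hG.continuous_apply continuous_neg hFc
  have hI2c' : Continuous fun τ => ev ε 0 (trans η (-τ) (-Complex.I • proj S (Q τ))) :=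
    (ev ε 0).continuous.comp hI2c
  have hPc : Continuous fun τ => -Complex.I • ev ε 0 (osc η ε τ (h τ)) :=
    ((ev ε 0).continuous.comp hoh).const_smul (-Complex.I)
  have hyeq : ∀ t ∈ Icc 0 T, y t = ev ε 0 b₀
      + ∫ τ in (0 : ℝ)..t, schro η ε (-τ) (-Complex.I • NR (u τ)) := fun t ht =>
    (hSg.duhamel_iff ((hNRc.comp hu).const_smul (-Complex.I))).1 (hu' t ht)
  have hzeq : ∀ t ∈ Icc 0 T, z t = ev ε 0 b₀
      + ∫ τ in (0 : ℝ)..t, ev ε 0 (trans η (-τ) (-Complex.I • proj S (Q τ))) := fun t ht => by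
    rw [hz]
    beta_reduce
    rw [(hG.duhamel_iff hFc).1 (hb.duhamel t ht), map_add,
      ← (ev ε 0).intervalIntegral_comp_comm (hI2c.intervalIntegrable _ _)]
  -- The integrands of `y` and `z` differ by the nonresonant part, which is small only after
  -- integration in time, and by three terms that are estimated pointwise in time.
  have hpt : ∀ τ ∈ Icc 0 T, ‖schro η ε (-τ) (-Complex.I • NR (u τ))
      - ev ε 0 (trans η (-τ) (-Complex.I • proj S (Q τ)))
      - -Complex.I • ev ε 0 (osc η ε τ (h τ))‖
      ≤ L * ‖y τ - z τ‖ + (ε * (L * (T * Y) + T * Y') + freezeError lam n Khat ε (b τ)) := by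
    intro τ hτ
    have e1 : ev ε 0 (trans η (-τ) (proj S (Q τ))) + ev ε 0 (osc η ε τ (h τ))
        = ev ε 0 (osc η ε τ (trans η (-τ) (Q τ))) := by
      conv_rhs => rw [← proj_add_proj_compl S (Q τ), map_add, map_add, map_add,
        hosc _ (proj_proj S _)]
    have e2 : NR (ua τ) = ev ε τ (powerNonlin lam mu (n + 1) (phaseMult Khat ε) (b τ)) := by
      rw [hNR]
      beta_reduce
      rw [retract_of_norm_le hR0 ((PhaseAlg.norm_ev_le _ _ _).trans (hR τ hτ)), wienerNonlin_ev hK]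
    have e3 : schro η ε (-τ) (-Complex.I • NR (u τ))
        - ev ε 0 (trans η (-τ) (-Complex.I • proj S (Q τ)))
        - -Complex.I • ev ε 0 (osc η ε τ (h τ))
        = -Complex.I • (schro η ε (-τ) (NR (u τ) - NR (ua τ))
          + schro η ε (-τ) (ev ε τ (powerNonlin lam mu (n + 1) (phaseMult Khat ε) (b τ) - Q τ))
          + (schro η ε (-τ) (ev ε τ (Q τ)) - ev ε 0 (osc η ε τ (trans η (-τ) (Q τ))))) := by
      rw [← e1, e2]
      simp only [map_sub, map_smul, smul_add, smul_sub]
      abel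
    rw [e3, norm_neg_I_smul]
    have n1 : ‖schro η ε (-τ) (NR (u τ) - NR (ua τ))‖ ≤ L * (‖y τ - z τ‖ + ε * T * Y) :=
      (norm_schro_le _ _ _ _).trans ((hNRlip _ _).trans
        (mul_le_mul_of_nonneg_left (huua τ hτ) hL0))
    have n2 : ‖schro η ε (-τ) (ev ε τ
        (powerNonlin lam mu (n + 1) (phaseMult Khat ε) (b τ) - Q τ))‖
        ≤ freezeError lam n Khat ε (b τ) :=
      (norm_schro_le _ _ _ _).trans ((PhaseAlg.norm_ev_le _ _ _).trans
        (norm_powerNonlin_sub_powerNonlin_le lam mu (n + 1) _ _ (b τ)))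
    have n3 := norm_schro_ev_sub_le hη hε hT (habs τ hτ) (hY' τ hτ)
    refine (norm_add₃_le.trans (add_le_add (add_le_add n1 n2) n3)).trans_eq ?_
    ring
  have hfc := (continuous_freezeError lam n Khat ε).comp hb.cont
  have hf0 : ∀ τ, 0 ≤ freezeError lam n Khat ε (b τ) := fun τ => freezeError_nonneg ..
  have hρ : 0 ≤ ∫ τ in (0 : ℝ)..T, freezeError lam n Khat ε (b τ) :=
    intervalIntegral.integral_nonneg hT.le fun τ _ => hf0 τ
  have key := gronwall_integral (f := fun t => ‖y t - z t‖) (hyc.sub hzc).norm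
    (fun t => norm_nonneg _) (A := ε * rateConst L Y Y' Lb T
      + ∫ τ in (0 : ℝ)..T, freezeError lam n Khat ε (b τ)) (K := L) (T := T)
    (by unfold rateConst; positivity) hL0 fun t ht => ?_
  · intro t ht
    refine (huua t ht).trans ?_
    have := key t ht
    beta_reduce at this
    linarith
  have hsplit : y t - z t = (∫ τ in (0 : ℝ)..t, (schro η ε (-τ) (-Complex.I • NR (u τ))
      - ev ε 0 (trans η (-τ) (-Complex.I • proj S (Q τ)))
      - -Complex.I • ev ε 0 (osc η ε τ (h τ))))
      + ∫ τ in (0 : ℝ)..t, -Complex.I • ev ε 0 (osc η ε τ (h τ)) := by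
    have i1 := intervalIntegral.integral_sub (μ := volume)
      ((hI1c.sub hI2c').intervalIntegrable 0 t) (hPc.intervalIntegrable 0 t)
    have i2 := intervalIntegral.integral_sub (μ := volume)
      (hI1c.intervalIntegrable 0 t) (hI2c'.intervalIntegrable 0 t)
    simp only [Pi.sub_apply] at i1 i2
    rw [i1, i2, hyeq t ht, hzeq t ht]
    abel
  have hP : ‖∫ τ in (0 : ℝ)..t, -Complex.I • ev ε 0 (osc η ε τ (h τ))‖
      ≤ 4 * Real.pi * ε * (T * (L * Lb + Y') + Y') := by
    rw [intervalIntegral.integral_smul, norm_neg_I_smul,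
      (ev ε 0).intervalIntegral_comp_comm (hoh.intervalIntegrable _ _)]
    exact (PhaseAlg.norm_ev_le _ _ _).trans (havg t ht)
  have hfint : ∫ τ in (0 : ℝ)..t, freezeError lam n Khat ε (b τ)
      ≤ ∫ τ in (0 : ℝ)..T, freezeError lam n Khat ε (b τ) :=
    intervalIntegral.integral_mono_interval le_rfl ht.1 ht.2 (ae_of_all _ hf0)
      (hfc.intervalIntegrable _ _)
  have hint : ‖∫ τ in (0 : ℝ)..t, (schro η ε (-τ) (-Complex.I • NR (u τ))
      - ev ε 0 (trans η (-τ) (-Complex.I • proj S (Q τ)))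
      - -Complex.I • ev ε 0 (osc η ε τ (h τ)))‖
      ≤ L * (∫ τ in (0 : ℝ)..t, ‖y τ - z τ‖) + (t * (ε * (L * (T * Y) + T * Y'))
        + ∫ τ in (0 : ℝ)..t, freezeError lam n Khat ε (b τ)) := by
    have hc1 : Continuous fun τ => L * ‖y τ - z τ‖ := continuous_const.mul (hyc.sub hzc).norm
    have hc2 : Continuous fun _ : ℝ => ε * (L * (T * Y) + T * Y') := continuous_const
    refine (intervalIntegral.norm_integral_le_of_norm_le ht.1
      (ae_of_all _ fun τ hτ => hpt τ ⟨hτ.1.le, hτ.2.trans ht.2⟩)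
      ((hc1.add (hc2.add hfc)).intervalIntegrable _ _)).trans_eq ?_
    have i1 := intervalIntegral.integral_add (μ := volume) (hc1.intervalIntegrable 0 t)
      ((hc2.add hfc).intervalIntegrable 0 t)
    have i2 := intervalIntegral.integral_add (μ := volume) (hc2.intervalIntegrable 0 t)
      (hfc.intervalIntegrable 0 t)
    simp only [Function.comp_apply, Pi.add_apply] at i1 i2
    rw [i1, i2, intervalIntegral.integral_const_mul, intervalIntegral.integral_const, sub_zero,
      smul_eq_mul]
  rw [hsplit]
  refine (norm_add_le _ _).trans ((add_le_add hint hP).trans ?_)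
  have ht' : t * (ε * (L * (T * Y) + T * Y')) ≤ T * (ε * (L * (T * Y) + T * Y')) :=
    mul_le_mul_of_nonneg_right ht.2 (by positivity)
  have er : ε * rateConst L Y Y' Lb T = T * (ε * (L * (T * Y) + T * Y'))
      + 4 * Real.pi * ε * (T * (L * Lb + Y') + Y') := by
    unfold rateConst; ring
  rw [er]
  linarith

end

/-! ### Existence of profiles and of exact solutions -/

section
variable {lam mu Λ : ℝ} {n : ℕ} {η : Fin d → ℤ} {Khat : Space d → ℂ} {S : Set (Phase d)}
  {T R : ℝ} {b₀ : PhaseAlg d} {b : ℝ → PhaseAlg d}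

lemma exists_norm_le_on_Icc {B : Type*} [NormedAddCommGroup B] {b : ℝ → B} (hb : Continuous b)
    (T : ℝ) : ∃ R : ℝ, 0 < R ∧ ∀ t ∈ Icc 0 T, ‖b t‖ ≤ R := by
  obtain ⟨R, hR⟩ := isCompact_Icc.exists_bound_of_continuousOn (s := Icc 0 T) hb.continuousOn
  exact ⟨max R 1, by positivity, fun t ht => (hR t ht).trans (le_max_left _ _)⟩

/-- A continuous retraction of the real line to `[0, T]`. -/
lemma exists_clamp {T : ℝ} (hT : 0 ≤ T) : ∃ p : ℝ → ℝ, Continuous p ∧ (∀ t, p t ∈ Icc 0 T) ∧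
    ∀ t ∈ Icc 0 T, p t = t :=
  ⟨fun t => max 0 (min T t), by fun_prop,
    fun t => ⟨le_max_left _ _, max_le hT (min_le_left _ _)⟩, fun t ht => by simp [ht.1, ht.2]⟩

/-- Local existence for the resonant transport system: the equation with truncated nonlinearity has
a solution, and the truncation is inactive for small times. -/
lemma exists_isPhaseProfile (lam mu : ℝ) (n : ℕ) (η : Fin d → ℤ) (hK : BddSymbol Khat)
    (S : Set (Phase d)) (b₀ : PhaseAlg d) :
    ∃ T : ℝ, 0 < T ∧ ∃ b, IsPhaseProfile lam mu n η Khat S T b₀ b := by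
  obtain ⟨Λ, hΛ⟩ := hK.2
  have hΛ0 : 0 ≤ Λ := (norm_nonneg _).trans (hΛ 0)
  set R := ‖b₀‖ + 1 with hR
  have hR0 : 0 < R := by positivity
  have hlip0 := lipConst_nonneg (lam := lam) (mu := mu) hΛ0 hR0.le n
  have hG := isContractionGroup_trans η
  obtain ⟨b, hbc, hb⟩ := hG.exists_mild_solution (T := 1)
    (N := fun x => -Complex.I • proj S (phaseNonlin lam mu n Khat (retract R x)))
    (L := lipConst lam mu Λ n R * 2) (M := lipConst lam mu Λ n R * R)
    (fun x y => by
      rw [← smul_sub, ← map_sub, norm_neg_I_smul, mul_assoc]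
      exact (norm_proj_le _ _).trans ((norm_phaseNonlin_sub_le hK hΛ (norm_retract_le hR0 x)
        (norm_retract_le hR0 y)).trans
        (mul_le_mul_of_nonneg_left (norm_retract_sub_le hR0 x y) hlip0)))
    (by positivity)
    (fun x => by
      rw [norm_neg_I_smul]
      exact (norm_proj_le _ _).trans (norm_phaseNonlin_le hK hΛ (norm_retract_le hR0 x)))
    zero_le_one b₀
  have hb0 : b 0 = b₀ := by
    have := hb 0 ⟨le_rfl, zero_le_one⟩
    rwa [hG.zero, intervalIntegral.integral_same, add_zero] at this
  have hev : ∀ᶠ t in 𝓝 (0 : ℝ), ‖b t‖ < R :=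
    hbc.norm.continuousAt.eventually_lt_const (by simp only [hb0, hR]; linarith)
  obtain ⟨δ, hδ, hball⟩ := Metric.eventually_nhds_iff.1 hev
  have hT1 : min (δ / 2) 1 ≤ 1 := min_le_right _ _
  have hTδ : min (δ / 2) 1 < δ := (min_le_left _ _).trans_lt (by linarith)
  refine ⟨min (δ / 2) 1, by positivity, b, hbc, fun t ht => ?_⟩
  rw [hb t ⟨ht.1, ht.2.trans hT1⟩]
  congr 1
  refine intervalIntegral.integral_congr fun τ hτ => ?_
  rw [uIcc_of_le ht.1] at hτ
  have hτR : ‖b τ‖ ≤ R := (hball (by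
    rw [Real.dist_eq, sub_zero, abs_of_nonneg hτ.1]
    exact (hτ.2.trans ht.2).trans_lt hTδ)).le
  rw [retract_of_norm_le hR0 hτR]

/-- Exact solutions exist up to the time `T` for which the profile exists, and are close to the
multiphase function that the profile defines. -/
theorem IsPhaseProfile.exists_exact_solution (hb : IsPhaseProfile lam mu n η Khat S T b₀ b)
    (hη : ∀ m, η m = 1 ∨ η m = -1) {K : 𝓢'(Space d, ℂ)} (hK : IsDegreeZeroKernel K Khat)
    (hS : ∀ γ ∈ S, γ.2 = quadForm η γ.1)
    (hres : ∀ c : PhaseAlg d, proj S c = c → ∀ γ, γ.2 = quadForm η γ.1 → γ ∉ S →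
      phaseNonlin lam mu n Khat c γ = 0)
    (hsupp : ∀ t, proj S (b t) = b t) (hT : 0 < T) {Y₀ : ℝ} (hY₀ : WeightBound Y₀ b₀) :
    ∃ ε₀ C : ℝ, ∃ ρ : ℝ → ℝ, 0 < ε₀ ∧ 0 < C ∧ Tendsto ρ (𝓝[>] 0) (𝓝 0) ∧
      (lam = 0 → ∀ ε, ρ ε = 0) ∧ ∀ ε, 0 < ε → ε ≤ ε₀ → ∃ u : ℝ → WienerAlg d, Continuous u ∧
        (∀ t ∈ Icc 0 T, u t = schro η ε t (ev ε 0 b₀) + ∫ τ in (0 : ℝ)..t,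
          schro η ε (t - τ) (-Complex.I • wienerNonlin lam mu n Khat (u τ))) ∧
        ∀ t ∈ Icc 0 T, ‖u t - ev ε t (b t)‖ ≤ C * ε + ρ ε := by
  have hKb := hK.bddSymbol
  obtain ⟨Λ, hΛ⟩ := hKb.2
  have hΛ0 : 0 ≤ Λ := (norm_nonneg _).trans (hΛ 0)
  have h0T : (0 : ℝ) ∈ Icc 0 T := ⟨le_rfl, hT.le⟩
  obtain ⟨B, hB0, hB⟩ := exists_norm_le_on_Icc hb.cont T
  -- The profile has norm at most `B`. An error of at most one keeps the exact solution in the ball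
  -- of radius `B + 1`, on which the nonlinearity is not truncated.
  set R := B + 1 with hRdef
  have hR0 : 0 < R := by positivity
  have hR : ∀ t ∈ Icc 0 T, ‖b t‖ ≤ R := fun t ht => (hB t ht).trans (by linarith)
  have hlip0 := lipConst_nonneg (lam := lam) (mu := mu) hΛ0 hR0.le n
  set Y := Y₀ * Real.exp (tameConst lam mu Λ n R * T)
  have hY := hb.weightBound hKb hΛ hR hT.le hY₀
  have hY' := fun t ht => (hY t ht).phaseNonlin (lam := lam) (mu := mu) (n := n) hKb hΛ (hR t ht)
  set Y' := tameConst lam mu Λ n R * Y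
  have hY0 : 0 ≤ Y := (hY 0 h0T).nonneg
  have hY'0 : 0 ≤ Y' := (hY' 0 h0T).nonneg
  have hLb := hb.lipschitz hη hKb hΛ hR hY
  set Lb := lipConst lam mu Λ n R * R + Y
  have hLb0 : 0 ≤ Lb := by positivity
  set L := 2 * lipConst lam mu Λ n R with hL
  have hL0 : 0 ≤ L := by positivity
  set C := rateConst L Y Y' Lb T * Real.exp (L * T) + T * Y + 1 with hC
  have hC0 : 0 < C := by
    have : 0 ≤ rateConst L Y Y' Lb T := by unfold rateConst; positivity
    positivity
  set ρ : ℝ → ℝ := fun ε =>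
    (∫ τ in (0 : ℝ)..T, freezeError lam n Khat ε (b τ)) * Real.exp (L * T) with hρ
  have hρt : Tendsto ρ (𝓝[>] 0) (𝓝 0) := by
    simpa using (tendsto_integral_freezeError (lam := lam) (n := n) hK hb.cont T).mul_const
      (Real.exp (L * T))
  have hsmall : ∀ᶠ ε in 𝓝[>] (0 : ℝ), C * ε + ρ ε ≤ 1 := by
    have h1 : Tendsto (fun ε : ℝ => C * ε) (𝓝[>] 0) (𝓝 0) := by
      have : Continuous fun ε : ℝ => C * ε := by fun_prop
      simpa using (this.tendsto 0).mono_left nhdsWithin_le_nhds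
    have h2 := h1.add hρt
    rw [add_zero] at h2
    exact h2.eventually_le_const zero_lt_one
  obtain ⟨ε₀, hε₀, hsub⟩ := mem_nhdsGT_iff_exists_Ioc_subset.1 hsmall
  refine ⟨ε₀, C, ρ, hε₀, hC0, hρt, fun h ε => by simp [hρ, freezeError, h], fun ε hε hεε₀ => ?_⟩
  have hle : C * ε + ρ ε ≤ 1 := hsub ⟨hε, hεε₀⟩
  have hwlip : ∀ x y, ‖wienerNonlin lam mu n Khat (retract R x)
      - wienerNonlin lam mu n Khat (retract R y)‖ ≤ L * ‖x - y‖ := fun x y => by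
    refine (norm_wienerNonlin_sub_le hKb hΛ (norm_retract_le hR0 x)
      (norm_retract_le hR0 y)).trans ?_
    refine (mul_le_mul_of_nonneg_left (norm_retract_sub_le hR0 x y) hlip0).trans_eq ?_
    rw [hL]; ring
  have hw0 : wienerNonlin lam mu n Khat 0 = 0 := powerNonlin_zero ..
  obtain ⟨u, huc, hu⟩ := (isContractionGroup_schro η ε).exists_mild_solution (T := T)
    (N := fun x => -Complex.I • wienerNonlin lam mu n Khat (retract R x))
    (L := L) (M := lipConst lam mu Λ n R * R)
    (fun x y => by
      rw [← smul_sub, norm_neg_I_smul]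
      exact hwlip x y)
    hL0
    (fun x => by
      rw [norm_neg_I_smul]
      have := norm_wienerNonlin_sub_le (lam := lam) (mu := mu) (n := n) hKb hΛ
        (norm_retract_le hR0 x) (y := 0) (by simpa using hR0.le)
      rw [hw0, sub_zero, sub_zero] at this
      exact this.trans (mul_le_mul_of_nonneg_left (norm_retract_le hR0 x) hlip0))
    hT.le (ev ε 0 b₀)
  have herr : ∀ t ∈ Icc 0 T, ‖u t - ev ε t (b t)‖ ≤ C * ε + ρ ε := fun t ht => by
    refine (hb.norm_sub_ev_le hη hKb hΛ hS hres hsupp hT hR0 hR hY hY' hLb0 hLb hε huc hu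
      t ht).trans ?_
    rw [hC, hρ]
    beta_reduce
    rw [← hL]
    nlinarith
  refine ⟨u, huc, fun t ht => ?_, herr⟩
  rw [hu t ht]
  congr 1
  refine intervalIntegral.integral_congr fun τ hτ => ?_
  rw [uIcc_of_le ht.1] at hτ
  have hτ' : τ ∈ Icc 0 T := ⟨hτ.1, hτ.2.trans ht.2⟩
  have hτR : ‖u τ‖ ≤ R := by
    have h1 := herr τ hτ'
    have h2 : ‖ev ε τ (b τ)‖ ≤ B := (PhaseAlg.norm_ev_le _ _ _).trans (hB τ hτ')
    have h3 := norm_le_insert' (u τ) (ev ε τ (b τ))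
    linarith
  rw [retract_of_norm_le hR0 hτR]

/-- Uniqueness of profiles, by Gronwall's inequality. -/
lemma IsPhaseProfile.unique {c : ℝ → PhaseAlg d} (hb : IsPhaseProfile lam mu n η Khat S T b₀ b)
    (hc : IsPhaseProfile lam mu n η Khat S T b₀ c) (hK : BddSymbol Khat) :
    ∀ t ∈ Icc 0 T, b t = c t := by
  obtain ⟨Λ, hΛ⟩ := hK.2
  obtain ⟨R₁, h1, hR₁⟩ := exists_norm_le_on_Icc hb.cont T
  obtain ⟨R₂, h2, hR₂⟩ := exists_norm_le_on_Icc hc.cont T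
  refine (isContractionGroup_trans η).mild_solution_unique (R := max R₁ R₂)
    (continuous_neg_I_proj lam mu n Khat S)
    (lipConst_nonneg (lam := lam) (mu := mu) ((norm_nonneg _).trans (hΛ 0))
      (h1.le.trans (le_max_left R₁ R₂)) n)
    (fun x y hx hy => ?_) hb.cont hc.cont (fun t ht => (hR₁ t ht).trans (le_max_left _ _))
    (fun t ht => (hR₂ t ht).trans (le_max_right _ _)) hb.duhamel hc.duhamel
  rw [← smul_sub, ← map_sub, norm_neg_I_smul]
  exact (norm_proj_le _ _).trans (norm_phaseNonlin_sub_le hK hΛ hx hy)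

end

/-! ### Expansion of the nonlinearity over tuples of phases -/

/-- The alternating sum `g_1 - g_2 + g_3 - ⋯`. -/
def altSum {A : Type*} [AddCommGroup A] {n : ℕ} (g : Fin n → A) : A :=
  ∑ i : Fin n, (-1 : ℤ) ^ (i : ℕ) • g i

lemma altSum_succ {A : Type*} [AddCommGroup A] {n : ℕ} (g : Fin (n + 1) → A) :
    altSum g = altSum (fun i => g i.castSucc) + (-1 : ℤ) ^ n • g (Fin.last n) := by
  simp [altSum, Fin.sum_univ_castSucc]

/-- An `(n+1)`-tuple is an `n`-tuple together with a last entry. -/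
def initLastEquiv (n : ℕ) (I : Type*) : (Fin (n + 1) → I) ≃ (Fin n → I) × I where
  toFun ℓ := (fun i => ℓ i.castSucc, ℓ (Fin.last n))
  invFun p := Fin.snoc (α := fun _ => I) p.1 p.2
  left_inv ℓ := by
    ext i
    refine Fin.lastCases ?_ (fun i => ?_) i
    · simp
    · simp
  right_inv p := by
    ext i <;> simp

lemma conjL_single (γ : Phase d) (x : WienerAlg d) :
    conjL (single γ x) = single (-γ) (conjL x) := by
  refine PhaseAlg.ext fun γ' => ?_
  rw [PhaseAlg.conjL_apply, PhaseAlg.single_apply, PhaseAlg.single_apply]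
  by_cases h : γ' = -γ
  · rw [if_pos h, if_pos (by rw [h, neg_neg])]
  · rw [if_neg h, if_neg (fun h' => h (by rw [← h', neg_neg])), map_zero]

lemma altFactor_single (n : ℕ) (γ : Phase d) (x : WienerAlg d) :
    altFactor n (single γ x) = single ((-1 : ℤ) ^ n • γ) (altFactor n x) := by
  rcases Nat.even_or_odd n with h | h
  · simp [altFactor, h]
  · have h' : ¬Even n := Nat.not_even_iff_odd.2 h
    simp [altFactor, h', h.neg_one_pow, conjL_single]

section
variable {I : Type*} {g : I → Phase d} {x : I → WienerAlg d} {b : PhaseAlg d}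

lemma hasSum_altFactor (hb : HasSum (fun i => single (g i) (x i)) b) (n : ℕ) :
    HasSum (fun i => single ((-1 : ℤ) ^ n • g i) (altFactor n (x i))) (altFactor n b) := by
  simp only [← altFactor_single]
  rcases Nat.even_or_odd n with h | h
  · simpa only [altFactor, if_pos h] using hb
  · have h' : ¬Even n := Nat.not_even_iff_odd.2 h
    simpa only [altFactor, if_neg h'] using (conjL : PhaseAlg d →L⋆[ℂ] PhaseAlg d).hasSum hb

lemma summable_norm_altProd (hx : Summable fun i => ‖x i‖) (n : ℕ) :
    Summable fun ℓ : Fin (n + 1) → I => ‖altProd (n + 1) fun i => x (ℓ i)‖ := by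
  induction n with
  | zero =>
    exact ((Equiv.funUnique (Fin 1) I).summable_iff (f := fun i => ‖x i‖)).2 hx
  | succ n ih =>
    have hx' : Summable fun i => ‖altFactor (n + 1) (x i)‖ := by
      simpa only [norm_altFactor] using hx
    refine ((initLastEquiv (n + 1) I).summable_iff.2 (summable_norm_mulL ih hx')).congr fun ℓ => ?_
    rw [altProd_succ]
    rfl

lemma hasSum_altPow (hb : HasSum (fun i => single (g i) (x i)) b) (hx : Summable fun i => ‖x i‖)
    (n : ℕ) : HasSum (fun ℓ : Fin (n + 1) → I =>
      single (altSum fun i => g (ℓ i)) (altProd (n + 1) fun i => x (ℓ i))) (altPow (n + 1) b) := by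
  induction n with
  | zero =>
    refine (((Equiv.funUnique (Fin 1) I).hasSum_iff (f := fun i => single (g i) (x i))).2
      hb).congr_fun
      fun ℓ => ?_
    have e : altSum (fun i : Fin 1 => g (ℓ i)) = g (ℓ 0) := by simp [altSum]
    rw [e]
    rfl
  | succ n ih =>
    have h1 : Summable fun ℓ : Fin (n + 1) → I =>
        ‖single (altSum fun i => g (ℓ i)) (altProd (n + 1) fun i => x (ℓ i))‖ := by
      simpa only [PhaseAlg.norm_single] using summable_norm_altProd hx n
    have h2 : Summable fun i => ‖single ((-1 : ℤ) ^ (n + 1) • g i) (altFactor (n + 1) (x i))‖ := by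
      simpa only [PhaseAlg.norm_single, norm_altFactor] using hx
    have h := hasSum_mulL ih (hasSum_altFactor hb (n + 1)) h1 h2
    rw [altPow_succ]
    refine ((initLastEquiv (n + 1) I).hasSum_iff.2 h).congr_fun fun ℓ => ?_
    simp only [Function.comp_apply, initLastEquiv, Equiv.coe_fn_mk, PhaseAlg.mulL_single]
    rw [altSum_succ]
    rfl

/-- The contribution of a tuple of phases to the limit nonlinearity. -/
def tupleTerm (lam mu : ℝ) (n : ℕ) (Khat : Space d → ℂ) (g : I → Phase d) (x : I → WienerAlg d)
    (ℓ : Fin (n + 2) → I) : WienerAlg d :=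
  (lam : ℂ) • mulL (symb (frozenSymbol Khat (altSum fun i : Fin (n + 1) => g (ℓ i.castSucc)))
      (altProd (n + 1) fun i => x (ℓ i.castSucc))) (x (ℓ (Fin.last (n + 1))))
    + (mu : ℂ) • mulL (altProd (n + 1) fun i => x (ℓ i.castSucc)) (x (ℓ (Fin.last (n + 1))))

/-- The limit nonlinearity of a sum of single-phase functions, expanded over tuples of phases. -/
lemma hasSum_phaseNonlin {Khat : Space d → ℂ} (hK : BddSymbol Khat)
    (hb : HasSum (fun i => single (g i) (x i)) b) (hx : Summable fun i => ‖x i‖)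
    (lam mu : ℝ) (n : ℕ) : HasSum (fun ℓ : Fin (n + 2) → I =>
      single (altSum (fun i : Fin (n + 1) => g (ℓ i.castSucc)) + g (ℓ (Fin.last (n + 1))))
        (tupleTerm lam mu n Khat g x ℓ)) (phaseNonlin lam mu n Khat b) := by
  obtain ⟨Λ, hΛ⟩ := hK.2
  have hA := hasSum_altPow hb hx n
  have hsA : Summable fun ℓ : Fin (n + 1) → I =>
      ‖single (altSum fun i => g (ℓ i)) (altProd (n + 1) fun i => x (ℓ i))‖ := by
    simpa only [PhaseAlg.norm_single] using summable_norm_altProd hx n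
  have hsx : Summable fun i => ‖single (g i) (x i)‖ := by
    simpa only [PhaseAlg.norm_single] using hx
  have hE := (frozenMult Khat).hasSum hA
  have hsE : Summable fun ℓ : Fin (n + 1) → I =>
      ‖frozenMult Khat (single (altSum fun i => g (ℓ i)) (altProd (n + 1) fun i => x (ℓ i)))‖ :=
    Summable.of_nonneg_of_le (fun _ => norm_nonneg _) (fun _ => norm_frozenMult_le hK hΛ _)
      (hsA.mul_left Λ)
  have h := ((hasSum_mulL hE hb hsE hsx).const_smul (lam : ℂ)).add
    ((hasSum_mulL hA hb hsA hsx).const_smul (mu : ℂ))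
  refine ((initLastEquiv (n + 1) I).hasSum_iff.2 h).congr_fun fun ℓ => ?_
  simp only [Function.comp_apply, initLastEquiv, Equiv.coe_fn_mk, frozenMult,
    PhaseAlg.diag_single hK.frozen, PhaseAlg.mulL_single]
  rw [tupleTerm, map_add, map_smul, map_smul]

end

/-- The phases that satisfy the eikonal equation, with wave vectors in `Φ`. -/
def resPhases (η : Fin d → ℤ) (Φ : Set (Fin d → ℤ)) : Set (Phase d) :=
  {γ | γ.1 ∈ Φ ∧ γ.2 = quadForm η γ.1}

/-- The phase with wave vector `k` that satisfies the eikonal equation. -/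
def eikonal (η : Fin d → ℤ) {Φ : Set (Fin d → ℤ)} (k : Φ) : Phase d := (k, quadForm η k)

lemma eikonal_injective (η : Fin d → ℤ) (Φ : Set (Fin d → ℤ)) :
    Function.Injective (eikonal η : Φ → Phase d) := fun _ _ h => Subtype.ext (congrArg Prod.fst h)

lemma range_eikonal (η : Fin d → ℤ) (Φ : Set (Fin d → ℤ)) :
    Set.range (eikonal η : Φ → Phase d) = resPhases η Φ := by
  ext γ
  constructor
  · rintro ⟨k, rfl⟩
    exact ⟨k.2, rfl⟩
  · rintro ⟨h1, h2⟩
    exact ⟨⟨γ.1, h1⟩, Prod.ext rfl h2.symm⟩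

/-- The resonance condition says that the alternating sum of eikonal phases is an eikonal phase. -/
lemma altSum_eikonal_iff {η : Fin d → ℤ} {Φ : Set (Fin d → ℤ)} {n : ℕ} (ℓ : Fin n → Φ)
    (k : Fin d → ℤ) : altSum (fun i => eikonal η (ℓ i)) = (k, quadForm η k) ↔
      Resonant η (fun i => (ℓ i : Fin d → ℤ)) k := by
  rw [altSum, Prod.ext_iff, Prod.fst_sum, Prod.snd_sum]
  rfl

section
variable {η : Fin d → ℤ} {Φ : Set (Fin d → ℤ)}

/-- A multiphase function supported on resonant phases is a family of amplitudes indexed by `Φ`. -/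
lemma hasSum_eikonal {c : PhaseAlg d} (hc : proj (resPhases η Φ) c = c) :
    HasSum (fun k : Φ => single (eikonal η k) (c (eikonal η k))) c := by
  refine ((eikonal_injective η Φ).hasSum_iff (f := fun γ => single γ (c γ)) fun γ hγ => ?_).2
    (PhaseAlg.hasSum_single c)
  rw [range_eikonal] at hγ
  have h0 : coord γ c = 0 := proj_eq_self_iff.1 hc γ hγ
  beta_reduce
  rw [h0, map_zero]

lemma summable_norm_eikonal (c : PhaseAlg d) : Summable fun k : Φ => ‖c (eikonal η k)‖ :=
  c.summable_norm.comp_injective (eikonal_injective η Φ)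

/-- If `Φ` is stable under resonances, then the nonlinearity creates no eikonal phase outside of
`Φ`. -/
lemma phaseNonlin_apply_eq_zero {Khat : Space d → ℂ} (hK : BddSymbol Khat) {n : ℕ}
    (hn : Even (n + 1)) (hΦ : ∀ (ℓ : Fin (n + 2) → Φ) (k : Fin d → ℤ),
      Resonant η (fun i => (ℓ i : Fin d → ℤ)) k → k ∈ Φ) (lam mu : ℝ)
    (c : PhaseAlg d) (hc : proj (resPhases η Φ) c = c) (γ : Phase d) (hγ : γ.2 = quadForm η γ.1)
    (hγS : γ ∉ resPhases η Φ) : phaseNonlin lam mu n Khat c γ = 0 := by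
  have h := (coord γ).hasSum
    (hasSum_phaseNonlin hK (hasSum_eikonal hc) (summable_norm_eikonal c) lam mu n)
  refine h.unique ?_
  refine hasSum_zero.congr_fun fun ℓ => ?_
  refine (PhaseAlg.single_apply _ _ _).trans (if_neg fun h => hγS ⟨?_, hγ⟩)
  refine hΦ ℓ γ.1 ((altSum_eikonal_iff ℓ γ.1).1 ?_)
  rw [altSum_succ, hn.neg_one_pow, one_smul, ← h]
  exact Prod.ext rfl hγ

end

/-! ### The nonlinearities on `L²` -/

lemma toLTwo_altFactor_ae (n : ℕ) (x : WienerAlg d) :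
    (toLTwo (altFactor n x) : Space d → ℂ) =ᵐ[volume]
      fun z => if Even n then toLTwo x z else conj (toLTwo x z) := by
  unfold altFactor
  split_ifs
  · rfl
  · exact WienerAlg.toLTwo_conjL x

lemma alternatingProduct_ae_eq (n : ℕ) (x : Fin (n + 1) → WienerAlg d) :
    alternatingProduct (fun i => toLTwo (x i)) =ᵐ[volume] toLTwo (altProd (n + 1) x) := by
  induction n with
  | zero =>
    refine Eventually.of_forall fun z => ?_
    simp only [alternatingProduct, Nat.reduceAdd, Finset.univ_unique, Fin.default_eq_zero,
      Finset.prod_singleton]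
    rfl
  | succ n ih =>
    rw [altProd_succ]
    filter_upwards [ih fun i => x i.castSucc, WienerAlg.toLTwo_mulL
      (altProd (n + 1) fun i => x i.castSucc) (altFactor (n + 1) (x (Fin.last (n + 1)))),
      toLTwo_altFactor_ae (n + 1) (x (Fin.last (n + 1)))] with z h1 h2 h3
    rw [h2, h3, ← h1]
    simp only [alternatingProduct]
    rw [Fin.prod_univ_castSucc]
    rfl

lemma toL2_alternatingProduct (n : ℕ) (x : Fin (n + 1) → WienerAlg d) :
    toL2 (alternatingProduct fun i => toLTwo (x i)) = toLTwo (altProd (n + 1) x) :=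
  toL2_eq_of_ae_eq (alternatingProduct_ae_eq n x)

lemma prod_range_alternating (u : ℂ) (ν : ℕ) :
    ∏ i ∈ Finset.range (2 * ν), (if Even i then u else conj u) = ((‖u‖ ^ (2 * ν) : ℝ) : ℂ) := by
  induction ν with
  | zero => simp
  | succ ν ih =>
    have h1 : Even (2 * ν) := even_two_mul ν
    have h2 : ¬Even (2 * ν + 1) := by simp
    rw [show 2 * (ν + 1) = 2 * ν + 1 + 1 by ring, Finset.prod_range_succ,
      Finset.prod_range_succ, ih,
      if_pos h1, if_neg h2, mul_assoc, Complex.mul_conj']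
    push_cast
    ring

/-- The alternating power of even order is the power of the modulus. -/
lemma toLTwo_altPow_ae {ν n : ℕ} (hn : 2 * ν = n + 1) (x : WienerAlg d) :
    (toLTwo (altPow (n + 1) x) : Space d → ℂ) =ᵐ[volume]
      fun z => ((‖toLTwo x z‖ ^ (2 * ν) : ℝ) : ℂ) := by
  filter_upwards [alternatingProduct_ae_eq n fun _ => x] with z hz
  rw [altPow, ← hz, ← prod_range_alternating, hn]
  exact (Finset.prod_range fun i => if Even i then toLTwo x z else conj (toLTwo x z)).symm

lemma toL2_norm_pow {ν n : ℕ} (hn : 2 * ν = n + 1) (x : WienerAlg d) :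
    toL2 (fun z => ((‖toLTwo x z‖ ^ (2 * ν) : ℝ) : ℂ)) = toLTwo (altPow (n + 1) x) :=
  toL2_eq_of_ae_eq (toLTwo_altPow_ae hn x).symm

lemma toLTwo_lin_ae (a c : ℂ) (x y : WienerAlg d) :
    (toLTwo (a • x + c • y) : Space d → ℂ) =ᵐ[volume] fun z => a * toLTwo x z + c * toLTwo y z := by
  filter_upwards [WienerAlg.toLTwo_add_ae (a • x) (c • y), WienerAlg.toLTwo_smul_ae a x,
    WienerAlg.toLTwo_smul_ae c y] with z h1 h2 h3
  rw [h1, h2, h3]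

/-- On `W ∩ L²`, the nonlinearity in `L²` is the one given by the algebra structure. -/
lemma nlsNonlinearity_toLTwo {ν n : ℕ} (hn : 2 * ν = n + 1) {Khat : Space d → ℂ}
    (hK : BddSymbol Khat) (lam mu : ℝ) (x : WienerAlg d) :
    nlsNonlinearity ν lam mu Khat (toLTwo x) = toLTwo (wienerNonlin lam mu n Khat x) := by
  refine toL2_eq_of_ae_eq ?_
  rw [toL2_norm_pow hn, ← WienerAlg.toLTwo_symb hK]
  filter_upwards [toLTwo_lin_ae (lam : ℂ) (mu : ℂ) (mulL (symb Khat (altPow (n + 1) x)) x)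
    (mulL (altPow (n + 1) x) x), WienerAlg.toLTwo_mulL (symb Khat (altPow (n + 1) x)) x,
    WienerAlg.toLTwo_mulL (altPow (n + 1) x) x, toLTwo_altPow_ae hn x] with z h1 h2 h3 h4
  rw [wienerNonlin, powerNonlin, h1, h2, h3, h4]
  ring

lemma schrodingerGroup_toLTwo (η : Fin d → ℤ) (ε t : ℝ) (x : WienerAlg d) :
    schrodingerGroup η ε t (toLTwo x) = toLTwo (schro η ε t x) :=
  (WienerAlg.toLTwo_symb (bddSymbol_schro η ε t) x).symm

lemma transportGroup_toLTwo (η k : Fin d → ℤ) (t : ℝ) (x : WienerAlg d) :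
    transportGroup η k t (toLTwo x) = toLTwo (symb (transSymbol η k t) x) :=
  (WienerAlg.toLTwo_symb ⟨measurable_transSymbol η k t, 1, fun _ => (norm_transSymbol ..).le⟩ x).symm

section
variable {η : Fin d → ℤ} {Φ : Set (Fin d → ℤ)} {Khat : Space d → ℂ}

/-- The product of the amplitudes in a tuple. -/
def tupleProd {n : ℕ} (x : Φ → WienerAlg d) (ℓ : Fin (n + 2) → Φ) : WienerAlg d :=
  mulL (altProd (n + 1) fun i => x (ℓ i.castSucc)) (x (ℓ (Fin.last (n + 1))))

/-- The product of the amplitudes in a tuple, with `E` applied to all factors but the last. -/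
def tupleConv {n : ℕ} (Khat : Space d → ℂ) (x : Φ → WienerAlg d) (ℓ : Fin (n + 2) → Φ) :
    WienerAlg d :=
  mulL (symb Khat (altProd (n + 1) fun i => x (ℓ i.castSucc))) (x (ℓ (Fin.last (n + 1))))

lemma summable_tupleProd {n : ℕ} {x : Φ → WienerAlg d} (hx : Summable fun k => ‖x k‖) :
    Summable fun ℓ : Fin (n + 2) → Φ => ‖tupleProd x ℓ‖ := by
  refine ((initLastEquiv (n + 1) Φ).summable_iff.2
    (summable_norm_mulL (summable_norm_altProd hx n) hx)).congr fun ℓ => ?_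
  rw [tupleProd]
  rfl

lemma summable_tupleConv {n : ℕ} (hK : BddSymbol Khat) {x : Φ → WienerAlg d}
    (hx : Summable fun k => ‖x k‖) :
    Summable fun ℓ : Fin (n + 2) → Φ => ‖tupleConv Khat x ℓ‖ := by
  obtain ⟨Λ, hΛ⟩ := hK.2
  have h : Summable fun ℓ : Fin (n + 1) → Φ => ‖symb Khat (altProd (n + 1) fun i => x (ℓ i))‖ :=
    Summable.of_nonneg_of_le (fun _ => norm_nonneg _) (fun _ => WienerAlg.norm_symb_le hK hΛ _)
      ((summable_norm_altProd hx n).mul_left Λ)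
  refine ((initLastEquiv (n + 1) Φ).summable_iff.2 (summable_norm_mulL h hx)).congr fun ℓ => ?_
  rw [tupleConv]
  rfl

/-- The difference of two wave vectors, as a point of the frequency space. -/
def waveDiff (k l : Fin d → ℤ) : Space d := WithLp.toLp 2 fun m => ((k m - l m : ℤ) : ℝ)

open Classical in
/-- The contribution of a resonant tuple: the symbol of `E` is frozen unless the last wave vector is
that of the output. -/
lemma tupleTerm_eq {n : ℕ} (hn : Even (n + 1)) (lam mu : ℝ) (x : Φ → WienerAlg d)
    {ℓ : Fin (n + 2) → Φ} {k : Φ} (hℓ : Resonant η (fun i => (ℓ i : Fin d → ℤ)) k) :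
    tupleTerm lam mu n Khat (eikonal η) x ℓ
      = (lam : ℂ) • (if ℓ (Fin.last (n + 1)) = k then tupleConv Khat x ℓ
          else Khat (waveDiff k (ℓ (Fin.last (n + 1)))) • tupleProd x ℓ)
        + (mu : ℂ) • tupleProd x ℓ := by
  have h1 := congrArg Prod.fst ((altSum_eikonal_iff (η := η) ℓ k).2 hℓ)
  rw [altSum_succ, hn.neg_one_pow, one_smul, Prod.fst_add] at h1
  have h2 : (altSum fun i : Fin (n + 1) => eikonal η (ℓ i.castSucc)).1
      = (k : Fin d → ℤ) - ℓ (Fin.last (n + 1)) := eq_sub_of_add_eq h1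
  rw [tupleTerm, tupleProd]
  congr 2
  split_ifs with h
  · have e : frozenSymbol Khat (altSum fun i : Fin (n + 1) => eikonal η (ℓ i.castSucc)) = Khat := by
      funext ξ
      rw [frozenSymbol, if_pos]
      rw [h2, h, sub_self]
    rw [e, tupleConv]
  · have e : frozenSymbol Khat (altSum fun i : Fin (n + 1) => eikonal η (ℓ i.castSucc))
        = fun _ => Khat (waveDiff k (ℓ (Fin.last (n + 1)))) := by
      funext ξ
      rw [frozenSymbol, if_neg, h2]
      · rfl
      · rw [h2, sub_eq_zero]
        exact fun h' => h (Subtype.ext h'.symm)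
    rw [e, WienerAlg.symb_const, map_smul, smul_apply]

/-- The set of resonant tuples of length `N`. -/
def resTuples (N : ℕ) (η : Fin d → ℤ) (Φ : Set (Fin d → ℤ)) (k : Fin d → ℤ) : Set (Fin N → Φ) :=
  {ℓ | Resonant η (fun i => (ℓ i : Fin d → ℤ)) k}

/-- The amplitudes of the limit nonlinearity, expressed through sums over resonant tuples. -/
lemma phaseNonlin_eikonal {n : ℕ} (hn : Even (n + 1)) (hK : BddSymbol Khat) (lam mu : ℝ)
    {c : PhaseAlg d} {x : Φ → WienerAlg d} (hx : Summable fun k => ‖x k‖)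
    (hc : HasSum (fun k : Φ => single (eikonal η k) (x k)) c) (k : Φ) :
    phaseNonlin lam mu n Khat c (eikonal η k)
      = (lam : ℂ) • (∑' ℓ : {ℓ : resTuples (n + 2) η Φ k // ℓ.1 (Fin.last (n + 1)) = k},
            tupleConv Khat x ℓ.1.1)
        + (lam : ℂ) • (∑' ℓ : {ℓ : resTuples (n + 2) η Φ k // ℓ.1 (Fin.last (n + 1)) ≠ k},
            Khat (waveDiff k (ℓ.1.1 (Fin.last (n + 1)))) • tupleProd x ℓ.1.1)
        + (mu : ℂ) • ∑' ℓ : resTuples (n + 2) η Φ k, tupleProd x ℓ.1 := by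
  classical
  obtain ⟨Λ, hΛ⟩ := hK.2
  set R := resTuples (n + 2) η Φ k
  set F : (Fin (n + 2) → Φ) → WienerAlg d := fun ℓ =>
    if ℓ (Fin.last (n + 1)) = k then tupleConv Khat x ℓ
      else Khat (waveDiff k (ℓ (Fin.last (n + 1)))) • tupleProd x ℓ with hF
  have hP := summable_tupleProd (n := n) hx
  have hFs : Summable F := by
    refine Summable.of_norm_bounded (g := fun ℓ => ‖tupleConv Khat x ℓ‖ + Λ * ‖tupleProd x ℓ‖)
      ((summable_tupleConv hK hx).add (hP.mul_left Λ)) fun ℓ => ?_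
    have hΛ0 : 0 ≤ Λ := (norm_nonneg _).trans (hΛ 0)
    rw [hF]
    beta_reduce
    split_ifs
    · have : 0 ≤ Λ * ‖tupleProd x ℓ‖ := by positivity
      linarith
    · rw [norm_smul]
      have h1 : ‖Khat (waveDiff k (ℓ (Fin.last (n + 1))))‖ * ‖tupleProd x ℓ‖
          ≤ Λ * ‖tupleProd x ℓ‖ := by gcongr; exact hΛ _
      have h2 : 0 ≤ ‖tupleConv Khat x ℓ‖ := norm_nonneg _
      linarith
  have h := (coord (eikonal η k)).hasSum (hasSum_phaseNonlin hK hc hx lam mu n)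
  have e : ∀ ℓ : Fin (n + 2) → Φ, coord (eikonal η k)
      (single (altSum (fun i : Fin (n + 1) => eikonal η (ℓ i.castSucc))
        + eikonal η (ℓ (Fin.last (n + 1)))) (tupleTerm lam mu n Khat (eikonal η) x ℓ))
      = R.indicator (fun ℓ => (lam : ℂ) • F ℓ + (mu : ℂ) • tupleProd x ℓ) ℓ := by
    intro ℓ
    refine (PhaseAlg.single_apply _ _ _).trans ?_
    have hiff : (eikonal η k = altSum (fun i : Fin (n + 1) => eikonal η (ℓ i.castSucc))
        + eikonal η (ℓ (Fin.last (n + 1)))) ↔ ℓ ∈ R := by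
      refine Iff.trans ?_ (altSum_eikonal_iff (η := η) ℓ k)
      have ht := altSum_succ fun i => eikonal η (ℓ i)
      rw [hn.neg_one_pow, one_smul] at ht
      rw [← ht, eq_comm]
      rfl
    by_cases hℓ : ℓ ∈ R
    · rw [if_pos (hiff.2 hℓ), indicator_of_mem hℓ, tupleTerm_eq hn lam mu x hℓ]
    · rw [if_neg (fun h => hℓ (hiff.1 h)), indicator_of_notMem hℓ]
  simp only [e] at h
  have hFR : Summable fun ℓ : R => F ℓ.1 := hFs.subtype R
  have hPR : Summable fun ℓ : R => tupleProd x ℓ.1 := hP.of_norm.subtype R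
  have h3 := (hFR.hasSum.const_smul (lam : ℂ)).add (hPR.hasSum.const_smul (mu : ℂ))
  have h4 := (hasSum_subtype_iff_indicator.2 h).unique h3
  refine h4.trans ?_
  congr 1
  rw [← smul_add]
  congr 1
  have h5 := Summable.tsum_add_tsum_compl (s := {ℓ : R | ℓ.1 (Fin.last (n + 1)) = k})
    (hFR.subtype _) (hFR.subtype _)
  refine h5.symm.trans ?_
  congr 1
  · refine tsum_congr fun ℓ => ?_
    have := ℓ.2
    rw [Set.mem_ofPred_eq] at this
    rw [hF]
    beta_reduce
    rw [if_pos this]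
  · refine tsum_congr fun ℓ => ?_
    have : ¬ ℓ.1.1 (Fin.last (n + 1)) = k := ℓ.2
    rw [hF]
    beta_reduce
    rw [if_neg this]

end

/-! ### The transport system and multiphase functions -/

section
variable {η : Fin d → ℤ} {Φ : Set (Fin d → ℤ)} {Khat : Space d → ℂ}

lemma toL2_tupleProd {n : ℕ} (hn : Even (n + 1)) (x : Φ → WienerAlg d) (ℓ : Fin (n + 2) → Φ) :
    toL2 (alternatingProduct fun i => toLTwo (x (ℓ i))) = toLTwo (tupleProd x ℓ) := by
  rw [toL2_alternatingProduct (n + 1) fun i => x (ℓ i), altProd_succ, altFactor, if_pos hn]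
  rfl

lemma toL2_tupleConv {n : ℕ} (hK : BddSymbol Khat) (x : Φ → WienerAlg d) (ℓ : Fin (n + 2) → Φ)
    {k : Φ} (hk : ℓ (Fin.last (n + 1)) = k) :
    toL2 (fun z => multiplier Khat
      (toL2 (alternatingProduct fun i : Fin (n + 1) => toLTwo (x (ℓ i.castSucc)))) z
        * toLTwo (x k) z) = toLTwo (tupleConv Khat x ℓ) := by
  rw [toL2_alternatingProduct n fun i => x (ℓ i.castSucc), ← WienerAlg.toLTwo_symb hK, ← hk]
  exact toL2_eq_of_ae_eq (WienerAlg.toLTwo_mulL _ _).symm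

/-- The right-hand side of the transport system is given by the amplitudes of the limit
nonlinearity. -/
lemma transportNonlinearity_toLTwo {ν n : ℕ} (hn : 2 * ν = n + 1) (hK : BddSymbol Khat)
    (lam mu : ℝ) {c : PhaseAlg d} {x : Φ → WienerAlg d} (hx : Summable fun k => ‖x k‖)
    (hc : HasSum (fun k : Φ => single (eikonal η k) (x k)) c) (k : Φ) :
    transportNonlinearity ν lam mu η Khat (fun l => toLTwo (x l)) k
      = toLTwo (-Complex.I • phaseNonlin lam mu n Khat c (eikonal η k)) := by
  have hev : Even (n + 1) := hn ▸ even_two_mul ν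
  unfold transportNonlinearity resonantTuples
  generalize 2 * ν = N at hn
  subst hn
  have hP := (summable_tupleProd (n := n) hx).of_norm
  have hC := (summable_tupleConv (n := n) hK hx).of_norm
  obtain ⟨Λ, hΛ⟩ := hK.2
  have hP' : Summable fun ℓ : Fin (n + 2) → Φ =>
      Khat (waveDiff k (ℓ (Fin.last (n + 1)))) • tupleProd x ℓ := by
    refine Summable.of_norm_bounded ((summable_tupleProd (n := n) hx).mul_left Λ) fun ℓ => ?_
    rw [norm_smul]
    gcongr
    exact hΛ _
  have e1 : ∑' ℓ : {ℓ : resTuples (n + 2) η Φ k // ℓ.1 (Fin.last (n + 1)) = k},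
      toL2 (fun z => multiplier Khat (toL2 (alternatingProduct fun i : Fin (n + 1) =>
        toLTwo (x (ℓ.1.1 i.castSucc)))) z * toLTwo (x k) z)
      = toLTwo (∑' ℓ : {ℓ : resTuples (n + 2) η Φ k // ℓ.1 (Fin.last (n + 1)) = k},
          tupleConv Khat x ℓ.1.1) := by
    refine Eq.trans ?_ (toLTwo.map_tsum ((hC.subtype (resTuples (n + 2) η Φ k)).subtype
      {ℓ | ℓ.1 (Fin.last (n + 1)) = k})).symm
    exact tsum_congr fun ℓ => toL2_tupleConv hK x ℓ.1.1 ℓ.2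
  have e2 : ∑' ℓ : {ℓ : resTuples (n + 2) η Φ k // ℓ.1 (Fin.last (n + 1)) ≠ k},
      Khat (waveDiff k (ℓ.1.1 (Fin.last (n + 1)))) •
        toL2 (alternatingProduct fun i => toLTwo (x (ℓ.1.1 i)))
      = toLTwo (∑' ℓ : {ℓ : resTuples (n + 2) η Φ k // ℓ.1 (Fin.last (n + 1)) ≠ k},
          Khat (waveDiff k (ℓ.1.1 (Fin.last (n + 1)))) • tupleProd x ℓ.1.1) := by
    refine Eq.trans ?_ (toLTwo.map_tsum ((hP'.subtype (resTuples (n + 2) η Φ k)).subtype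
      {ℓ | ℓ.1 (Fin.last (n + 1)) ≠ k})).symm
    refine tsum_congr fun ℓ => ?_
    rw [toL2_tupleProd hev]
    exact (map_smul toLTwo _ _).symm
  have e3 : ∑' ℓ : resTuples (n + 2) η Φ k, toL2 (alternatingProduct fun i => toLTwo (x (ℓ.1 i)))
      = toLTwo (∑' ℓ : resTuples (n + 2) η Φ k, tupleProd x ℓ.1) := by
    refine Eq.trans ?_ (toLTwo.map_tsum (hP.subtype (resTuples (n + 2) η Φ k))).symm
    exact tsum_congr fun ℓ => toL2_tupleProd hev x ℓ.1
  have h : coord (eikonal η k) (phaseNonlin lam mu n Khat c) = _ :=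
    phaseNonlin_eikonal (η := η) hev hK lam mu hx hc k
  beta_reduce
  rw [h, smul_add, smul_add, map_add, map_add, smul_smul, smul_smul, smul_smul, map_smul, map_smul,
    map_smul, ← e1, ← e2, ← e3, neg_mul, neg_mul, sub_eq_add_neg, sub_eq_add_neg, ← neg_smul,
    ← neg_smul]
  rfl

lemma norm_eq_tsum_eikonal {c : PhaseAlg d} (hc : proj (resPhases η Φ) c = c) :
    ‖c‖ = ∑' k : Φ, ‖c (eikonal η k)‖ := by
  rw [PhaseAlg.norm_eq_tsum]
  refine ((eikonal_injective η Φ).tsum_eq (f := fun γ => ‖c γ‖) fun γ hγ => ?_).symm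
  rw [range_eikonal]
  by_contra h
  exact hγ (by
    have h0 : coord γ c = 0 := proj_eq_self_iff.1 hc γ h
    beta_reduce
    rw [h0, norm_zero])

/-- The norm of `PhaseAlg` is the norm of the space `X` of families of amplitudes. -/
lemma profileNorm_toLTwo {c : PhaseAlg d} (hc : proj (resPhases η Φ) c = c) :
    profileNorm (fun k : Φ => toLTwo (c (eikonal η k))) = ‖c‖ₑ := by
  unfold profileNorm
  simp only [WienerAlg.wienerL2Norm_toLTwo]
  rw [← ofReal_norm, norm_eq_tsum_eikonal hc,
    ENNReal.ofReal_tsum_of_nonneg (fun _ => norm_nonneg _) (summable_norm_eikonal c)]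
  simp only [ofReal_norm]

/-- The multiphase function with given amplitudes. -/
lemma exists_hasSum_eikonal (η : Fin d → ℤ) {x : Φ → WienerAlg d} (hx : Summable fun k => ‖x k‖) :
    ∃ c : PhaseAlg d, proj (resPhases η Φ) c = c ∧ ∀ k : Φ, c (eikonal η k) = x k := by
  classical
  have hs : Summable fun k : Φ => single (eikonal η k) (x k) :=
    Summable.of_norm (by simpa only [PhaseAlg.norm_single] using hx)
  have happ : ∀ γ : Phase d, HasSum (fun k : Φ => if γ = eikonal η k then x k else 0)
      (coord γ (∑' k : Φ, single (eikonal η k) (x k))) := fun γ =>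
    ((coord γ).hasSum hs.hasSum).congr_fun fun k => (PhaseAlg.single_apply _ _ _).symm
  refine ⟨∑' k : Φ, single (eikonal η k) (x k), proj_eq_self_iff.2 fun γ hγ => ?_, fun k => ?_⟩
  · refine (happ γ).unique (hasSum_zero.congr_fun fun k => if_neg ?_)
    rintro rfl
    exact hγ ((range_eikonal η Φ).subset (Set.mem_range_self k))
  · refine (happ (eikonal η k)).unique ?_
    convert! hasSum_ite_eq k (x k) using 2 with l
    by_cases h : l = k
    · subst h; simp
    · rw [if_neg h, if_neg fun h' => h (eikonal_injective η Φ h').symm]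

/-- A family of amplitudes with finite profile norm comes from a multiphase function. -/
lemma exists_lift (η : Fin d → ℤ) {A : Φ → L2 d} (hA : profileNorm A < ∞) :
    ∃ c : PhaseAlg d, proj (resPhases η Φ) c = c ∧ ∀ k : Φ, toLTwo (c (eikonal η k)) = A k := by
  have h1 : ∀ k : Φ, ∃ x, toLTwo x = A k := fun k =>
    WienerAlg.exists_toLTwo_eq ((ENNReal.le_tsum k).trans_lt hA)
  choose x hx using h1
  have hs : Summable fun k => ‖x k‖ := by
    have h2 : ∑' k, ‖x k‖ₑ ≠ ∞ := by
      refine ne_of_lt (lt_of_eq_of_lt ?_ hA)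
      unfold profileNorm
      exact tsum_congr fun k => by rw [← hx, WienerAlg.wienerL2Norm_toLTwo]
    simpa using ENNReal.summable_toReal h2
  obtain ⟨c, hc, hc'⟩ := exists_hasSum_eikonal η hs
  exact ⟨c, hc, fun k => by rw [hc' k, hx]⟩

lemma ext_of_proj {S : Set (Phase d)} {x y : PhaseAlg d} (hx : proj S x = x) (hy : proj S y = y)
    (h : ∀ γ ∈ S, x γ = y γ) : x = y := by
  refine PhaseAlg.ext fun γ => ?_
  by_cases hγ : γ ∈ S
  · exact h γ hγ
  · exact (proj_eq_self_iff.1 hx γ hγ).trans (proj_eq_self_iff.1 hy γ hγ).symm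

/-- Duhamel's formula for the transport system is Duhamel's formula for multiphase functions, read
amplitude by amplitude. -/
lemma phaseProfile_duhamel_iff {ν n : ℕ} (hn : 2 * ν = n + 1) (hK : BddSymbol Khat) (lam mu : ℝ)
    {b₀ x : PhaseAlg d} {b : ℝ → PhaseAlg d} (hb₀ : proj (resPhases η Φ) b₀ = b₀)
    (hx : proj (resPhases η Φ) x = x) (hb : Continuous b) {t : ℝ} (ht : 0 ≤ t)
    (hbs : ∀ τ ∈ Icc 0 t, proj (resPhases η Φ) (b τ) = b τ) :
    (x = trans η t b₀ + ∫ τ in (0 : ℝ)..t, trans η (t - τ)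
        (-Complex.I • proj (resPhases η Φ) (phaseNonlin lam mu n Khat (b τ)))) ↔
      ∀ k : Φ, toLTwo (x (eikonal η k))
        = transportGroup η k t (toLTwo (b₀ (eikonal η k))) + ∫ τ in (0 : ℝ)..t,
          transportGroup η k (t - τ) (transportNonlinearity ν lam mu η Khat
            (fun l => toLTwo (b τ (eikonal η l))) k) := by
  classical
  set S := resPhases η Φ
  have hc : Continuous fun τ => trans η (t - τ)
      (-Complex.I • proj S (phaseNonlin lam mu n Khat (b τ))) :=
    (isContractionGroup_trans η).continuous_apply (by fun_prop)
      ((continuous_neg_I_proj lam mu n Khat S).comp hb)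
  set y := trans η t b₀ + ∫ τ in (0 : ℝ)..t, trans η (t - τ)
        (-Complex.I • proj S (phaseNonlin lam mu n Khat (b τ))) with hy
  have hyS : proj S y = y := by
    rw [hy, map_add, proj_trans, hb₀, ← (proj S).intervalIntegral_comp_comm
      (hc.intervalIntegrable _ _)]
    simp only [proj_trans, map_smul, proj_proj]
  have htr : ∀ (k : Φ) (s : ℝ) (z : PhaseAlg d), coord (eikonal η k) (trans η s z)
      = symb (transSymbol η k s) (coord (eikonal η k) z) := fun k s z =>
    PhaseAlg.diag_apply (phaseSymbol_trans η s) z (eikonal η k)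
  have hyk : ∀ k : Φ, toLTwo (coord (eikonal η k) y)
      = transportGroup η k t (toLTwo (b₀ (eikonal η k))) + ∫ τ in (0 : ℝ)..t,
          transportGroup η k (t - τ) (transportNonlinearity ν lam mu η Khat
            (fun l => toLTwo (b τ (eikonal η l))) k) := by
    intro k
    rw [hy, map_add, map_add, htr, ← transportGroup_toLTwo]
    congr 1
    have h1 := (toLTwo.comp (coord (eikonal η k))).intervalIntegral_comp_comm
      (hc.intervalIntegrable (μ := volume) 0 t)
    refine h1.symm.trans (intervalIntegral.integral_congr fun τ hτ => ?_)
    rw [uIcc_of_le ht] at hτ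
    beta_reduce
    rw [ContinuousLinearMap.comp_apply, htr, ← transportGroup_toLTwo,
      transportNonlinearity_toLTwo hn hK lam mu (summable_norm_eikonal (b τ))
        (hasSum_eikonal (hbs τ hτ)) k, map_smul]
    congr 3
    refine (proj_apply S _ _).trans (if_pos ?_)
    exact (range_eikonal η Φ).subset (Set.mem_range_self k)
  constructor
  · intro h k
    rw [← hyk k, h]
  · intro h
    refine ext_of_proj hx hyS fun γ hγ => ?_
    obtain ⟨k, rfl⟩ : γ ∈ Set.range (eikonal η : Φ → Phase d) := by rwa [range_eikonal]
    exact WienerAlg.toLTwo_injective ((h k).trans (hyk k).symm)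

lemma tendsto_enorm_sub {B : Type*} [NormedAddCommGroup B] {b : ℝ → B} {s : Set ℝ} {t : ℝ}
    (hb : Continuous b) : Tendsto (fun r => ‖b r - b t‖ₑ) (𝓝[s] t) (𝓝 0) := by
  have h : Continuous fun r => ‖b r - b t‖ₑ := (hb.sub continuous_const).enorm
  have := h.tendsto t
  rw [sub_self, enorm_zero] at this
  exact this.mono_left nhdsWithin_le_nhds

/-- The amplitudes of a multiphase solution solve the transport system. -/
lemma IsPhaseProfile.isProfile {ν n : ℕ} (hn : 2 * ν = n + 1) (hK : BddSymbol Khat) {lam mu T : ℝ}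
    {b₀ : PhaseAlg d} {b : ℝ → PhaseAlg d}
    (hb : IsPhaseProfile lam mu n η Khat (resPhases η Φ) T b₀ b) (hT : 0 ≤ T)
    (hb₀ : proj (resPhases η Φ) b₀ = b₀) {α : (Fin d → ℤ) → L2 d}
    (hα : ∀ k : Φ, α k = toLTwo (b₀ (eikonal η k))) :
    IsProfile ν lam mu η Khat α T (fun t (k : Φ) => toLTwo (b t (eikonal η k))) where
  continuous t ht := by
    refine ⟨by rw [profileNorm_toLTwo (hb.proj_eq hb₀ t ht)]; exact enorm_lt_top, ?_⟩
    refine (tendsto_enorm_sub hb.cont).congr' ?_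
    filter_upwards [self_mem_nhdsWithin] with s hs
    have hsub : proj (resPhases η Φ) (b s - b t) = b s - b t := by
      rw [map_sub, hb.proj_eq hb₀ s hs, hb.proj_eq hb₀ t ht]
    rw [← profileNorm_toLTwo hsub]
    congr 1
    ext1 k
    beta_reduce
    rw [map_sub, map_sub]
    rfl
  init k := by
    have h := hb.duhamel 0 ⟨le_rfl, hT⟩
    rw [trans_zero, intervalIntegral.integral_same, add_zero] at h
    beta_reduce
    rw [h, hα]
  duhamel t ht k := by
    rw [hα]
    exact (phaseProfile_duhamel_iff hn hK lam mu hb₀ (hb.proj_eq hb₀ t ht) hb.cont ht.1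
      fun τ hτ => hb.proj_eq hb₀ τ ⟨hτ.1, hτ.2.trans ht.2⟩).1 (hb.duhamel t ht) k

lemma continuousOn_lift {T : ℝ} {a : ℝ → Φ → L2 d} (ha : ContinuousInNorm profileNorm T a)
    {L : ℝ → PhaseAlg d} (hL : ∀ t ∈ Icc 0 T, proj (resPhases η Φ) (L t) = L t ∧
      ∀ k : Φ, toLTwo (L t (eikonal η k)) = a t k) : ContinuousOn L (Icc 0 T) := by
  intro t ht
  have h2 := (ha t ht).2
  refine tendsto_iff_norm_sub_tendsto_zero.2 ?_
  have h3 : Tendsto (fun s => ‖L s - L t‖ₑ) (𝓝[Icc 0 T] t) (𝓝 0) := by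
    refine h2.congr' ?_
    filter_upwards [self_mem_nhdsWithin] with s hs
    have hsub : proj (resPhases η Φ) (L s - L t) = L s - L t := by
      rw [map_sub, (hL s hs).1, (hL t ht).1]
    rw [← profileNorm_toLTwo hsub]
    congr 1
    ext1 k
    rw [Pi.sub_apply, ← (hL s hs).2, ← (hL t ht).2, ← map_sub]
    rfl
  have h4 := (ENNReal.tendsto_toReal ENNReal.zero_ne_top).comp h3
  simpa [Function.comp_def] using h4

/-- Converse of `IsPhaseProfile.isProfile`. -/
lemma IsProfile.isPhaseProfile {ν n : ℕ} (hn : 2 * ν = n + 1) (hK : BddSymbol Khat)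
    {lam mu T : ℝ} {b₀ : PhaseAlg d} (hb₀ : proj (resPhases η Φ) b₀ = b₀)
    {α : (Fin d → ℤ) → L2 d} (hα : ∀ k : Φ, α k = toLTwo (b₀ (eikonal η k)))
    {a : ℝ → Φ → L2 d} (ha : IsProfile ν lam mu η Khat α T a) {b : ℝ → PhaseAlg d}
    (hb : Continuous b) (hbS : ∀ t, proj (resPhases η Φ) (b t) = b t)
    (hab : ∀ t ∈ Icc 0 T, a t = fun k => toLTwo (b t (eikonal η k))) :
    IsPhaseProfile lam mu n η Khat (resPhases η Φ) T b₀ b := by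
  refine ⟨hb, fun t ht => ?_⟩
  refine (phaseProfile_duhamel_iff hn hK lam mu hb₀ (hbS t) hb ht.1 fun τ _ => hbS τ).2 fun k => ?_
  have h1 : toLTwo (b t (eikonal η k)) = a t k := (congrFun (hab t ht) k).symm
  have h2 : ∫ τ in (0 : ℝ)..t,
        transportGroup η k (t - τ) (transportNonlinearity ν lam mu η Khat (a τ) k)
      = ∫ τ in (0 : ℝ)..t, transportGroup η k (t - τ) (transportNonlinearity ν lam mu η Khat
          (fun l => toLTwo (b τ (eikonal η l))) k) := by
    refine intervalIntegral.integral_congr fun τ hτ => ?_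
    rw [uIcc_of_le ht.1] at hτ
    beta_reduce
    rw [hab τ ⟨hτ.1, hτ.2.trans ht.2⟩]
  rw [h1, ha.duhamel t ht k, h2, hα k]

/-- Every solution of the transport system is given by a multiphase function, which can be taken
constant in time outside of `[0, T]`. -/
lemma IsProfile.exists_isPhaseProfile {ν n : ℕ} (hn : 2 * ν = n + 1) (hK : BddSymbol Khat)
    {lam mu T : ℝ} (hT : 0 ≤ T) {b₀ : PhaseAlg d} (hb₀ : proj (resPhases η Φ) b₀ = b₀)
    {α : (Fin d → ℤ) → L2 d} (hα : ∀ k : Φ, α k = toLTwo (b₀ (eikonal η k)))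
    {a : ℝ → Φ → L2 d} (ha : IsProfile ν lam mu η Khat α T a) :
    ∃ b : ℝ → PhaseAlg d, IsPhaseProfile lam mu n η Khat (resPhases η Φ) T b₀ b ∧
      (∀ t, proj (resPhases η Φ) (b t) = b t) ∧
      ∀ t ∈ Icc 0 T, a t = fun k => toLTwo (b t (eikonal η k)) := by
  have h1 : ∀ t : ℝ, ∃ c : PhaseAlg d, t ∈ Icc 0 T → proj (resPhases η Φ) c = c ∧
      ∀ k : Φ, toLTwo (c (eikonal η k)) = a t k := fun t => by
    by_cases ht : t ∈ Icc 0 T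
    · obtain ⟨c, hc⟩ := exists_lift η (ha.continuous t ht).1
      exact ⟨c, fun _ => hc⟩
    · exact ⟨0, fun h => absurd h ht⟩
  choose L hL using h1
  have hLc := continuousOn_lift ha.continuous hL
  obtain ⟨p, hpc, hpm, hpe⟩ := exists_clamp hT
  have hbc : Continuous fun t => L (p t) := hLc.comp_continuous hpc hpm
  have hbS : ∀ t, proj (resPhases η Φ) (L (p t)) = L (p t) := fun t => (hL _ (hpm t)).1
  have hab : ∀ t ∈ Icc 0 T, a t = fun k => toLTwo (L (p t) (eikonal η k)) := fun t ht => by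
    rw [hpe t ht]
    exact funext fun k => ((hL t ht).2 k).symm
  exact ⟨fun t => L (p t), ha.isPhaseProfile hn hK hb₀ hα hbc hbS hab, hbS, hab⟩

end

/-! ### Multiphase functions in `L²` -/

lemma fourierChar_freq (ε : ℝ) (κ : Fin d → ℤ) (z : Space d) :
    (Real.fourierChar (inner ℝ (freq ε κ) z) : ℂ)
      = Complex.exp (((∑ m, (κ m : ℝ) * z m) / ε : ℝ) * Complex.I) := by
  rw [Real.fourierChar_apply]
  congr 2
  norm_cast
  have hpi := Real.pi_ne_zero
  simp only [PiLp.inner_apply, freq, RCLike.inner_apply, conj_trivial]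
  rw [Finset.mul_sum, Finset.sum_div]
  refine Finset.sum_congr rfl fun m _ => ?_
  rcases eq_or_ne ε 0 with rfl | hε
  · simp
  · field_simp

lemma toLTwo_wave (ε t : ℝ) (γ : Phase d) (x : WienerAlg d) :
    (toLTwo (PhaseAlg.wave ε t γ x) : Space d → ℂ) =ᵐ[volume] fun z => toLTwo x z *
      Complex.exp (Complex.I * (((∑ m, (γ.1 m : ℝ) * z m - t / 2 * (γ.2 : ℝ)) / ε : ℝ) : ℂ)) := by
  filter_upwards [WienerAlg.toLTwo_smul_ae (timeFactor ε t γ) (shift (freq ε γ.1) x),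
    WienerAlg.toLTwo_shift (freq ε γ.1) x] with z h1 h2
  rw [PhaseAlg.wave, h1, h2, fourierChar_freq, timeFactor, ← mul_assoc, ← Complex.exp_add, mul_comm]
  congr 2
  rw [← add_mul, mul_comm]
  congr 1
  norm_cast
  rw [sub_div, neg_add_eq_sub]
  congr 1
  rw [div_mul_eq_mul_div, div_div, mul_comm t]

/-- The approximate solution is the evaluation of the profile. -/
lemma approxSolution_eq {η : Fin d → ℤ} {Φ : Set (Fin d → ℤ)} {a : ℝ → Φ → L2 d} {ε t : ℝ}
    {c : PhaseAlg d} (hc : proj (resPhases η Φ) c = c)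
    (ha : a t = fun k => toLTwo (c (eikonal η k))) :
    approxSolution η a ε t = toLTwo (ev ε t c) := by
  have h := (toLTwo.comp (ev ε t)).hasSum (hasSum_eikonal hc)
  rw [ContinuousLinearMap.comp_apply] at h
  rw [← h.tsum_eq, approxSolution]
  refine tsum_congr fun k => ?_
  rw [ContinuousLinearMap.comp_apply, PhaseAlg.ev_single, ha]
  refine toL2_eq_of_ae_eq ?_
  filter_upwards [toLTwo_wave ε t (eikonal η k) (c (eikonal η k))] with z hz
  rw [hz, phase, eikonal, quadForm]
  push_cast
  rfl

/-! ### The initial data -/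

lemma fourier_laplacian_apply (f : 𝓢(Space d, ℂ)) (ξ : Space d) :
    (𝓕 (Δ f) : 𝓢(Space d, ℂ)) ξ
      = -((∑ m, (2 * Real.pi * ξ m) ^ 2 : ℝ) : ℂ) * (𝓕 f : 𝓢(Space d, ℂ)) ξ := by
  have hg : Function.HasTemperateGrowth (fun x : Space d => ‖x‖ ^ 2) := by fun_prop
  rw [SchwartzMap.laplacian_eq_fourierMultiplierCLM, FourierTransform.fourier_smul,
    SchwartzMap.fourierMultiplierCLM_apply, FourierTransform.fourier_fourierInv_eq,
    _root_.smul_apply, SchwartzMap.smulLeftCLM_apply_apply hg, EuclideanSpace.real_norm_sq_eq,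
    smul_smul, Complex.real_smul]
  congr 1
  norm_cast
  rw [neg_mul, Finset.mul_sum]
  congr 1
  exact Finset.sum_congr rfl fun m _ => by ring

/-- Schwartz functions as elements of `W ∩ L²`. -/
def ofSchwartz (f : 𝓢(Space d, ℂ)) : WienerAlg d :=
  WienerAlg.mk (𝓕 f : 𝓢(Space d, ℂ)) ((𝓕 f).memLp 1) ((𝓕 f).memLp 2)

lemma toLTwo_ofSchwartz (f : 𝓢(Space d, ℂ)) : toLTwo (ofSchwartz f) = f.toLp 2 := by
  rw [WienerAlg.toLTwo_def, ofSchwartz, WienerAlg.ftL2_mk]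
  have h : ((𝓕 f).memLp 2).toLp (𝓕 f : 𝓢(Space d, ℂ)) = (𝓕 f).toLp 2 := rfl
  rw [h, ← SchwartzMap.toLp_fourier_eq, FourierTransform.fourierInv_fourier_eq]

lemma enorm_ofSchwartz (f : 𝓢(Space d, ℂ)) : ‖ofSchwartz f‖ₑ
    = eLpNorm (𝓕 f : 𝓢(Space d, ℂ)) 1 volume + eLpNorm (𝓕 f : 𝓢(Space d, ℂ)) 2 volume :=
  WienerAlg.enorm_mk _ _

/-- The weighted norm of a smooth amplitude is controlled by the amplitude and its Laplacian. -/
lemma norm_weight_ofSchwartz_le {M : ℝ} (hM : 0 ≤ M) (γ : Phase d) (f : 𝓢(Space d, ℂ)) :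
    ‖symb (weight M γ) (ofSchwartz f)‖
      ≤ (1 + ∑ m, (γ.1 m : ℝ) ^ 2) * ‖ofSchwartz f‖ + ‖ofSchwartz (Δ f)‖ := by
  set c : ℝ := 1 + ∑ m, (γ.1 m : ℝ) ^ 2 with hc
  have hc0 : 0 ≤ c := by positivity
  have key : ∀ p : ℝ≥0∞, 1 ≤ p → eLpNorm (ft (symb (weight M γ) (ofSchwartz f))) p volume
      ≤ ENNReal.ofReal c * eLpNorm (ft (ofSchwartz f)) p volume
        + eLpNorm (ft (ofSchwartz (Δ f))) p volume := by
    intro p hp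
    have e : ENNReal.ofReal c * eLpNorm (ft (ofSchwartz f)) p volume
        = eLpNorm (fun ξ => c * ‖ft (ofSchwartz f) ξ‖) p volume := by
      have h1 := eLpNorm_const_smul (μ := (volume : Measure (Space d))) (p := p) c
        (fun ξ => ‖ft (ofSchwartz f) ξ‖)
      rw [eLpNorm_norm] at h1
      refine Eq.trans ?_ h1.symm
      rw [← ofReal_norm, Real.norm_of_nonneg hc0]
    rw [e, ← eLpNorm_norm (ft (ofSchwartz (Δ f)))]
    refine le_trans ?_ (eLpNorm_add_le
      ((ofSchwartz f).memLp_two_ft.1.norm.const_mul c) (ofSchwartz (Δ f)).memLp_two_ft.1.norm hp)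
    refine eLpNorm_mono_ae ?_
    filter_upwards [WienerAlg.ft_symb ((phaseSymbol_weight hM).bdd γ) (ofSchwartz f),
      WienerAlg.ft_mk ((𝓕 f).memLp 1) ((𝓕 f).memLp 2),
      WienerAlg.ft_mk ((𝓕 (Δ f)).memLp 1) ((𝓕 (Δ f)).memLp 2)] with ξ h1 h2 h3
    rw [h1, norm_mul, norm_weight hM, Pi.add_apply, ofSchwartz, ofSchwartz, h2, h3,
      fourier_laplacian_apply, norm_mul, norm_neg, Complex.norm_real]
    have h4 : 0 ≤ ∑ m, (2 * Real.pi * ξ m) ^ 2 := Finset.sum_nonneg fun _ _ => sq_nonneg _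
    rw [Real.norm_of_nonneg h4, ← add_mul, Real.norm_of_nonneg (by positivity)]
    gcongr
    exact min_le_left _ _
  have h : ‖symb (weight M γ) (ofSchwartz f)‖ₑ
      ≤ ENNReal.ofReal (c * ‖ofSchwartz f‖ + ‖ofSchwartz (Δ f)‖) := by
    rw [ENNReal.ofReal_add (by positivity) (by positivity), ENNReal.ofReal_mul hc0, ofReal_norm,
      ofReal_norm, WienerAlg.enorm_eq, WienerAlg.enorm_eq, WienerAlg.enorm_eq (ofSchwartz (Δ f)),
      mul_add, add_add_add_comm]
    exact add_le_add (key 1 le_rfl) (key 2 one_le_two)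
  rw [← ofReal_norm] at h
  exact (ENNReal.ofReal_le_ofReal_iff (by positivity)).1 h

section
variable {J₀ : Set ℕ} {κ : J₀ → Fin d → ℤ} {α : J₀ → 𝓢(Space d, ℂ)} {η : Fin d → ℤ}
  {Φ : Set (Fin d → ℤ)}

lemma SummableAmplitudes.summable (hα : SummableAmplitudes κ α) :
    Summable fun j => (1 + ∑ m, (κ j m : ℝ) ^ 2) * ‖ofSchwartz (α j)‖ + ‖ofSchwartz (Δ (α j))‖ := by
  unfold SummableAmplitudes at hα
  have h1 := (ENNReal.add_lt_top.1 hα).1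
  have h2 := (ENNReal.add_lt_top.1 hα).2
  refine Summable.add ?_ ?_
  · have h3 := ENNReal.summable_toReal h1.ne
    refine h3.congr fun j => ?_
    rw [← enorm_ofSchwartz, ENNReal.toReal_mul, ENNReal.toReal_ofReal (by positivity), toReal_enorm]
  · have h3 := ENNReal.summable_toReal h2.ne
    refine h3.congr fun j => ?_
    rw [← enorm_ofSchwartz, toReal_enorm]

lemma SummableAmplitudes.summable_norm (hα : SummableAmplitudes κ α) :
    Summable fun j => ‖ofSchwartz (α j)‖ := by
  refine Summable.of_nonneg_of_le (fun _ => norm_nonneg _) (fun j => ?_) hα.summable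
  have h1 : 0 ≤ ∑ m, (κ j m : ℝ) ^ 2 := by positivity
  have h2 : 0 ≤ ‖ofSchwartz (Δ (α j))‖ := norm_nonneg _
  have h3 : 0 ≤ ‖ofSchwartz (α j)‖ := norm_nonneg _
  nlinarith

/-- The multiphase function that gives the initial data. -/
def initialPhase (η : Fin d → ℤ) (κ : J₀ → Fin d → ℤ) (α : J₀ → 𝓢(Space d, ℂ)) : PhaseAlg d :=
  ∑' j, single (κ j, quadForm η (κ j)) (ofSchwartz (α j))

lemma SummableAmplitudes.hasSum_initialPhase (hα : SummableAmplitudes κ α) (η : Fin d → ℤ) :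
    HasSum (fun j => single (κ j, quadForm η (κ j)) (ofSchwartz (α j))) (initialPhase η κ α) :=
  (Summable.of_norm (by simpa only [PhaseAlg.norm_single] using hα.summable_norm)).hasSum

/-- The summability of the initial amplitudes is what bounds the weighted norm of the multiphase
initial datum. -/
lemma SummableAmplitudes.weightBound (hα : SummableAmplitudes κ α) (η : Fin d → ℤ) :
    ∃ Y, WeightBound Y (initialPhase η κ α) := by
  refine ⟨∑' j, ((1 + ∑ m, (κ j m : ℝ) ^ 2) * ‖ofSchwartz (α j)‖ + ‖ofSchwartz (Δ (α j))‖),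
    fun M hM => ?_⟩
  have h := (diag (weight M)).hasSum (hα.hasSum_initialPhase η)
  rw [← h.tsum_eq]
  refine tsum_of_norm_bounded hα.summable.hasSum fun j => ?_
  rw [PhaseAlg.diag_single (phaseSymbol_weight hM), PhaseAlg.norm_single]
  exact norm_weight_ofSchwartz_le hM _ _

lemma SummableAmplitudes.proj_initialPhase (hα : SummableAmplitudes κ α)
    (hΦ : ∀ j, κ j ∈ Φ) : proj (resPhases η Φ) (initialPhase η κ α) = initialPhase η κ α := by
  refine proj_eq_self_iff.2 fun γ hγ => ?_
  refine ((coord γ).hasSum (hα.hasSum_initialPhase η)).unique (hasSum_zero.congr_fun fun j => ?_)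
  refine (PhaseAlg.single_apply _ _ _).trans (if_neg ?_)
  rintro rfl
  exact hγ ⟨hΦ j, rfl⟩

lemma SummableAmplitudes.initialAmplitude_eq (hα : SummableAmplitudes κ α) (η : Fin d → ℤ)
    (k : Φ) : initialAmplitude κ α k = toLTwo (initialPhase η κ α (eikonal η k)) := by
  classical
  have h := (toLTwo.comp (coord (eikonal η k))).hasSum (hα.hasSum_initialPhase η)
  refine HasSum.tsum_eq ?_
  refine (hasSum_subtype_iff_indicator (f := fun j => (α j).toLp 2)
    (s := {j : J₀ | κ j = (k : Fin d → ℤ)})).2 ?_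
  refine h.congr_fun fun j => ?_
  rw [ContinuousLinearMap.comp_apply]
  by_cases hj : κ j = (k : Fin d → ℤ)
  · rw [indicator_of_mem (by exact hj), ← toLTwo_ofSchwartz]
    congr 1
    refine ((PhaseAlg.single_apply _ _ _).trans (if_pos ?_)).symm
    rw [hj]; rfl
  · rw [indicator_of_notMem (by exact hj)]
    refine (map_zero toLTwo).symm.trans ?_
    congr 1
    refine ((PhaseAlg.single_apply _ _ _).trans (if_neg fun h' => hj ?_)).symm
    exact (congrArg Prod.fst h').symm

lemma SummableAmplitudes.initialDatum_eq (hα : SummableAmplitudes κ α) (η : Fin d → ℤ) (ε : ℝ) :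
    initialDatum κ α ε = toLTwo (ev ε 0 (initialPhase η κ α)) := by
  have h := (toLTwo.comp (ev ε 0)).hasSum (hα.hasSum_initialPhase η)
  rw [ContinuousLinearMap.comp_apply] at h
  rw [← h.tsum_eq, initialDatum]
  refine tsum_congr fun j => ?_
  rw [ContinuousLinearMap.comp_apply, PhaseAlg.ev_single]
  refine toL2_eq_of_ae_eq ?_
  have h1 : (toLTwo (ofSchwartz (α j)) : Space d → ℂ) =ᵐ[volume] α j := by
    rw [toLTwo_ofSchwartz]
    exact (α j).coeFn_toLp 2
  filter_upwards [toLTwo_wave ε 0 (κ j, quadForm η (κ j)) (ofSchwartz (α j)), h1] with z hz hz1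
  rw [hz, hz1]
  simp

end

/-! ### The Schrödinger equation in `L^∞ ∩ L²` -/

/-- A function is bounded by the `L¹` norm of its Fourier transform. -/
lemma linftyL2Norm_le_wienerL2Norm (f : L2 d) : linftyL2Norm f ≤ wienerL2Norm f := by
  by_cases h : wienerL2Norm f = ∞
  · rw [h]; exact le_top
  obtain ⟨x, rfl⟩ := WienerAlg.exists_toLTwo_eq (lt_top_iff_ne_top.2 h)
  refine add_le_add ?_ le_rfl
  rw [eLpNorm_exponent_top, WienerAlg.fourier_toLTwo]
  exact essSup_le_of_ae_le _ x.enorm_toLTwo_apply_le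

lemma linftyL2Norm_add_le (f g : L2 d) :
    linftyL2Norm (f + g) ≤ linftyL2Norm f + linftyL2Norm g := by
  unfold linftyL2Norm
  rw [add_add_add_comm, eLpNorm_congr_ae (Lp.coeFn_add f g), eLpNorm_congr_ae (Lp.coeFn_add f g)]
  exact add_le_add
    (eLpNorm_add_le (Lp.aestronglyMeasurable _) (Lp.aestronglyMeasurable _) le_top)
    (eLpNorm_add_le (Lp.aestronglyMeasurable _) (Lp.aestronglyMeasurable _) one_le_two)

lemma enorm_le_linftyL2Norm (f : L2 d) : ‖f‖ₑ ≤ linftyL2Norm f := by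
  rw [Lp.enorm_def]; exact le_add_self

lemma ae_norm_le_of_linftyL2Norm_le {f : L2 d} {R : ℝ} (hR : 0 ≤ R)
    (h : linftyL2Norm f ≤ ENNReal.ofReal R) : ∀ᵐ x, ‖f x‖ ≤ R := by
  filter_upwards [ae_le_eLpNormEssSup (f := f) (μ := volume)] with x hx
  rw [← eLpNorm_exponent_top] at hx
  have h1 := (hx.trans le_self_add).trans h
  rw [← ofReal_norm] at h1
  exact (ENNReal.ofReal_le_ofReal_iff hR).1 h1

/-- A function in `C([0,T]; L^∞ ∩ L²)` is bounded. -/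
lemma ContinuousInNorm.exists_linftyL2Norm_le {T : ℝ} {v : ℝ → L2 d}
    (hv : ContinuousInNorm linftyL2Norm T v) :
    ∃ R : ℝ, 0 ≤ R ∧ ∀ t ∈ Icc 0 T, linftyL2Norm (v t) ≤ ENNReal.ofReal R := by
  refine isCompact_Icc.induction_on
    (p := fun s => ∃ R : ℝ, 0 ≤ R ∧ ∀ t ∈ s, linftyL2Norm (v t) ≤ ENNReal.ofReal R)
    ⟨0, le_rfl, fun t ht => absurd ht (notMem_empty t)⟩
    (fun s t hst ⟨R, h0, hR⟩ => ⟨R, h0, fun r hr => hR r (hst hr)⟩)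
    (fun s t ⟨R, h0, hR⟩ ⟨R', h0', hR'⟩ => ⟨max R R', h0.trans (le_max_left _ _), fun r hr =>
      hr.elim (fun h => (hR r h).trans (ENNReal.ofReal_le_ofReal (le_max_left _ _)))
        (fun h => (hR' r h).trans (ENNReal.ofReal_le_ofReal (le_max_right _ _)))⟩)
    fun t ht => ?_
  obtain ⟨h1, h2⟩ := hv t ht
  refine ⟨_, h2.eventually_le_const zero_lt_one, (linftyL2Norm (v t)).toReal + 1, by positivity,
    fun s hs => ?_⟩
  rw [ENNReal.ofReal_add ENNReal.toReal_nonneg zero_le_one, ENNReal.ofReal_toReal h1.ne,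
    ENNReal.ofReal_one]
  calc linftyL2Norm (v s) = linftyL2Norm (v t + (v s - v t)) := by rw [add_sub_cancel]
    _ ≤ _ := (linftyL2Norm_add_le _ _).trans (add_le_add le_rfl hs)

lemma coeFn_fourier_multiplier {m : Space d → ℂ} (hm : BddSymbol m) (f : L2 d) :
    (𝓕 (multiplier m f) : L2 d) =ᵐ[volume] fun ξ => m ξ * (𝓕 f : L2 d) ξ := by
  rw [multiplier, FourierInvPair.fourier_fourierInv_eq]
  exact coeFn_toL2 (hm.memLp_mul (Lp.memLp _))

lemma ext_fourier {f g : L2 d} (h : (𝓕 f : L2 d) =ᵐ[volume] (𝓕 g : L2 d)) : f = g := by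
  have h1 : (𝓕⁻ (𝓕 f : L2 d) : L2 d) = 𝓕⁻ (𝓕 g : L2 d) := by rw [Lp.ext h]
  rwa [FourierPair.fourierInv_fourier_eq, FourierPair.fourierInv_fourier_eq] at h1

lemma norm_multiplier_le {m : Space d → ℂ} (hm : BddSymbol m) {C : ℝ} (hC : ∀ ξ, ‖m ξ‖ ≤ C)
    (f : L2 d) : ‖multiplier m f‖ ≤ C * ‖f‖ := by
  rw [← Lp.norm_fourier_eq f, ← Lp.norm_fourier_eq]
  refine Lp.norm_le_mul_norm_of_ae_le_mul ?_
  filter_upwards [coeFn_fourier_multiplier hm f] with ξ h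
  rw [h, norm_mul]
  gcongr
  exact hC ξ

/-- A Fourier multiplier as a bounded operator on `L²`. -/
def multiplierL {m : Space d → ℂ} (hm : BddSymbol m) : L2 d →L[ℂ] L2 d :=
  LinearMap.mkContinuousOfExistsBound
    { toFun := multiplier m
      map_add' := fun f g => ext_fourier <| by
        rw [FourierTransform.fourier_add (multiplier m f)]
        filter_upwards [coeFn_fourier_multiplier hm (f + g), coeFn_fourier_multiplier hm f,
          coeFn_fourier_multiplier hm g, Lp.coeFn_add (𝓕 f : L2 d) (𝓕 g),
          Lp.coeFn_add (𝓕 (multiplier m f) : L2 d) (𝓕 (multiplier m g))] with ξ h1 h2 h3 h4 h5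
        rw [h1, h5, FourierTransform.fourier_add, h4, Pi.add_apply, Pi.add_apply, h2, h3, mul_add]
      map_smul' := fun c f => ext_fourier <| by
        rw [RingHom.id_apply, FourierTransform.fourier_smul c (multiplier m f)]
        filter_upwards [coeFn_fourier_multiplier hm (c • f), coeFn_fourier_multiplier hm f,
          Lp.coeFn_smul c (𝓕 f : L2 d),
          Lp.coeFn_smul c (𝓕 (multiplier m f) : L2 d)] with ξ h1 h2 h3 h4
        rw [h1, h4, FourierTransform.fourier_smul, h3, Pi.smul_apply, Pi.smul_apply, h2,
          smul_eq_mul, smul_eq_mul]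
        ring }
    (by
      obtain ⟨C, hC⟩ := hm.2
      exact ⟨C, norm_multiplier_le hm hC⟩)

lemma multiplierL_apply {m : Space d → ℂ} (hm : BddSymbol m) (f : L2 d) :
    multiplierL hm f = multiplier m f := rfl

lemma tendsto_multiplier {ι : Type*} {l : Filter ι} [l.IsCountablyGenerated]
    {m : ι → Space d → ℂ} {m₀ : Space d → ℂ} {C : ℝ} (hm : ∀ i, Measurable (m i))
    (hC : ∀ i ξ, ‖m i ξ‖ ≤ C) (hm₀ : BddSymbol m₀)
    (h : ∀ ξ, Tendsto (fun i => m i ξ) l (𝓝 (m₀ ξ))) (f : L2 d) :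
    Tendsto (fun i => multiplier (m i) f) l (𝓝 (multiplier m₀ f)) := by
  obtain ⟨C₀, hC₀⟩ := hm₀.2
  rw [tendsto_iff_norm_sub_tendsto_zero]
  have key : Tendsto (fun i => ‖multiplier (m i) f - multiplier m₀ f‖ₑ) l (𝓝 0) := by
    have e : ∀ i, ‖multiplier (m i) f - multiplier m₀ f‖ₑ
        = eLpNorm (fun ξ => (m i ξ - m₀ ξ) * (𝓕 f : L2 d) ξ) 2 volume := fun i => by
      have h1 : ‖multiplier (m i) f - multiplier m₀ f‖ₑ
          = ‖(𝓕 (multiplier (m i) f) : L2 d) - 𝓕 (multiplier m₀ f)‖ₑ := by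
        have h2 : (𝓕 (multiplier (m i) f - multiplier m₀ f) : L2 d)
            = 𝓕 (multiplier (m i) f) - 𝓕 (multiplier m₀ f) :=
          map_sub (Lp.fourierTransformₗᵢ (Space d) ℂ) _ _
        rw [← h2, ← ofReal_norm, ← ofReal_norm, Lp.norm_fourier_eq]
      rw [h1, Lp.enorm_def]
      refine eLpNorm_congr_ae ?_
      filter_upwards [Lp.coeFn_sub (𝓕 (multiplier (m i) f) : L2 d) (𝓕 (multiplier m₀ f)),
        coeFn_fourier_multiplier ⟨hm i, C, hC i⟩ f, coeFn_fourier_multiplier hm₀ f] with ξ h2 h3 h4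
      rw [h2, Pi.sub_apply, h3, h4, sub_mul]
    simp only [e]
    exact tendsto_eLpNorm_mul_zero (C := C + C₀) (by norm_num) (by norm_num)
      (Eventually.of_forall fun i => (hm i).sub hm₀.1)
      (Eventually.of_forall fun i ξ => (norm_sub_le _ _).trans (add_le_add (hC i ξ) (hC₀ ξ)))
      (Lp.memLp _) (ae_of_all _ fun ξ => by simpa using (h ξ).sub_const (m₀ ξ))
  have := (ENNReal.tendsto_toReal ENNReal.zero_ne_top).comp key
  simpa [Function.comp_def] using this

/-- The free Schrödinger group as a group of bounded operators on `L²`. -/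
def schroL2 (η : Fin d → ℤ) (ε t : ℝ) : L2 d →L[ℂ] L2 d := multiplierL (bddSymbol_schro η ε t)

lemma isContractionGroup_schroL2 (η : Fin d → ℤ) (ε : ℝ) :
    IsContractionGroup (schroL2 η ε) where
  zero f := ext_fourier <| by
    filter_upwards [coeFn_fourier_multiplier (bddSymbol_schro η ε 0) f] with ξ h
    exact h.trans (by rw [schroSymbol_zero, one_mul])
  add s t f := ext_fourier <| by
    filter_upwards [coeFn_fourier_multiplier (bddSymbol_schro η ε (s + t)) f,
      coeFn_fourier_multiplier (bddSymbol_schro η ε t) f,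
      coeFn_fourier_multiplier (bddSymbol_schro η ε s) (schroL2 η ε t f)] with ξ h1 h2 h3
    refine h3.trans (Eq.trans ?_ h1.symm)
    have h2' : (𝓕 (schroL2 η ε t f) : L2 d) ξ = _ := h2
    rw [h2', schroSymbol_add, mul_assoc]
  norm_le t f :=
    (norm_multiplier_le (bddSymbol_schro η ε t) (fun ξ => (norm_schroSymbol ..).le) f).trans_eq
      (one_mul _)
  cont f := continuous_iff_continuousAt.2 fun t =>
    tendsto_multiplier (C := 1) (measurable_schroSymbol η ε) (fun i ξ => (norm_schroSymbol ..).le)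
      (bddSymbol_schro η ε t) (fun ξ => by
        have : Continuous fun t => schroSymbol η ε t ξ := by unfold schroSymbol; fun_prop
        exact this.tendsto t) f

lemma norm_le_of_ae_le_three {f g h k : L2 d} {a b c : ℝ} (ha : 0 ≤ a) (hb : 0 ≤ b) (hc : 0 ≤ c)
    (H : ∀ᵐ x, ‖f x‖ ≤ a * ‖g x‖ + b * ‖h x‖ + c * ‖k x‖) :
    ‖f‖ ≤ a * ‖g‖ + b * ‖h‖ + c * ‖k‖ := by
  have e : ∀ (r : ℝ), 0 ≤ r → ∀ φ : L2 d,
      eLpNorm (fun x => r * ‖φ x‖) 2 volume = ENNReal.ofReal (r * ‖φ‖) := fun r hr φ => by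
    have h1 := eLpNorm_const_smul (μ := (volume : Measure (Space d))) (p := 2) r (fun x => ‖φ x‖)
    rw [eLpNorm_norm] at h1
    refine h1.trans ?_
    rw [ENNReal.ofReal_mul hr, ofReal_norm, Lp.enorm_def, ← ofReal_norm, Real.norm_of_nonneg hr]
  have m : ∀ (r : ℝ) (φ : L2 d), AEStronglyMeasurable (fun x => r * ‖φ x‖) volume := fun r φ =>
    (Lp.aestronglyMeasurable φ).norm.const_mul r
  have h1 : ‖f‖ₑ ≤ ENNReal.ofReal (a * ‖g‖ + b * ‖h‖ + c * ‖k‖) := by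
    rw [Lp.enorm_def, ENNReal.ofReal_add (by positivity) (by positivity),
      ENNReal.ofReal_add (by positivity) (by positivity), ← e a ha, ← e b hb, ← e c hc]
    refine (eLpNorm_mono_ae_real H).trans ?_
    refine (eLpNorm_add_le ((m a g).add (m b h)) (m c k) one_le_two).trans ?_
    exact add_le_add (eLpNorm_add_le (m a g) (m b h) one_le_two) le_rfl
  rw [← ofReal_norm] at h1
  exact (ENNReal.ofReal_le_ofReal_iff (by positivity)).1 h1

section
variable {ν : ℕ} {lam mu Λ R : ℝ} {Khat : Space d → ℂ} {w w' h : L2 d}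

/-- The density `|w|^{2ν}` is in `L²`, for bounded `w` in `L²`. -/
lemma memLp_norm_pow (hν : 1 ≤ ν) (hw : ∀ᵐ x, ‖w x‖ ≤ R) :
    MemLp (fun x => ((‖w x‖ ^ (2 * ν) : ℝ) : ℂ)) 2 volume := by
  refine MemLp.of_le_mul (c := R ^ (2 * ν - 1)) (Lp.memLp w)
    (Complex.continuous_ofReal.comp_aestronglyMeasurable
      ((Lp.aestronglyMeasurable w).norm.pow _)) ?_
  filter_upwards [hw] with x hx
  rw [Complex.norm_real, norm_pow, norm_norm, ← Nat.sub_add_cancel (show 1 ≤ 2 * ν by omega),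
    pow_succ, Nat.add_sub_cancel]
  gcongr

lemma memLp_nlsNonlinearity (hw : ∀ᵐ x, ‖w x‖ ≤ R) :
    MemLp (fun x =>
      (lam : ℂ) * multiplier Khat (toL2 (fun y => ((‖w y‖ ^ (2 * ν) : ℝ) : ℂ))) x * w x
        + (mu : ℂ) * ((‖w x‖ ^ (2 * ν) : ℝ) : ℂ) * w x) 2 volume := by
  have hwm := Lp.aestronglyMeasurable w
  refine MemLp.add ?_ ?_
  · refine MemLp.of_le_mul (c := ‖(lam : ℂ)‖ * R) (Lp.memLp (multiplier Khat
      (toL2 (fun y => ((‖w y‖ ^ (2 * ν) : ℝ) : ℂ)))))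
      (((Lp.aestronglyMeasurable _).const_mul _).mul hwm) ?_
    filter_upwards [hw] with x hx
    rw [norm_mul, norm_mul, mul_right_comm]
    gcongr
  · refine MemLp.of_le_mul (c := ‖(mu : ℂ)‖ * R ^ (2 * ν)) (Lp.memLp w)
      (((Complex.continuous_ofReal.comp_aestronglyMeasurable (hwm.norm.pow _)).const_mul _).mul
        hwm) ?_
    filter_upwards [hw] with x hx
    rw [norm_mul, norm_mul, Complex.norm_real (‖w x‖ ^ (2 * ν)), norm_pow, norm_norm]
    gcongr

lemma abs_norm_pow_sub_le (N : ℕ) {z z' : ℂ} (hz : ‖z‖ ≤ R) (hz' : ‖z'‖ ≤ R) :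
    |‖z‖ ^ N - ‖z'‖ ^ N| ≤ N * R ^ (N - 1) * ‖z - z'‖ := by
  refine (abs_pow_sub_pow_le _ _ _).trans ?_
  rw [abs_norm, abs_norm]
  calc _ ≤ ‖z - z'‖ * N * R ^ (N - 1) := by
        gcongr
        · exact abs_norm_sub_norm_le z z'
        · exact max_le hz hz'
    _ = _ := by ring

/-- The Lipschitz constant of the density `|z|^{2ν}` on the disc of radius `R`. -/
def densityConst (ν : ℕ) (R : ℝ) : ℝ := (2 * ν : ℕ) * R ^ (2 * ν - 1)

lemma densityConst_nonneg (hR : 0 ≤ R) : 0 ≤ densityConst ν R := by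
  unfold densityConst; positivity

lemma norm_density_sub_le (hν : 1 ≤ ν) (hw : ∀ᵐ x, ‖w x‖ ≤ R) (hw' : ∀ᵐ x, ‖w' x‖ ≤ R) :
    ‖toL2 (fun y => ((‖w y‖ ^ (2 * ν) : ℝ) : ℂ)) - toL2 (fun y => ((‖w' y‖ ^ (2 * ν) : ℝ) : ℂ))‖
      ≤ densityConst ν R * ‖w - w'‖ := by
  refine Lp.norm_le_mul_norm_of_ae_le_mul ?_
  filter_upwards [hw, hw', Lp.coeFn_sub w w', coeFn_toL2 (memLp_norm_pow hν hw),
    coeFn_toL2 (memLp_norm_pow hν hw'), Lp.coeFn_sub (toL2 fun y => ((‖w y‖ ^ (2 * ν) : ℝ) : ℂ))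
      (toL2 fun y => ((‖w' y‖ ^ (2 * ν) : ℝ) : ℂ))] with x h1 h2 h3 h4 h5 h6
  rw [h6, h3, Pi.sub_apply, Pi.sub_apply, h4, h5, ← Complex.ofReal_sub, Complex.norm_real]
  exact abs_norm_pow_sub_le (2 * ν) h1 h2

/-- The nonlinearity is Lipschitz on bounded subsets of `L^∞`, in the norm of `L²`, up to a term in
which the nonlocal factor stays fixed. The operator `E` is not bounded on `L^∞`; this term is
controlled through `h`. -/
lemma norm_nlsNonlinearity_sub_le (hν : 1 ≤ ν) (hK : BddSymbol Khat) (hΛ : ∀ ξ, ‖Khat ξ‖ ≤ Λ)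
    (hR : 0 ≤ R) (hw : ∀ᵐ x, ‖w x‖ ≤ R) (hw' : ∀ᵐ x, ‖w' x‖ ≤ R)
    (hh : ∀ᵐ x, ‖multiplier Khat (toL2 (fun y => ((‖w' y‖ ^ (2 * ν) : ℝ) : ℂ))) x‖ * ‖(w - w') x‖
      ≤ ‖h x‖) :
    ‖nlsNonlinearity ν lam mu Khat w - nlsNonlinearity ν lam mu Khat w'‖
      ≤ (|lam| * R * (Λ * densityConst ν R) + |mu| * (densityConst ν R * R + R ^ (2 * ν)))
          * ‖w - w'‖ + |lam| * ‖h‖ := by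
  have hΛ0 : 0 ≤ Λ := (norm_nonneg _).trans (hΛ 0)
  have hD := densityConst_nonneg (ν := ν) hR
  set e := multiplier Khat (toL2 (fun y => ((‖w y‖ ^ (2 * ν) : ℝ) : ℂ))) with he
  set e' := multiplier Khat (toL2 (fun y => ((‖w' y‖ ^ (2 * ν) : ℝ) : ℂ))) with he'
  have hee : ‖e - e'‖ ≤ Λ * (densityConst ν R * ‖w - w'‖) := by
    rw [he, he', ← multiplierL_apply hK, ← multiplierL_apply hK, ← map_sub, multiplierL_apply]
    exact (norm_multiplier_le hK hΛ _).trans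
      (mul_le_mul_of_nonneg_left (norm_density_sub_le hν hw hw') hΛ0)
  have key := norm_le_of_ae_le_three
    (f := nlsNonlinearity ν lam mu Khat w - nlsNonlinearity ν lam mu Khat w') (g := e - e')
    (h := h) (k := w - w') (a := |lam| * R) (b := |lam|)
    (c := |mu| * (densityConst ν R * R + R ^ (2 * ν))) (by positivity) (by positivity)
    (by positivity) ?_
  · refine key.trans ?_
    have := mul_le_mul_of_nonneg_left hee (show 0 ≤ |lam| * R by positivity)
    nlinarith
  filter_upwards [hw, hw', hh, Lp.coeFn_sub w w', Lp.coeFn_sub e e', Lp.coeFn_sub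
    (nlsNonlinearity ν lam mu Khat w) (nlsNonlinearity ν lam mu Khat w'),
    coeFn_toL2 (memLp_nlsNonlinearity (ν := ν) (lam := lam) (mu := mu) (Khat := Khat) hw),
    coeFn_toL2 (memLp_nlsNonlinearity (ν := ν) (lam := lam) (mu := mu) (Khat := Khat) hw')]
    with x h1 h2 h3 h4 h5 h6 h7 h8
  rw [h4, Pi.sub_apply] at h3
  rw [h6, h4, h5, Pi.sub_apply, Pi.sub_apply, Pi.sub_apply, nlsNonlinearity, h7, nlsNonlinearity,
    h8, ← he, ← he']
  have hp := abs_norm_pow_sub_le (2 * ν) h1 h2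
  -- the difference is multiplied with `E(|w'|^{2ν})`, never with `E(|w|^{2ν})`
  have hid : (lam : ℂ) * e x * w x + (mu : ℂ) * ((‖w x‖ ^ (2 * ν) : ℝ) : ℂ) * w x
      - ((lam : ℂ) * e' x * w' x + (mu : ℂ) * ((‖w' x‖ ^ (2 * ν) : ℝ) : ℂ) * w' x)
      = (lam : ℂ) * ((e x - e' x) * w x) + (lam : ℂ) * (e' x * (w x - w' x))
        + (mu : ℂ) * (((‖w x‖ ^ (2 * ν) - ‖w' x‖ ^ (2 * ν) : ℝ) : ℂ) * w x
          + ((‖w' x‖ ^ (2 * ν) : ℝ) : ℂ) * (w x - w' x)) := by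
    push_cast; ring
  rw [hid]
  have hl : ‖(lam : ℂ)‖ = |lam| := Complex.norm_real lam
  have hm : ‖(mu : ℂ)‖ = |mu| := Complex.norm_real mu
  refine (norm_add₃_le).trans ?_
  refine add_le_add (add_le_add ?_ ?_) ?_
  · rw [norm_mul, norm_mul, hl, mul_assoc, mul_comm R]
    gcongr
  · rw [norm_mul, norm_mul, hl]
    gcongr
  · rw [norm_mul, hm, mul_assoc]
    gcongr
    refine (norm_add_le _ _).trans ?_
    rw [norm_mul, norm_mul, Complex.norm_real, Complex.norm_real, norm_pow, norm_norm, add_mul]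
    refine add_le_add ?_ (by gcongr)
    calc _ ≤ densityConst ν R * ‖w x - w' x‖ * R := by
          gcongr
          exact hp
      _ = _ := by ring

end

lemma ContinuousInNorm.of_wienerL2Norm {T : ℝ} {u : ℝ → L2 d}
    (hu : ContinuousInNorm wienerL2Norm T u) : ContinuousInNorm linftyL2Norm T u := fun t ht =>
  ⟨(linftyL2Norm_le_wienerL2Norm _).trans_lt (hu t ht).1,
    tendsto_of_tendsto_of_tendsto_of_le_of_le tendsto_const_nhds (hu t ht).2
      (fun _ => zero_le) fun _ => linftyL2Norm_le_wienerL2Norm _⟩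

lemma continuousInNorm_toLTwo {x : ℝ → WienerAlg d} (hx : Continuous x) {T : ℝ} {u : ℝ → L2 d}
    (hu : ∀ t ∈ Icc 0 T, u t = toLTwo (x t)) : ContinuousInNorm wienerL2Norm T u := fun t ht => by
  refine ⟨by rw [hu t ht, WienerAlg.wienerL2Norm_toLTwo]; exact enorm_lt_top, ?_⟩
  refine (tendsto_enorm_sub hx).congr' ?_
  filter_upwards [self_mem_nhdsWithin] with s hs
  rw [hu s hs, hu t ht, ← map_sub, WienerAlg.wienerL2Norm_toLTwo]

section
variable {ν n : ℕ} {lam mu : ℝ} {η : Fin d → ℤ} {Khat : Space d → ℂ} {ε T : ℝ}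
  {x₀ : WienerAlg d} {x : ℝ → WienerAlg d}

lemma neg_I_smul_integral {f : ℝ → L2 d} (t : ℝ) :
    -Complex.I • ∫ τ in (0 : ℝ)..t, f τ = ∫ τ in (0 : ℝ)..t, -Complex.I • f τ :=
  (intervalIntegral.integral_smul _ _).symm

/-- A solution in `W ∩ L²` is a solution in `L²`. -/
lemma isNLSSolution_toLTwo (hn : 2 * ν = n + 1) (hK : BddSymbol Khat) (hT : 0 ≤ T)
    (hx : Continuous x) (h : ∀ t ∈ Icc 0 T, x t = schro η ε t x₀
      + ∫ τ in (0 : ℝ)..t, schro η ε (t - τ) (-Complex.I • wienerNonlin lam mu n Khat (x τ))) :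
    IsNLSSolution ν lam mu η Khat ε T (toLTwo x₀) fun t => toLTwo (x t) where
  init := by
    rw [h 0 ⟨le_rfl, hT⟩, schro_zero, intervalIntegral.integral_same, add_zero]
  duhamel t ht := by
    have hc : Continuous fun τ =>
        schro η ε (t - τ) (-Complex.I • wienerNonlin lam mu n Khat (x τ)) :=
      (isContractionGroup_schro η ε).continuous_apply (by fun_prop)
        (((continuous_wienerNonlin lam mu n Khat).comp hx).const_smul (-Complex.I))
    rw [h t ht, map_add, ← schrodingerGroup_toLTwo, sub_eq_add_neg, ← neg_smul,
      neg_I_smul_integral, ← toLTwo.intervalIntegral_comp_comm (hc.intervalIntegrable _ _)]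
    congr 1
    refine intervalIntegral.integral_congr fun τ _ => ?_
    beta_reduce
    rw [nlsNonlinearity_toLTwo hn hK, schrodingerGroup_toLTwo, map_smul, map_smul]

lemma continuousOn_nlsNonlinearity (hν : 1 ≤ ν) (hK : BddSymbol Khat) {v : ℝ → L2 d}
    (hv : ContinuousInNorm linftyL2Norm T v) {R : ℝ} (hR : 0 ≤ R)
    (hvR : ∀ t ∈ Icc 0 T, ∀ᵐ x, ‖v t x‖ ≤ R) (lam mu : ℝ) :
    ContinuousOn (fun t => nlsNonlinearity ν lam mu Khat (v t)) (Icc 0 T) := by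
  obtain ⟨Λ, hΛ⟩ := hK.2
  intro t ht
  set c := |lam| * R * (Λ * densityConst ν R) + |mu| * (densityConst ν R * R + R ^ (2 * ν))
  set e := multiplier Khat (toL2 (fun y => ((‖v t y‖ ^ (2 * ν) : ℝ) : ℂ))) with he
  have hN : Tendsto (fun s => (linftyL2Norm (v s - v t)).toReal)
      (𝓝[Icc 0 T] t) (𝓝 0) := by
    simpa [Function.comp_def] using (ENNReal.tendsto_toReal ENNReal.zero_ne_top).comp (hv t ht).2
  have hfin : ∀ᶠ s in 𝓝[Icc 0 T] t, linftyL2Norm (v s - v t) < ∞ :=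
    (hv t ht).2.eventually_lt_const ENNReal.zero_lt_top
  have hb : ∀ᶠ s in 𝓝[Icc 0 T] t,
      ‖nlsNonlinearity ν lam mu Khat (v s) - nlsNonlinearity ν lam mu Khat (v t)‖
        ≤ (|c| + |lam| * ‖e‖) * (linftyL2Norm (v s - v t)).toReal := by
    filter_upwards [hfin, self_mem_nhdsWithin] with s hs hsT
    set r := (linftyL2Norm (v s - v t)).toReal with hr
    have hr0 : 0 ≤ r := ENNReal.toReal_nonneg
    have hle : linftyL2Norm (v s - v t) ≤ ENNReal.ofReal r :=
      (ENNReal.ofReal_toReal hs.ne).ge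
    have h1 : ‖v s - v t‖ ≤ r := by
      have := (enorm_le_linftyL2Norm _).trans hle
      rw [← ofReal_norm] at this
      exact (ENNReal.ofReal_le_ofReal_iff hr0).1 this
    -- `E(|v(t)|^{2ν})` is only in `L²`, but it multiplies a difference that is small in `L^∞`
    refine (norm_nlsNonlinearity_sub_le (h := (r : ℂ) • e) hν hK hΛ hR (hvR s hsT) (hvR t ht)
      ?_).trans ?_
    · filter_upwards [ae_norm_le_of_linftyL2Norm_le hr0 hle, Lp.coeFn_smul (r : ℂ) e] with x h2 h3
      rw [h3, Pi.smul_apply, norm_smul, Complex.norm_real, Real.norm_of_nonneg hr0, mul_comm]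
      gcongr
    · rw [norm_smul, Complex.norm_real, Real.norm_of_nonneg hr0, add_mul |c|]
      refine add_le_add ((mul_le_mul_of_nonneg_right (le_abs_self c) (norm_nonneg _)).trans
        (mul_le_mul_of_nonneg_left h1 (abs_nonneg c))) (le_of_eq ?_)
      ring
  refine tendsto_iff_norm_sub_tendsto_zero.2
    (squeeze_zero' (Eventually.of_forall fun _ => norm_nonneg _) hb ?_)
  simpa using hN.const_mul (|c| + |lam| * ‖e‖)

lemma ContinuousInNorm.continuousOn {v : ℝ → L2 d} (hv : ContinuousInNorm linftyL2Norm T v) :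
    ContinuousOn v (Icc 0 T) := fun t ht => by
  refine tendsto_iff_norm_sub_tendsto_zero.2 ?_
  have h : Tendsto (fun s => ‖v s - v t‖ₑ) (𝓝[Icc 0 T] t) (𝓝 0) :=
    tendsto_of_tendsto_of_tendsto_of_le_of_le tendsto_const_nhds (hv t ht).2
      (fun _ => zero_le) fun _ => enorm_le_linftyL2Norm _
  simpa [Function.comp_def] using (ENNReal.tendsto_toReal ENNReal.zero_ne_top).comp h

/-- Two continuous curves that solve Duhamel's formula, and whose nonlinear terms differ by at
most a multiple of the difference of the curves, are equal. -/
lemma eq_of_duhamel {S : ℝ → L2 d →L[ℂ] L2 d} (hS : IsContractionGroup S) {L : ℝ} (hL : 0 ≤ L)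
    (hT : 0 ≤ T) {u₀ : L2 d} {u v f g : ℝ → L2 d} (hu : ContinuousOn u (Icc 0 T))
    (hv : ContinuousOn v (Icc 0 T)) (hf : ContinuousOn f (Icc 0 T)) (hg : ContinuousOn g (Icc 0 T))
    (hfg : ∀ t ∈ Icc 0 T, ‖f t - g t‖ ≤ L * ‖u t - v t‖)
    (hu' : ∀ t ∈ Icc 0 T, u t = S t u₀ - Complex.I • ∫ τ in (0 : ℝ)..t, S (t - τ) (f τ))
    (hv' : ∀ t ∈ Icc 0 T, v t = S t u₀ - Complex.I • ∫ τ in (0 : ℝ)..t, S (t - τ) (g τ)) :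
    ∀ t ∈ Icc 0 T, u t = v t := by
  obtain ⟨p, hpc, hpm, hpe⟩ := exists_clamp hT
  have hfc := hf.comp_continuous hpc hpm
  have hgc := hg.comp_continuous hpc hpm
  have hd : Continuous fun t => ‖u (p t) - v (p t)‖ :=
    ((hu.comp_continuous hpc hpm).sub (hv.comp_continuous hpc hpm)).norm
  have key := gronwall_integral hd (fun t => norm_nonneg _) le_rfl hL (T := T) fun t ht => ?_
  · intro t ht
    have := key t ht
    rw [zero_mul, hpe t ht] at this
    exact sub_eq_zero.1 (norm_le_zero_iff.1 this)
  have hc1 : Continuous fun τ => S (t - τ) (f (p τ)) := hS.continuous_apply (by fun_prop) hfc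
  have hc2 : Continuous fun τ => S (t - τ) (g (p τ)) := hS.continuous_apply (by fun_prop) hgc
  have hclamp : ∀ h : ℝ → L2 d, ∫ τ in (0 : ℝ)..t, S (t - τ) (h τ)
      = ∫ τ in (0 : ℝ)..t, S (t - τ) (h (p τ)) := fun h =>
    intervalIntegral.integral_congr fun τ hτ => by
      rw [uIcc_of_le ht.1] at hτ
      beta_reduce
      rw [hpe τ ⟨hτ.1, hτ.2.trans ht.2⟩]
  have e : u (p t) - v (p t)
      = -(Complex.I • ∫ τ in (0 : ℝ)..t, S (t - τ) (f (p τ) - g (p τ))) := by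
    simp only [map_sub]
    rw [intervalIntegral.integral_sub (hc1.intervalIntegrable _ _) (hc2.intervalIntegrable _ _),
      hpe t ht, hu' t ht, hv' t ht, hclamp f, hclamp g, smul_sub]
    abel
  rw [zero_add, e, norm_neg, norm_smul, Complex.norm_I, one_mul,
    ← intervalIntegral.integral_const_mul]
  refine intervalIntegral.norm_integral_le_of_norm_le ht.1 (ae_of_all _ fun τ _ => ?_)
    ((continuous_const.mul hd).intervalIntegrable _ _)
  exact (hS.norm_le _ _).trans (hfg _ (hpm τ))

/-- A solution in `W ∩ L²` is the only one in `L^∞ ∩ L²`. The nonlocal term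
`E(|u|^{2ν})` of the former is bounded, although `E` is not bounded on `L^∞`. -/
lemma IsNLSSolution.eq_toLTwo (hn : 2 * ν = n + 1) (hK : BddSymbol Khat) (hT : 0 ≤ T)
    (hx : Continuous x) {v : ℝ → L2 d}
    (hxs : IsNLSSolution ν lam mu η Khat ε T (toLTwo x₀) fun t => toLTwo (x t))
    (hvs : IsNLSSolution ν lam mu η Khat ε T (toLTwo x₀) v)
    (hv : ContinuousInNorm linftyL2Norm T v) : ∀ t ∈ Icc 0 T, v t = toLTwo (x t) := by
  have hν : 1 ≤ ν := by omega
  obtain ⟨Λ, hΛ⟩ := hK.2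
  have hΛ0 : 0 ≤ Λ := (norm_nonneg _).trans (hΛ 0)
  obtain ⟨R₁, h1, hR₁⟩ := hv.exists_linftyL2Norm_le
  obtain ⟨R₂, h2, hR₂⟩ := exists_norm_le_on_Icc hx T
  obtain ⟨M, hM0, hM⟩ := exists_norm_le_on_Icc
    ((symb Khat).continuous.comp ((continuous_altPow (n + 1)).comp hx)) T
  set R := max R₁ R₂
  have hR : 0 ≤ R := h1.trans (le_max_left _ _)
  have hvR : ∀ t ∈ Icc 0 T, ∀ᵐ z, ‖v t z‖ ≤ R := fun t ht =>
    ae_norm_le_of_linftyL2Norm_le hR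
      ((hR₁ t ht).trans (ENNReal.ofReal_le_ofReal (le_max_left _ _)))
  have hxR : ∀ t ∈ Icc 0 T, ∀ᵐ z, ‖toLTwo (x t) z‖ ≤ R := fun t ht => by
    filter_upwards [WienerAlg.norm_toLTwo_apply_le (x t)] with z hz
    exact hz.trans ((hR₂ t ht).trans (le_max_right _ _))
  have hxc : ContinuousInNorm linftyL2Norm T fun t => toLTwo (x t) :=
    (continuousInNorm_toLTwo hx fun _ _ => rfl).of_wienerL2Norm
  have hD := densityConst_nonneg (ν := ν) hR
  refine eq_of_duhamel (isContractionGroup_schroL2 η ε)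
    (L := |lam| * R * (Λ * densityConst ν R) + |mu| * (densityConst ν R * R + R ^ (2 * ν))
      + |lam| * M)
    (by positivity) hT hv.continuousOn hxc.continuousOn
    (continuousOn_nlsNonlinearity hν hK hv hR hvR lam mu)
    (continuousOn_nlsNonlinearity hν hK hxc hR hxR lam mu) (fun t ht => ?_)
    hvs.duhamel hxs.duhamel
  -- `M` bounds the nonlocal factor of the Wiener solution in `L^∞`
  refine (norm_nlsNonlinearity_sub_le (h := (M : ℂ) • (v t - toLTwo (x t))) hν hK hΛ hR (hvR t ht)
    (hxR t ht) ?_).trans_eq ?_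
  · rw [toL2_norm_pow hn, ← WienerAlg.toLTwo_symb hK]
    filter_upwards [WienerAlg.norm_toLTwo_apply_le (symb Khat (altPow (n + 1) (x t))),
      Lp.coeFn_smul (M : ℂ) (v t - toLTwo (x t))] with z hz hz'
    rw [hz', Pi.smul_apply, norm_smul, Complex.norm_real, Real.norm_of_nonneg hM0.le]
    gcongr
    exact hz.trans (hM t ht)
  · rw [norm_smul, Complex.norm_real, Real.norm_of_nonneg hM0.le]
    ring

end

/-! ### Resonances, existence and convergence -/

lemma mem_relevantSet_of_resonant {ν N : ℕ} (hN : N = 2 * ν + 1) {η : Fin d → ℤ}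
    {Φ₀ : Set (Fin d → ℤ)} (ℓ : Fin N → relevantSet ν η Φ₀) (k : Fin d → ℤ)
    (h : Resonant η (fun i => (ℓ i : Fin d → ℤ)) k) : k ∈ relevantSet ν η Φ₀ := by
  subst hN
  exact .resonance _ k (fun i => (ℓ i).2) h

end MultiphaseNLS

end

open MultiphaseNLS

theorem theorem1p1 (d ν : ℕ) (hd : 1 ≤ d) (hν : 1 ≤ ν) (lam mu : ℝ)
    (η : Fin d → ℤ) (hη : ∀ m, η m = 1 ∨ η m = -1)
    (K : 𝓢'(Space d, ℂ)) (Khat : Space d → ℂ) (hK : IsDegreeZeroKernel K Khat)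
    (J₀ : Set ℕ) (κ : J₀ → Fin d → ℤ) (α : J₀ → 𝓢(Space d, ℂ))
    (hα : SummableAmplitudes κ α) :
    -- the transport system has a local solution
    (∃ T : ℝ, 0 < T ∧ ∃ a : ℝ → relevantSet ν η (Set.range κ) → L2 d,
      IsProfile ν lam mu η Khat (initialAmplitude κ α) T a) ∧
    -- on any time interval on which it has a solution:
    ∀ T : ℝ, 0 < T → ∀ a : ℝ → relevantSet ν η (Set.range κ) → L2 d,
      IsProfile ν lam mu η Khat (initialAmplitude κ α) T a →
      -- this solution is unique
      (∀ b : ℝ → relevantSet ν η (Set.range κ) → L2 d,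
        IsProfile ν lam mu η Khat (initialAmplitude κ α) T b →
          ∀ t ∈ Set.Icc 0 T, b t = a t) ∧
      -- the approximate solution is continuous in time with values in `W ∩ L²` and `L^∞ ∩ L²`
      (∀ ε : ℝ, 0 < ε →
        ContinuousInNorm wienerL2Norm T (approxSolution η a ε) ∧
        ContinuousInNorm linftyL2Norm T (approxSolution η a ε)) ∧
      ∃ ε₀ C : ℝ, 0 < ε₀ ∧ 0 < C ∧ ∃ u : ℝ → ℝ → L2 d,
        -- existence and uniqueness of the exact solution
        (∀ ε : ℝ, 0 < ε → ε ≤ ε₀ →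
          IsNLSSolution ν lam mu η Khat ε T (initialDatum κ α ε) (u ε) ∧
          ContinuousInNorm wienerL2Norm T (u ε) ∧
          ContinuousInNorm linftyL2Norm T (u ε) ∧
          ∀ v : ℝ → L2 d, IsNLSSolution ν lam mu η Khat ε T (initialDatum κ α ε) v →
            ContinuousInNorm linftyL2Norm T v → ∀ t ∈ Set.Icc 0 T, v t = u ε t) ∧
        -- error estimates
        (∀ ε : ℝ, 0 < ε → ε ≤ ε₀ →
          (⨆ t ∈ Set.Icc 0 T, linftyL2Norm (u ε t - approxSolution η a ε t)) ≤
            ⨆ t ∈ Set.Icc 0 T, wienerL2Norm (u ε t - approxSolution η a ε t)) ∧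
        (lam ≠ 0 → Tendsto
          (fun ε : ℝ => ⨆ t ∈ Set.Icc 0 T, wienerL2Norm (u ε t - approxSolution η a ε t))
          (𝓝[>] 0) (𝓝 0)) ∧
        (lam = 0 → ∀ ε : ℝ, 0 < ε → ε ≤ ε₀ →
          (⨆ t ∈ Set.Icc 0 T, wienerL2Norm (u ε t - approxSolution η a ε t)) ≤
            ENNReal.ofReal (C * ε)) := by
  -- without a unit, the product `|u|^{2ν}` needs at least one factor; `n + 1` is their number
  obtain ⟨n, hn⟩ : ∃ n, 2 * ν = n + 1 := ⟨2 * ν - 1, by omega⟩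
  have hev : Even (n + 1) := hn ▸ even_two_mul ν
  have hKb := hK.bddSymbol
  set Φ := relevantSet ν η (Set.range κ)
  set b₀ := initialPhase η κ α
  have hκ : ∀ j, κ j ∈ Φ := fun j => .init _ ⟨j, rfl⟩
  have hb₀ : proj (resPhases η Φ) b₀ = b₀ := hα.proj_initialPhase hκ
  have hα₀ := fun k : Φ => hα.initialAmplitude_eq η k
  refine ⟨?_, fun T hT a ha => ?_⟩
  · obtain ⟨T, hT, b, hb⟩ := exists_isPhaseProfile lam mu n η hKb (resPhases η Φ) b₀
    exact ⟨T, hT, _, hb.isProfile hn hKb hT.le hb₀ hα₀⟩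
  obtain ⟨b, hb, hbS, hab⟩ := ha.exists_isPhaseProfile hn hKb hT.le hb₀ hα₀
  have happ : ∀ ε, ∀ t ∈ Set.Icc 0 T,
      approxSolution η a ε t = WienerAlg.toLTwo (PhaseAlg.ev ε t (b t)) := fun ε t ht =>
    approxSolution_eq (hbS t) (hab t ht)
  refine ⟨fun a' ha' t ht => ?_, fun ε _ => ?_, ?_⟩
  · obtain ⟨b', hb', -, hab'⟩ := ha'.exists_isPhaseProfile hn hKb hT.le hb₀ hα₀
    rw [hab t ht, hab' t ht, hb.unique hb' hKb t ht]
  · have h := continuousInNorm_toLTwo (continuous_ev ε hb.cont) (happ ε)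
    exact ⟨h, h.of_wienerL2Norm⟩
  obtain ⟨Y, hY⟩ := hα.weightBound η
  obtain ⟨ε₀, C, ρ, hε₀, hC, hρ, hρ0, hex⟩ := hb.exists_exact_solution hη hK (fun γ hγ => hγ.2)
    (phaseNonlin_apply_eq_zero hKb hev
      (fun ℓ k h => mem_relevantSet_of_resonant (by omega) ℓ k h) lam mu) hbS hT hY
  choose! w hwc hw herr using hex
  have hle : ∀ ε, 0 < ε → ε ≤ ε₀ →
      (⨆ t ∈ Set.Icc 0 T, wienerL2Norm (WienerAlg.toLTwo (w ε t) - approxSolution η a ε t))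
        ≤ ENNReal.ofReal (C * ε + ρ ε) := fun ε h0 h1 => iSup₂_le fun t ht => by
    rw [happ ε t ht, ← map_sub, WienerAlg.wienerL2Norm_toLTwo, ← ofReal_norm]
    exact ENNReal.ofReal_le_ofReal (herr ε h0 h1 t ht)
  refine ⟨ε₀, C, hε₀, hC, fun ε t => WienerAlg.toLTwo (w ε t), fun ε h0 h1 => ?_,
    fun ε _ _ => iSup₂_mono fun t _ => linftyL2Norm_le_wienerL2Norm _, fun _ => ?_,
    fun hlam ε h0 h1 => ?_⟩
  · rw [hα.initialDatum_eq η ε]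
    have hsol := isNLSSolution_toLTwo hn hKb hT.le (hwc ε h0 h1) (hw ε h0 h1)
    have hcont : ContinuousInNorm wienerL2Norm T fun t => WienerAlg.toLTwo (w ε t) :=
      continuousInNorm_toLTwo (hwc ε h0 h1) fun _ _ => rfl
    exact ⟨hsol, hcont, hcont.of_wienerL2Norm, fun v hv hvc =>
      hsol.eq_toLTwo hn hKb hT.le (hwc ε h0 h1) hv hvc⟩
  · have h1 : Tendsto (fun ε : ℝ => C * ε + ρ ε) (𝓝[>] 0) (𝓝 0) := by
      have h2 : Continuous fun ε : ℝ => C * ε := by fun_prop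
      simpa using ((h2.tendsto 0).mono_left nhdsWithin_le_nhds).add hρ
    have h3 := ENNReal.tendsto_ofReal h1
    rw [ENNReal.ofReal_zero] at h3
    refine tendsto_of_tendsto_of_tendsto_of_le_of_le' tendsto_const_nhds h3
      (Eventually.of_forall fun _ => zero_le) ?_
    filter_upwards [Ioc_mem_nhdsGT hε₀] with ε hε
    exact hle ε hε.1 hε.2
  · have := hle ε h0 h1
    rwa [hρ0 hlam, add_zero] at this
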